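/- **Conventions.** A gap constraint for a string $p\in\Sigma^*$ is a triple $C=(i,j,L)$ with $1\le i<j\le|p|$ and $L\subseteq\Sigma^*$. It is *regular* if $L$ is given by a (possibly incomplete) DFA $A$, with $\mathrm{size}(C)$ the number of states plus the number of defined transitions of $A$; it is a *semilinear length constraint* if $L=\{v : |v|\in S\}$ for a semilinear set $S=\bigcup_{r}L(x_{r,0};x_{r,1},\dots,x_{r,m_r})$ given by the numbers $x_{r,s}$, with $\mathrm{size}(C)=\sum_r(m_r+1)$, where $L(x_0;x_1,\dots,x_m)=\{x_0+\sum_{s=1}^m k_sx_s : k_s\in\mathbb{N}_0\}$. An instance of $\mathrm{MATCH}_{\mathcal L}$, $\mathcal L\in\{\mathrm{REG},\mathrm{SEMI}\}$, consists of a text $w$ and a pattern $p$ with $|p|\le|w|$ over an alphabet $\{1,\dots,\sigma\}$, $\sigma\le|w|$, and a non-empty finite set $\mathcal C$ of regular (respectively semilinear length) constraints for $p$ that contains at most one constraint for each pair $(i,j)$, where $\mathrm{size}(C)\le|w|^2$ (respectively $\mathrm{size}(C)\le|w|$) for all $C\in\mathcal C$. The question is whether there are positions $e(1)<\dots<e(|p|)$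 of $w$ with $w[e(i)]=p[i]$ for all $i$ and $w[e(i)+1..e(j)-1]\in L$ for all $(i,j,L)\in\mathcal C$. The set $\mathcal C$ is *non-intersecting* if for all $(i,j,L),(i',j',L')\in\mathcal C$ the intervals $[i,j-1]$ and $[i',j'-1]$ are disjoint or one contains the other; $\mathrm{MATCH}_{\mathcal L,\mathcal H}$ is the restriction of $\mathrm{MATCH}_{\mathcal L}$ to non-intersecting sets $\mathcal C$. Running times refer to the unit-cost RAM whose memory words have a length logarithmic in the input length (long enough to hold each number of the input, and to address the memory used within the time bound). SETH is the hypothesis that for every $\varepsilon>0$ there is a $k\in\mathbb{N}$ such that satisfiability of $k$-CNF formulas with $n$ variables and $m$ clauses cannot be solved in time $O(2^{n(1-\varepsilon)}\operatorname{poly}(m))$ for any polynomial. **Theorem.** Let $\mathcal L\in\{\mathrm{REG},\mathrm{SEMI}\}$ and let $g,h$ be real numbers with $g+h<3$. Unless SETH fails, $\mathrm{MATCH}_{\mathcal L,\mathcal H}$ cannot be solved in $O(|w|^g|\mathcal C|^h)$ time. Moreover, there is an absolute constant $s$ such that this holds already for the restriction to instances in which every constraint has size at most $s$. -/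

import Mathlib

/-! ### The unit-cost RAM with words of logarithmic length -/

namespace RAM

/-- Instructions of the RAM. Memory cells are indexed by natural numbers, and `d`, `a`, `b` are
(fixed) addresses of cells; `l` is a position in the program. Subtraction is truncated at `0`,
division rounds down. -/
inductive Instr where
  | const (d v : ℕ)
  | copy (d a : ℕ)
  | add (d a b : ℕ)
  | sub (d a b : ℕ)
  | mul (d a b : ℕ)
  | div (d a b : ℕ)
  | mod (d a b : ℕ)
  /-- `mem[d] := mem[mem[a]]` -/
  | load (d a : ℕ)
  /-- `mem[mem[d]] := mem[a]` -/
  | store (d a : ℕ)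
  /-- `mem[d] := input[mem[a]]` (and `0` beyond the end of the input) -/
  | read (d a : ℕ)
  | jump (l : ℕ)
  /-- jump to `l` if `mem[a] = 0` -/
  | jumpZero (a l : ℕ)
  /-- stop and answer `b` -/
  | halt (b : Bool)

abbrev Program := List Instr

structure Config where
  pc : ℕ
  mem : ℕ → ℕ

/-- All memory cells are `0` at the start; the input is in a separate read-only array. -/
def init : Config := ⟨0, fun _ => 0⟩

def Config.set (c : Config) (d v : ℕ) : Config := ⟨c.pc + 1, Function.update c.mem d v⟩

/-- The effect of one instruction. -/
def Instr.exec (input : List ℕ) (c : Config) : Instr → Config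
  | .const d v => c.set d v
  | .copy d a => c.set d (c.mem a)
  | .add d a b => c.set d (c.mem a + c.mem b)
  | .sub d a b => c.set d (c.mem a - c.mem b)
  | .mul d a b => c.set d (c.mem a * c.mem b)
  | .div d a b => c.set d (c.mem a / c.mem b)
  | .mod d a b => c.set d (c.mem a % c.mem b)
  | .load d a => c.set d (c.mem (c.mem a))
  | .store d a => c.set (c.mem d) (c.mem a)
  | .read d a => c.set d (input.getD (c.mem a) 0)
  | .jump l => ⟨l, c.mem⟩
  | .jumpZero a l => if c.mem a = 0 then ⟨l, c.mem⟩ else ⟨c.pc + 1, c.mem⟩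
  | .halt _ => c

/-- One step of the program; nothing happens once the program counter has left the program. -/
def step (P : Program) (input : List ℕ) (c : Config) : Config :=
  match P[c.pc]? with
  | some i => i.exec input c
  | none => c

/-- The configuration after `i` steps. -/
def configAt (P : Program) (input : List ℕ) (i : ℕ) : Config := (step P input)^[i] init

/-- The answer given in a configuration, if the program halts there. -/
def answer (P : Program) (c : Config) : Option Bool :=
  match P[c.pc]? with
  | some (.halt b) => some b
  | _ => none

/-- The length in bits of a memory word, for a given input and time bound `t`: a constant `c` times
the logarithm of the sum of the number of input entries, the largest input entry, and `t`. So a word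
can hold any input entry and any address that can be needed within time `t`. If `t` and the input
entries are polynomially bounded in the input length `N`, these are words of `O(log N)` bits. -/
noncomputable def wordLength (c : ℕ) (input : List ℕ) (t : ℝ) : ℕ :=
  c * Nat.log 2 (input.length + input.foldr max 0 + ⌈t⌉₊ + 2)

/-- The decision problem "does `yes x` hold?", for instances `x` with `inst x`, given to the machine
as the list `enc x` of numbers, can be solved in time `O(t x)`: a single program answers correctly
within `K * t x` steps on every instance `x`, while all numbers that it ever stores fit into words
of the length above. -/
def SolvableInTime {α : Type} (enc : α → List ℕ) (inst yes : α → Prop) (t : α → ℝ) : Prop :=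
  ∃ (P : Program) (K c : ℕ), ∀ x, inst x → ∃ T : ℕ, (T : ℝ) ≤ K * t x ∧
    (∃ b : Bool, answer P (configAt P (enc x) T) = some b ∧ (b = true ↔ yes x)) ∧
    ∀ i ≤ T, ∀ a, (configAt P (enc x) i).mem a < 2 ^ wordLength c (enc x) (t x)

end RAM

/-! ### The strong exponential time hypothesis -/

/-- A formula in conjunctive normal form over the variables `0, …, numVars - 1`; the literal
`(v, true)` is the variable `v` and `(v, false)` is its negation. -/
structure CNF where
  numVars : ℕ
  clauses : List (List (Fin numVars × Bool))

namespace CNF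

def Satisfiable (F : CNF) : Prop :=
  ∃ A : Fin F.numVars → Bool, ∀ c ∈ F.clauses, ∃ l ∈ c, A l.1 = l.2

/-- Every clause has at most `k` literals. -/
def IsKCNF (k : ℕ) (F : CNF) : Prop := ∀ c ∈ F.clauses, c.length ≤ k

def encode (F : CNF) : List ℕ :=
  [F.numVars, F.clauses.length] ++
    F.clauses.flatMap fun c => c.length :: c.map fun l => 2 * (l.1 : ℕ) + l.2.toNat

end CNF

/-- For every `ε > 0` there is a `k` such that satisfiability of `k`-CNF formulas with `n` variables
and `m` clauses cannot be solved in time `O(2 ^ (n (1 - ε)) poly(m))`, for any polynomial. -/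
def SETH : Prop :=
  ∀ ε : ℝ, 0 < ε → ∃ k : ℕ, ∀ a : ℕ,
    ¬ RAM.SolvableInTime CNF.encode (CNF.IsKCNF k) CNF.Satisfiable
      (fun F => (2 : ℝ) ^ ((F.numVars : ℝ) * (1 - ε)) * ((F.clauses.length : ℝ) + 1) ^ a)

/-! ### Representations of gap-constraint languages -/

/-- A deterministic finite automaton over the alphabet `{0, …, σ - 1}`, possibly incomplete:
`step q a = none` means that the transition is undefined. -/
structure PartialDFA (σ : ℕ) where
  numStates : ℕ
  start : Fin numStates
  step : Fin numStates → Fin σ → Option (Fin numStates)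
  accept : Fin numStates → Bool

namespace PartialDFA

variable {σ : ℕ}

/-- The complete automaton with the additional rejecting sink `none`. -/
def toDFA (A : PartialDFA σ) : DFA (Fin σ) (Option (Fin A.numStates)) where
  step q a := q.bind fun q => A.step q a
  start := some A.start
  accept := {q | ∃ s, q = some s ∧ A.accept s = true}

def language (A : PartialDFA σ) : Set (List (Fin σ)) := A.toDFA.accepts

/-- The list of all defined transitions. -/
def transitions (A : PartialDFA σ) : List (Fin A.numStates × Fin σ × Fin A.numStates) :=
  (List.finRange A.numStates).flatMap fun q =>
    (List.finRange σ).filterMap fun a => (A.step q a).map fun r => (q, a, r)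

def size (A : PartialDFA σ) : ℕ := A.numStates + A.transitions.length

def encode (A : PartialDFA σ) : List ℕ :=
  [A.numStates, (A.start : ℕ), A.transitions.length] ++
    (List.finRange A.numStates).map (fun q => (A.accept q).toNat) ++
    A.transitions.flatMap fun t => [(t.1 : ℕ), (t.2.1 : ℕ), (t.2.2 : ℕ)]

end PartialDFA

/-- A representation `L(x₀; x₁, …, xₘ)` of a linear set. -/
structure LinearRep where
  base : ℕ
  periods : List ℕ
  pos : ∀ x ∈ periods, 0 < x

namespace LinearRep

def toSet (L : LinearRep) : Set ℕ :=
  {x | ∃ k : Fin L.periods.length → ℕ, x = L.base + ∑ i, k i * L.periods.get i}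

def size (L : LinearRep) : ℕ := L.periods.length + 1

def encode (L : LinearRep) : List ℕ := L.periods.length :: L.base :: L.periods

end LinearRep

/-- A semilinear set, represented as a finite union of linear sets. -/
abbrev SemilinearRep := List LinearRep

namespace SemilinearRep

def toSet (S : SemilinearRep) : Set ℕ := {x | ∃ L ∈ S, x ∈ L.toSet}

def size (S : SemilinearRep) : ℕ := (S.map LinearRep.size).sum

def encode (S : SemilinearRep) : List ℕ := S.length :: S.flatMap LinearRep.encode

end SemilinearRep

/-- The two kinds of gap constraints: regular and semilinear length constraints. -/
inductive ConstraintKind where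
  | reg
  | semi

namespace ConstraintKind

/-- Regular constraints are represented by automata, semilinear ones by semilinear sets. -/
def Rep (σ : ℕ) : ConstraintKind → Type
  | reg => PartialDFA σ
  | semi => SemilinearRep

/-- The represented gap-constraint language. -/
def language {σ : ℕ} : (𝓛 : ConstraintKind) → 𝓛.Rep σ → Set (List (Fin σ))
  | reg => fun A => PartialDFA.language A
  | semi => fun S => {v | v.length ∈ SemilinearRep.toSet S}

def size {σ : ℕ} : (𝓛 : ConstraintKind) → 𝓛.Rep σ → ℕ
  | reg => fun A => PartialDFA.size A
  | semi => fun S => SemilinearRep.size S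

def encode {σ : ℕ} : (𝓛 : ConstraintKind) → 𝓛.Rep σ → List ℕ
  | reg => fun A => PartialDFA.encode A
  | semi => fun S => SemilinearRep.encode S

/-- The standing bound on the size of a single constraint for a text of length `n`. -/
def sizeBound (n : ℕ) : ConstraintKind → ℕ
  | reg => n ^ 2
  | semi => n

end ConstraintKind

/-! ### The matching problem -/

/-- A gap constraint `(i, j, L)` for a string of length `m` over `{0, …, σ - 1}`. Positions are
counted from `0`. -/
structure GapConstraint (𝓛 : ConstraintKind) (σ m : ℕ) where
  left : Fin m
  right : Fin m
  lt : left < right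
  rep : 𝓛.Rep σ

namespace GapConstraint

variable {𝓛 : ConstraintKind} {σ m : ℕ}

def language (C : GapConstraint 𝓛 σ m) : Set (List (Fin σ)) := 𝓛.language C.rep

def size (C : GapConstraint 𝓛 σ m) : ℕ := 𝓛.size C.rep

/-- The positions `left, …, right - 1`. -/
def interval (C : GapConstraint 𝓛 σ m) : Finset (Fin m) := Finset.Ico C.left C.right

def encode (C : GapConstraint 𝓛 σ m) : List ℕ :=
  [(C.left : ℕ), (C.right : ℕ)] ++ 𝓛.encode C.rep

end GapConstraint

/-- The factor of `v` strictly between the positions `e i` and `e j`. -/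
def gap {α : Type} (v : List α) {m : ℕ} (e : Fin m → Fin v.length) (i j : Fin m) : List α :=
  (v.drop ((e i : ℕ) + 1)).take ((e j : ℕ) - (e i : ℕ) - 1)

/-- An instance of the matching problem with constraints of kind `𝓛`: a text and a pattern over an
integer alphabet, and a non-empty set of gap constraints for the pattern with at most one constraint
for every pair of positions (listed in any order). -/
structure MatchInstance (𝓛 : ConstraintKind) where
  σ : ℕ
  text : List (Fin σ)
  pattern : List (Fin σ)
  constraints : List (GapConstraint 𝓛 σ pattern.length)
  alphabet_le : σ ≤ text.length
  pattern_le : pattern.length ≤ text.length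
  nonempty : constraints ≠ []
  nodup : (constraints.map fun C => (C.left, C.right)).Nodup
  size_le : ∀ C ∈ constraints, C.size ≤ 𝓛.sizeBound text.length

namespace MatchInstance

variable {𝓛 : ConstraintKind}

/-- The pattern is a `𝓒`-subsequence of the text, where `𝓒` is the set of constraints. -/
def IsMatch (I : MatchInstance 𝓛) : Prop :=
  ∃ e : Fin I.pattern.length → Fin I.text.length, StrictMono e ∧
    (∀ i, I.text.get (e i) = I.pattern.get i) ∧
    ∀ C ∈ I.constraints, gap I.text e C.left C.right ∈ C.language

/-- The constraints are pairwise non-intersecting. -/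
def NonIntersecting (I : MatchInstance 𝓛) : Prop :=
  ∀ C ∈ I.constraints, ∀ C' ∈ I.constraints,
    C.interval ∩ C'.interval = C.interval ∨ C.interval ∩ C'.interval = C'.interval ∨
      C.interval ∩ C'.interval = ∅

def encode (I : MatchInstance 𝓛) : List ℕ :=
  [I.σ, I.text.length] ++ I.text.map (fun x => (x : ℕ)) ++
    [I.pattern.length] ++ I.pattern.map (fun x => (x : ℕ)) ++
    [I.constraints.length] ++ I.constraints.flatMap GapConstraint.encode

end MatchInstance

/-!
Split the variables of a formula into three groups of `n / 3`. A partial assignment of a group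
becomes the 0/1 vector of the clauses that it fails to satisfy, so the formula is satisfiable if and
only if there are vectors, one from each group, that are not all `1` in any coordinate. Each of the
three families consists of about `N = 2 ^ (n / 3)` vectors, whose length `m` is the number of
clauses.

The first family is written into the left half of the text, and the second one into the mirrored
right half. A constraint between a position of the left half of the pattern and its mirror image
only sees the distance of two letters of the text; as each letter is shifted inside its cell
according to its bit, this distance reveals the sum of the two bits, and the constraint can forbid
that both are `1`. It does so where a vector of the third family has a `1`. These intervals are
nested, and so are the ones of the constraints between neighbours that keep the cells of a block
together.

It remains to make the pattern choose a single triple. The `N` blocks of a half of the pattern stand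
for the vectors of the third family, while a half of the text has the `N` vectors of its family in
the middle, as blocks of stage `1`, and `N - 1` blocks each of stage `0` and of stage `2` around
them. The stage shifts the letters as well, so the constraints can require it to be equal on both
sides and to grow by at most one from block to block. As `N` blocks do not fit into stage `0` or
stage `2`, some block is placed in stage `1`, and it selects an orthogonal triple.

The text and the set of constraints have size `O(N * m)`, and each constraint has constant size.
Hence time `|w| ^ g * |C| ^ h` with `g + h < 3` decides satisfiability in time `2 ^ (n * δ)` times a
polynomial in `m`, for some `δ < 1`.
-/

namespace RAM

/-! ### Straight-line code and counted loops -/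

/-- `Runs P inp V B c c'`: the program `P` gets from `c` to `c'` in at most `B` steps, and all
memory contents on the way are at most `V`. -/
def Runs (P : Program) (inp : List ℕ) (V B : ℕ) (c c' : Config) : Prop :=
  ∃ T ≤ B, (step P inp)^[T] c = c' ∧ ∀ i ≤ T, ∀ a, ((step P inp)^[i] c).mem a ≤ V

theorem step_eq_exec {P : Program} {inp : List ℕ} {c : Config} {i : Instr}
    (h : P[c.pc]? = some i) : step P inp c = i.exec inp c := by
  simp [step, h]

theorem update_le {mem : ℕ → ℕ} {d v V : ℕ} (h : ∀ a, mem a ≤ V) (hv : v ≤ V) (a : ℕ) :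
    Function.update mem d v a ≤ V := by
  rw [Function.update_apply]
  split_ifs
  exacts [hv, h a]

namespace Runs

variable {P : Program} {inp : List ℕ} {V B B₁ B₂ b b' d v : ℕ} {c c' c'' : Config}
  {mem : ℕ → ℕ} {i : Instr}

theorem refl (h : ∀ a, c.mem a ≤ V) : Runs P inp V 0 c c :=
  ⟨0, le_rfl, rfl, fun i hi a => by rw [Nat.le_zero.1 hi]; exact h a⟩

theorem mono (h : Runs P inp V B₁ c c') (hB : B₁ ≤ B₂) : Runs P inp V B₂ c c' :=
  let ⟨T, hT, h⟩ := h
  ⟨T, hT.trans hB, h⟩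

theorem of_pc_eq (h : Runs P inp V B c ⟨b, mem⟩) (e : b = b') : Runs P inp V B c ⟨b', mem⟩ :=
  e ▸ h

theorem trans (h₁ : Runs P inp V B₁ c c') (h₂ : Runs P inp V B₂ c' c'') :
    Runs P inp V (B₁ + B₂) c c'' := by
  obtain ⟨T₁, hT₁, e₁, m₁⟩ := h₁
  obtain ⟨T₂, hT₂, e₂, m₂⟩ := h₂
  refine ⟨T₂ + T₁, by omega, by rw [Function.iterate_add_apply, e₁, e₂], fun i hi a => ?_⟩
  rcases le_total i T₁ with h | h
  · exact m₁ i h a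
  · obtain ⟨j, rfl⟩ := Nat.exists_eq_add_of_le' h
    rw [Function.iterate_add_apply, e₁]
    exact m₂ j (by omega) a

theorem mem_le (h : Runs P inp V B c ⟨b, mem⟩) (a : ℕ) : mem a ≤ V := by
  obtain ⟨T, -, e, m⟩ := h
  simpa [e] using m T le_rfl a

theorem single (h : ∀ a, c.mem a ≤ V) (h' : ∀ a, (step P inp c).mem a ≤ V) :
    Runs P inp V 1 c (step P inp c) := by
  refine ⟨1, le_rfl, rfl, fun i hi => ?_⟩
  rcases Nat.le_one_iff_eq_zero_or_eq_one.1 hi with rfl | rfl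
  exacts [h, h']

theorem write (d v : ℕ) (hi : P[b]? = some i)
    (he : i.exec inp ⟨b, mem⟩ = ⟨b + 1, Function.update mem d v⟩)
    (h : ∀ a, mem a ≤ V) (hv : v ≤ V) :
    Runs P inp V 1 ⟨b, mem⟩ ⟨b + 1, Function.update mem d v⟩ := by
  have hs : step P inp ⟨b, mem⟩ = ⟨b + 1, Function.update mem d v⟩ := (step_eq_exec hi).trans he
  exact hs ▸ single h (hs ▸ update_le h hv)

theorem goto (l : ℕ) (hi : P[b]? = some i) (he : i.exec inp ⟨b, mem⟩ = ⟨l, mem⟩)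
    (h : ∀ a, mem a ≤ V) : Runs P inp V 1 ⟨b, mem⟩ ⟨l, mem⟩ := by
  have hs : step P inp ⟨b, mem⟩ = ⟨l, mem⟩ := (step_eq_exec hi).trans he
  exact hs ▸ single h (hs ▸ h)

end Runs

/-- The program `P` contains the code `is` at position `b`. -/
def CodeAt (P : Program) (b : ℕ) : List Instr → Prop
  | [] => True
  | i :: is => P[b]? = some i ∧ CodeAt P (b + 1) is

theorem codeAt_append {P : Program} {is js : List Instr} {b : ℕ} :
    CodeAt P b (is ++ js) ↔ CodeAt P b is ∧ CodeAt P (b + is.length) js := by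
  induction is generalizing b with
  | nil => simp [CodeAt]
  | cons i is ih => simp [CodeAt, ih, and_assoc, Nat.add_comm, Nat.add_left_comm]

theorem codeAt_length_append (pre is post : List Instr) :
    CodeAt (pre ++ is ++ post) pre.length is := by
  induction is generalizing pre with
  | nil => trivial
  | cons i is ih =>
    refine ⟨by simp, ?_⟩
    simpa using ih (pre ++ [i])

/-- Code for position `b` that executes `body` for each value of the cell `i` below the value of the
cell `k`; the cell `t` is scratch space. -/
def countedLoop (k i t b : ℕ) (body : List Instr) : List Instr :=
  [.const i 0, .sub t k i, .jumpZero t (b + 3 + body.length + 3)] ++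
    (body ++ [.const t 1, .add i i t, .jump (b + 1)])

theorem length_countedLoop (k i t b : ℕ) (body : List Instr) :
    (countedLoop k i t b body).length = body.length + 6 := by
  simp [countedLoop]

/-- `Inv j` holds at the start of round `j` of the `n` rounds of `countedLoop k i t b body`, and
round `j` of the body takes at most `cost j` steps. -/
structure IsLoopInvariant (P : Program) (inp : List ℕ) (V k i t b : ℕ) (body : List Instr) (n : ℕ)
    (cost : ℕ → ℕ) (Inv : ℕ → (ℕ → ℕ) → Prop) : Prop where
  count_eq : ∀ {j m}, Inv j m → m k = n
  congr : ∀ {j m m'}, Inv j m → (∀ a, a ≠ i → a ≠ t → m' a = m a) → Inv j m'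
  round : ∀ {j m}, j < n → Inv j m → m i = j → (∀ a, m a ≤ V) →
    ∃ m', Runs P inp V (cost j) ⟨b + 3, m⟩ ⟨b + 3 + body.length, m'⟩ ∧ m' i = j ∧ Inv (j + 1) m'

namespace IsLoopInvariant

variable {P : Program} {inp : List ℕ} {V k i t b n : ℕ} {body : List Instr} {cost : ℕ → ℕ}
  {Inv : ℕ → (ℕ → ℕ) → Prop} {m : ℕ → ℕ}

theorem runs_round (h : IsLoopInvariant P inp V k i t b body n cost Inv)
    (hP : CodeAt P b (countedLoop k i t b body)) (hit : i ≠ t) {j : ℕ} (hj : j < n)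
    (hInv : Inv j m) (hi : m i = j) (hm : ∀ a, m a ≤ V) :
    ∃ m', Runs P inp V (cost j + 5) ⟨b + 1, m⟩ ⟨b + 1, m'⟩ ∧ m' i = j + 1 ∧ Inv (j + 1) m' := by
  simp only [countedLoop, codeAt_append, CodeAt, List.length_cons, List.length_nil,
    and_true] at hP
  obtain ⟨⟨-, hsub, hexit⟩, -, hone, hadd, hback⟩ := hP
  have hk := h.count_eq hInv
  have hnV : n ≤ V := hk ▸ hm k
  have s₁ := Runs.write (inp := inp) t (n - j) hsub
    (by simp [Instr.exec, Config.set, hk, hi]) hm (by omega)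
  have s₂ := Runs.goto (inp := inp) (b + 3) hexit
    (by simp [Instr.exec, Nat.sub_eq_zero_iff_le, hj]) s₁.mem_le
  obtain ⟨m₁, r, hi₁, hInv₁⟩ := h.round hj
    (h.congr hInv fun a _ hat => Function.update_of_ne hat _ _)
    (by rw [Function.update_of_ne hit, hi]) s₂.mem_le
  have s₃ := Runs.write (inp := inp) t 1 hone rfl r.mem_le (by omega)
  have s₄ := Runs.write (inp := inp) i (j + 1) hadd
    (by simp [Instr.exec, Config.set, Function.update_of_ne hit, hi₁]) s₃.mem_le (by omega)
  have s₅ := Runs.goto (inp := inp) (b + 1) hback rfl s₄.mem_le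
  refine ⟨_, ((s₁.trans s₂).trans (r.trans (s₃.trans (s₄.trans s₅)))).mono (by omega),
    by simp, h.congr hInv₁ fun a hai hat => ?_⟩
  rw [Function.update_of_ne hai, Function.update_of_ne hat]

theorem runs_rounds (h : IsLoopInvariant P inp V k i t b body n cost Inv)
    (hP : CodeAt P b (countedLoop k i t b body)) (hit : i ≠ t) (hInv : Inv 0 m)
    (hm : ∀ a, m a ≤ V) {j : ℕ} (hj : j ≤ n) :
    ∃ m', Runs P inp V (∑ l ∈ Finset.range j, (cost l + 5) + 1) ⟨b, m⟩ ⟨b + 1, m'⟩ ∧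
      m' i = j ∧ Inv j m' := by
  induction j with
  | zero =>
    exact ⟨_, (Runs.write i 0 hP.1 rfl hm (Nat.zero_le V)).mono (by simp), by simp,
      h.congr hInv fun a hai _ => Function.update_of_ne hai _ _⟩
  | succ j ih =>
    obtain ⟨m₁, r₁, hi₁, hInv₁⟩ := ih (by omega)
    obtain ⟨m₂, r₂, hi₂, hInv₂⟩ := h.runs_round hP hit hj hInv₁ hi₁ r₁.mem_le
    exact ⟨m₂, (r₁.trans r₂).mono (by rw [Finset.sum_range_succ]; omega), hi₂, hInv₂⟩

theorem runs_countedLoop (h : IsLoopInvariant P inp V k i t b body n cost Inv)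
    (hP : CodeAt P b (countedLoop k i t b body)) (hit : i ≠ t) (hInv : Inv 0 m)
    (hm : ∀ a, m a ≤ V) :
    ∃ m', Runs P inp V (∑ j ∈ Finset.range n, (cost j + 5) + 3) ⟨b, m⟩
      ⟨b + (countedLoop k i t b body).length, m'⟩ ∧ Inv n m' := by
  obtain ⟨m₁, r₁, hi₁, hInv₁⟩ := h.runs_rounds hP hit hInv hm le_rfl
  have s₁ := Runs.write (inp := inp) t 0 hP.2.1
    (by simp [Instr.exec, Config.set, hi₁, h.count_eq hInv₁]) r₁.mem_le (Nat.zero_le V)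
  have s₂ := Runs.goto (inp := inp) (b + 3 + body.length + 3) hP.2.2.1
    (by simp [Instr.exec]) s₁.mem_le
  refine ⟨_, ((r₁.trans (s₁.trans s₂)).of_pc_eq ?_).mono le_rfl,
    h.congr hInv₁ fun a _ hat => Function.update_of_ne hat _ _⟩
  rw [length_countedLoop]
  omega

end IsLoopInvariant

/-! ### Compiling arithmetic expressions with bounded iteration -/

/-- The binary operations of the RAM. -/
inductive Op where
  | add | sub | mul | div | mod

namespace Op

/-- The value of an operation. -/
def apply : Op → ℕ → ℕ → ℕ
  | add => (· + ·)
  | sub => (· - ·)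
  | mul => (· * ·)
  | div => (· / ·)
  | mod => (· % ·)

/-- The instruction of the RAM that performs an operation; its arguments are the cell for the result
and the cells of the operands. -/
def instr : Op → ℕ → ℕ → ℕ → Instr
  | add => .add
  | sub => .sub
  | mul => .mul
  | div => .div
  | mod => .mod

/-- The results of additions and multiplications are charged, so that the cost of an expression
also bounds the numbers that occur. -/
def charge : Op → ℕ → ℕ → ℕ
  | add => (· + ·)
  | mul => (· * ·)
  | _ => fun _ _ => 0

theorem exec_instr (o : Op) (inp : List ℕ) (c : Config) (d a b : ℕ) :
    (o.instr d a b).exec inp c =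
      ⟨c.pc + 1, Function.update c.mem d (o.apply (c.mem a) (c.mem b))⟩ := by
  cases o <;> rfl

theorem apply_le (o : Op) {x y V : ℕ} (hx : x ≤ V) (hc : o.charge x y ≤ V) : o.apply x y ≤ V := by
  cases o
  · exact hc
  · exact (Nat.sub_le _ _).trans hx
  · exact hc
  · exact (Nat.div_le_self _ _).trans hx
  · exact (Nat.mod_le _ _).trans hx

end Op

/-- Expressions; `var x` is the value at position `x` of the environment, a list to which `op`,
`bind` and `iter` append the values of subexpressions. -/
inductive NatExpr where
  | const (v : ℕ)
  | var (x : ℕ)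
  | op (o : Op) (e₁ e₂ : NatExpr)
  | read (e : NatExpr)
  | bind (e₁ e₂ : NatExpr)
  /-- Iterates `body`; it sees the number of rounds, the accumulator, and the current round. -/
  | iter (count start body : NatExpr)

namespace NatExpr

/-- The accumulator after `i` rounds. -/
def iterate (f : ℕ → ℕ → ℕ) (z : ℕ) : ℕ → ℕ
  | 0 => z
  | i + 1 => f (iterate f z i) i

section

variable (inp : List ℕ)

/-- The value of an expression in an environment. -/
def eval : NatExpr → List ℕ → ℕ
  | const v, _ => v
  | var x, ρ => ρ.getD x 0
  | op o e₁ e₂, ρ => o.apply (e₁.eval ρ) (e₂.eval (ρ ++ [e₁.eval ρ]))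
  | read e, ρ => inp.getD (e.eval ρ) 0
  | bind e₁ e₂, ρ => e₂.eval (ρ ++ [e₁.eval ρ])
  | iter count start body, ρ =>
    iterate (fun acc i => body.eval (ρ ++ [count.eval ρ, acc, i]))
      (start.eval (ρ ++ [count.eval ρ])) (count.eval ρ)

/-- A bound on the number of steps of the compiled expression, and on the numbers it computes. -/
def cost : NatExpr → List ℕ → ℕ
  | const v, _ => v + 1
  | var _, _ => 1
  | op o e₁ e₂, ρ => e₁.cost ρ + e₂.cost (ρ ++ [e₁.eval inp ρ]) +
      o.charge (e₁.eval inp ρ) (e₂.eval inp (ρ ++ [e₁.eval inp ρ])) + 1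
  | read e, ρ => e.cost ρ + 1
  | bind e₁ e₂, ρ => e₁.cost ρ + e₂.cost (ρ ++ [e₁.eval inp ρ]) + 1
  | iter count start body, ρ => count.cost ρ + start.cost (ρ ++ [count.eval inp ρ]) + 4 +
      ∑ i ∈ Finset.range (count.eval inp ρ),
        (body.cost (ρ ++ [count.eval inp ρ,
          iterate (fun acc i => body.eval inp (ρ ++ [count.eval inp ρ, acc, i]))
            (start.eval inp (ρ ++ [count.eval inp ρ])) i, i]) + 6)

end

/-- The code of an expression for an environment of length `n`, to be placed at position `b`. The
environment is in the cells `1, …, n`, and the value goes to the cell `n + 1`. -/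
def compile : NatExpr → ℕ → ℕ → List Instr
  | const v, n, _ => [.const (n + 1) v]
  | var x, n, _ => if x < n then [.copy (n + 1) (x + 1)] else [.const (n + 1) 0]
  | op o e₁ e₂, n, b =>
    e₁.compile n b ++ (e₂.compile (n + 1) (b + (e₁.compile n b).length) ++
      [o.instr (n + 1) (n + 1) (n + 2)])
  | read e, n, b => e.compile n b ++ [.read (n + 1) (n + 1)]
  | bind e₁ e₂, n, b =>
    e₁.compile n b ++ (e₂.compile (n + 1) (b + (e₁.compile n b).length) ++
      [.copy (n + 1) (n + 2)])
  | iter count start body, n, b =>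
    let b₁ := b + (count.compile n b).length
    let b₂ := b₁ + (start.compile (n + 1) b₁).length
    count.compile n b ++ (start.compile (n + 1) b₁ ++
      (countedLoop (n + 1) (n + 3) (n + 4) b₂
        (body.compile (n + 3) (b₂ + 3) ++ [.copy (n + 2) (n + 4)]) ++
      [.copy (n + 1) (n + 2)]))

/-- The cells from `width` on are not used. -/
def width : NatExpr → ℕ → ℕ
  | const _, n => n + 2
  | var _, n => n + 2
  | op _ e₁ e₂, n => max (e₁.width n) (e₂.width (n + 1))
  | read e, n => e.width n
  | bind e₁ e₂, n => max (e₁.width n) (e₂.width (n + 1))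
  | iter count start body, n =>
    max (count.width n) (max (start.width (n + 1)) (body.width (n + 3)))

theorem add_two_le_width (e : NatExpr) (n : ℕ) : n + 2 ≤ e.width n := by
  induction e generalizing n with
  | const => exact le_rfl
  | var => exact le_rfl
  | op _ _ _ ih => exact (ih n).trans (le_max_left _ _)
  | read _ ih => exact ih n
  | bind _ _ ih => exact (ih n).trans (le_max_left _ _)
  | iter _ _ _ ih => exact (ih n).trans (le_max_left _ _)

end NatExpr

/-- The environment `ρ` is in the memory cells `1, …, ρ.length`. -/
def Holds (ρ : List ℕ) (mem : ℕ → ℕ) : Prop := ∀ i (h : i < ρ.length), mem (i + 1) = ρ[i]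

namespace Holds

variable {ρ : List ℕ} {mem mem' : ℕ → ℕ}

theorem nil : Holds [] mem := fun _ hi => absurd hi (Nat.not_lt_zero _)

theorem congr (h : Holds ρ mem) (hm : ∀ a, 0 < a → a ≤ ρ.length → mem' a = mem a) :
    Holds ρ mem' := fun i hi => by
  rw [hm _ i.succ_pos hi, h i hi]

theorem append (h : Holds ρ mem) {v : ℕ} (hv : mem (ρ.length + 1) = v) : Holds (ρ ++ [v]) mem :=
  fun i hi => by
    by_cases hi' : i < ρ.length
    · rw [h i hi', List.getElem_append_left hi']
    · obtain rfl : i = ρ.length := by simp at hi; omega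
      simp [hv]

end Holds

theorem getD_le {inp : List ℕ} {V : ℕ} (h : ∀ x ∈ inp, x ≤ V) (i : ℕ) : inp.getD i 0 ≤ V := by
  rw [List.getD_eq_getElem?_getD]
  by_cases hi : i < inp.length
  · simpa [hi] using h _ (List.getElem_mem hi)
  · simp [hi]

namespace NatExpr

/-- The compiled expression computes its value within its cost, wherever it stands in the program
`P`, and changes no cell of the environment and no cell from its width on. -/
def CompilesCorrectly (P : Program) (inp : List ℕ) (V : ℕ) (e : NatExpr) : Prop :=
  ∀ (ρ : List ℕ) (b : ℕ) (mem : ℕ → ℕ), CodeAt P b (e.compile ρ.length b) → Holds ρ mem →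
    (∀ a, mem a ≤ V) → e.cost inp ρ ≤ V →
    ∃ mem', Runs P inp V (e.cost inp ρ) ⟨b, mem⟩ ⟨b + (e.compile ρ.length b).length, mem'⟩ ∧
      mem' (ρ.length + 1) = e.eval inp ρ ∧
      ∀ a, a ≤ ρ.length ∨ e.width ρ.length ≤ a → mem' a = mem a

namespace CompilesCorrectly

variable {P : Program} {inp : List ℕ} {V : ℕ} {e e₁ e₂ count start body : NatExpr}

theorem const (v : ℕ) : CompilesCorrectly P inp V (const v) := fun ρ b mem hP _ hm hV => by
  simp only [cost] at hV
  refine ⟨_, (Runs.write (ρ.length + 1) v hP.1 rfl hm (by omega)).mono (by simp [cost]),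
    by simp [eval], fun a ha => ?_⟩
  simp only [width] at ha
  rw [Function.update_of_ne (by omega)]

theorem var (x : ℕ) : CompilesCorrectly P inp V (var x) := fun ρ b mem hP hρ hm _ => by
  suffices Runs P inp V 1 ⟨b, mem⟩
      ⟨b + ((NatExpr.var x).compile ρ.length b).length,
        Function.update mem (ρ.length + 1) (ρ.getD x 0)⟩ by
    refine ⟨_, this, by simp [eval], fun a ha => ?_⟩
    simp only [width] at ha
    rw [Function.update_of_ne (by omega)]
  by_cases hx : x < ρ.length
  · have hval : mem (x + 1) = ρ.getD x 0 := by simp [hρ x hx, hx]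
    simp only [compile, hx, if_true] at hP ⊢
    exact Runs.write _ _ hP.1 (by rw [← hval]; rfl) hm (hval ▸ hm _)
  · have hval : ρ.getD x 0 = 0 := by simp [not_lt.1 hx]
    simp only [compile, hx, if_false] at hP ⊢
    exact Runs.write _ _ hP.1 (by rw [hval]; rfl) hm (by omega)

theorem pair (h₁ : CompilesCorrectly P inp V e₁) (h₂ : CompilesCorrectly P inp V e₂)
    {ρ : List ℕ} {b : ℕ} {mem : ℕ → ℕ} (hP₁ : CodeAt P b (e₁.compile ρ.length b))
    (hP₂ : CodeAt P (b + (e₁.compile ρ.length b).length)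
      (e₂.compile (ρ.length + 1) (b + (e₁.compile ρ.length b).length)))
    (hρ : Holds ρ mem) (hm : ∀ a, mem a ≤ V)
    (hV : e₁.cost inp ρ + e₂.cost inp (ρ ++ [e₁.eval inp ρ]) ≤ V) :
    ∃ mem', Runs P inp V (e₁.cost inp ρ + e₂.cost inp (ρ ++ [e₁.eval inp ρ])) ⟨b, mem⟩
        ⟨b + (e₁.compile ρ.length b).length +
          (e₂.compile (ρ.length + 1) (b + (e₁.compile ρ.length b).length)).length, mem'⟩ ∧
      mem' (ρ.length + 1) = e₁.eval inp ρ ∧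
      mem' (ρ.length + 2) = e₂.eval inp (ρ ++ [e₁.eval inp ρ]) ∧
      ∀ a, a ≤ ρ.length ∨ max (e₁.width ρ.length) (e₂.width (ρ.length + 1)) ≤ a →
        mem' a = mem a := by
  obtain ⟨m₁, r₁, v₁, f₁⟩ := h₁ ρ b mem hP₁ hρ hm (by omega)
  have run₂ := h₂ (ρ ++ [e₁.eval inp ρ]) (b + (e₁.compile ρ.length b).length) m₁
  simp only [List.length_append, List.length_singleton] at run₂
  obtain ⟨m₂, r₂, v₂, f₂⟩ := run₂ hP₂ ((hρ.congr fun a _ ha => f₁ a (.inl ha)).append v₁)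
    r₁.mem_le (by omega)
  refine ⟨m₂, r₁.trans r₂, by rw [f₂ _ (.inl le_rfl), v₁], v₂, fun a ha => ?_⟩
  rw [f₂ a (by omega), f₁ a (by omega)]

theorem op (o : Op) (h₁ : CompilesCorrectly P inp V e₁) (h₂ : CompilesCorrectly P inp V e₂) :
    CompilesCorrectly P inp V (op o e₁ e₂) := fun ρ b mem hP hρ hm hV => by
  simp only [compile, codeAt_append, List.length_append] at hP ⊢
  simp only [cost, width] at hV ⊢
  have hw := add_two_le_width e₁ ρ.length
  obtain ⟨m, r, v₁, v₂, f⟩ := h₁.pair h₂ hP.1 hP.2.1 hρ hm (by omega)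
  have s := Runs.write (inp := inp) (ρ.length + 1) ((NatExpr.op o e₁ e₂).eval inp ρ) hP.2.2.1
    (by rw [Op.exec_instr]; simp only [v₁, v₂, eval]) r.mem_le
    (o.apply_le (v₁ ▸ r.mem_le _) (by omega))
  refine ⟨_, ((r.trans s).of_pc_eq (by simp [add_assoc])).mono (by omega),
    Function.update_self .., fun a ha => ?_⟩
  rw [Function.update_of_ne (by omega), f a ha]

theorem read (hinp : ∀ x ∈ inp, x ≤ V) (h : CompilesCorrectly P inp V e) :
    CompilesCorrectly P inp V (read e) := fun ρ b mem hP hρ hm hV => by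
  simp only [compile, codeAt_append, List.length_append] at hP ⊢
  simp only [cost, width] at hV ⊢
  have hw := add_two_le_width e ρ.length
  obtain ⟨m, r, v, f⟩ := h ρ b mem hP.1 hρ hm (by omega)
  have s := Runs.write (inp := inp) (ρ.length + 1) ((NatExpr.read e).eval inp ρ) hP.2.1
    (by simp only [Instr.exec, Config.set, v, eval]) r.mem_le (getD_le hinp _)
  refine ⟨_, by simpa only [add_assoc, List.length_singleton] using r.trans s,
    Function.update_self .., fun a ha => ?_⟩
  rw [Function.update_of_ne (by omega), f a ha]

theorem bind (h₁ : CompilesCorrectly P inp V e₁) (h₂ : CompilesCorrectly P inp V e₂) :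
    CompilesCorrectly P inp V (bind e₁ e₂) := fun ρ b mem hP hρ hm hV => by
  simp only [compile, codeAt_append, List.length_append] at hP ⊢
  simp only [cost, width] at hV ⊢
  have hw := add_two_le_width e₁ ρ.length
  obtain ⟨m, r, -, v₂, f⟩ := h₁.pair h₂ hP.1 hP.2.1 hρ hm (by omega)
  have s := Runs.write (inp := inp) (ρ.length + 1) ((NatExpr.bind e₁ e₂).eval inp ρ) hP.2.2.1
    (by simp only [Instr.exec, Config.set, v₂, eval]) r.mem_le (by
      rw [eval, ← v₂]
      exact r.mem_le _)
  refine ⟨_, by simpa only [add_assoc, List.length_singleton] using r.trans s,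
    Function.update_self .., fun a ha => ?_⟩
  rw [Function.update_of_ne (by omega), f a ha]

theorem isLoopInvariant (h : CompilesCorrectly P inp V body) {ρ : List ℕ} {b n z : ℕ}
    {m₀ : ℕ → ℕ} (hP : CodeAt P (b + 3)
      (body.compile (ρ.length + 3) (b + 3) ++ [.copy (ρ.length + 2) (ρ.length + 4)]))
    (hρ : Holds ρ m₀) {f : ℕ → ℕ → ℕ} (hf : ∀ acc i, f acc i = body.eval inp (ρ ++ [n, acc, i]))
    (hV : ∀ j < n, body.cost inp (ρ ++ [n, iterate f z j, j]) ≤ V) :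
    IsLoopInvariant P inp V (ρ.length + 1) (ρ.length + 3) (ρ.length + 4) b
      (body.compile (ρ.length + 3) (b + 3) ++ [.copy (ρ.length + 2) (ρ.length + 4)]) n
      (fun j => body.cost inp (ρ ++ [n, iterate f z j, j]) + 1)
      fun j m => m (ρ.length + 1) = n ∧ m (ρ.length + 2) = iterate f z j ∧
        ∀ a, a ≤ ρ.length ∨ body.width (ρ.length + 3) ≤ a → m a = m₀ a where
  count_eq h := h.1
  congr := by
    rintro j m m' ⟨hn, hacc, hm⟩ hm'
    have hw := add_two_le_width body (ρ.length + 3)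
    exact ⟨by rw [hm' _ (by omega) (by omega), hn], by rw [hm' _ (by omega) (by omega), hacc],
      fun a ha => by rw [hm' a (by omega) (by omega), hm a ha]⟩
  round := by
    rintro j m hj ⟨hn, hacc, hm⟩ hi hmV
    rw [codeAt_append] at hP
    have hw := add_two_le_width body (ρ.length + 3)
    have henv : Holds (ρ ++ [n] ++ [iterate f z j] ++ [j]) m := by
      refine (((hρ.congr fun a _ ha => hm a (.inl ha)).append hn).append ?_).append ?_ <;>
        simpa only [List.length_append, List.length_singleton]
    have run := h (ρ ++ [n] ++ [iterate f z j] ++ [j]) (b + 3) m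
    simp only [List.length_append, List.length_singleton, add_assoc, Nat.reduceAdd] at run
    simp only [← add_assoc] at run
    obtain ⟨m₁, r, v, g⟩ := run hP.1 henv hmV (by simpa using hV j hj)
    have s := Runs.write (inp := inp) (ρ.length + 2) (iterate f z (j + 1)) hP.2.1
      (by simp [Instr.exec, Config.set, v, iterate, hf]) r.mem_le (by
        refine le_trans (le_of_eq ?_) (r.mem_le (ρ.length + 3 + 1))
        simp [v, iterate, hf])
    refine ⟨_, ((r.trans s).of_pc_eq (by simp [add_assoc])).mono (by simp), ?_, ?_, by simp,
      fun a ha => ?_⟩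
    · rw [Function.update_of_ne (by omega), g _ (by omega), hi]
    · rw [Function.update_of_ne (by omega), g _ (by omega), hn]
    · rw [Function.update_of_ne (by omega), g _ (by omega), hm a ha]

theorem iter (h₁ : CompilesCorrectly P inp V count) (h₂ : CompilesCorrectly P inp V start)
    (h₃ : CompilesCorrectly P inp V body) : CompilesCorrectly P inp V (iter count start body) :=
  fun ρ b mem hP hρ hm hV => by
  simp only [compile, codeAt_append, List.length_append] at hP ⊢
  simp only [cost, width] at hV ⊢
  have hw := add_two_le_width count ρ.length
  have hw' := add_two_le_width body (ρ.length + 3)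
  obtain ⟨hP₁, hP₂, hP₃, hP₄, -⟩ := hP
  obtain ⟨m₁, r₁, v₁, v₂, f₁⟩ := h₁.pair h₂ hP₁ hP₂ hρ hm (by omega)
  have hbody := (codeAt_append.1 (codeAt_append.1 hP₃).2).1
  set n := count.eval inp ρ
  set z := start.eval inp (ρ ++ [n])
  have invariant := h₃.isLoopInvariant (n := n) (z := z) hbody
    (hρ.congr fun a _ ha => f₁ a (.inl ha)) (fun _ _ => rfl) fun j hj => by
      have := Finset.single_le_sum (f := fun j => body.cost inp (ρ ++ [n,
        iterate (fun acc i => body.eval inp (ρ ++ [n, acc, i])) z j, j]) + 6)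
        (fun _ _ => Nat.zero_le _) (Finset.mem_range.2 hj)
      omega
  obtain ⟨m₂, r₂, -, v, f₂⟩ :=
    invariant.runs_countedLoop hP₃ (by omega) ⟨v₁, v₂, fun _ _ => rfl⟩ r₁.mem_le
  have s := Runs.write (inp := inp) (ρ.length + 1)
    (iterate (fun acc i => body.eval inp (ρ ++ [n, acc, i])) z n) hP₄
    (by simp [Instr.exec, Config.set, v]) r₂.mem_le (by rw [← v]; exact r₂.mem_le _)
  refine ⟨_, (((r₁.trans r₂).trans s).of_pc_eq (by simp [add_assoc])).mono ?_,
    Function.update_self .., fun a ha => ?_⟩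
  · simp only [add_assoc, Nat.reduceAdd]
    omega
  · rw [Function.update_of_ne (by omega), f₂ a (by omega), f₁ a (by omega)]

end CompilesCorrectly

theorem compilesCorrectly (P : Program) {inp : List ℕ} {V : ℕ} (hinp : ∀ x ∈ inp, x ≤ V)
    (e : NatExpr) : e.CompilesCorrectly P inp V := by
  induction e with
  | const v => exact .const v
  | var x => exact .var x
  | op o _ _ h₁ h₂ => exact .op o h₁ h₂
  | read _ h => exact .read hinp h
  | bind _ _ h₁ h₂ => exact .bind h₁ h₂
  | iter _ _ _ h₁ h₂ h₃ => exact .iter h₁ h₂ h₃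

end NatExpr

/-! ### Compiling generators of lists -/

/-- Programs that write a list of numbers. The environment is as for expressions. -/
inductive Gen where
  | emit (e : NatExpr)
  | seq (g₁ g₂ : Gen)
  | bind (e : NatExpr) (g : Gen)
  /-- Repeats `body`; it sees the number of rounds and the current round. -/
  | loop (count : NatExpr) (body : Gen)

namespace Gen

section

variable (inp : List ℕ)

/-- The list that a generator writes. -/
def out : Gen → List ℕ → List ℕ
  | emit e, ρ => [e.eval inp ρ]
  | seq g₁ g₂, ρ => g₁.out ρ ++ g₂.out ρ
  | bind e g, ρ => g.out (ρ ++ [e.eval inp ρ])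
  | loop count body, ρ =>
    (List.range (count.eval inp ρ)).flatMap fun i => body.out (ρ ++ [count.eval inp ρ, i])

/-- A bound on the number of steps of the compiled generator. -/
def cost : Gen → List ℕ → ℕ
  | emit e, ρ => e.cost inp ρ + 3
  | seq g₁ g₂, ρ => g₁.cost ρ + g₂.cost ρ
  | bind e g, ρ => e.cost inp ρ + g.cost (ρ ++ [e.eval inp ρ])
  | loop count body, ρ => count.cost inp ρ + 3 +
      ∑ i ∈ Finset.range (count.eval inp ρ), (body.cost (ρ ++ [count.eval inp ρ, i]) + 5)

end

/-- The code of a generator for an environment of length `n`, to be placed at position `b`. The cell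
`0` holds the address to which the next number is written; the numbers are written to every second
cell. -/
def compile : Gen → ℕ → ℕ → List Instr
  | emit e, n, b => e.compile n b ++ [.store 0 (n + 1), .const (n + 1) 2, .add 0 0 (n + 1)]
  | seq g₁ g₂, n, b => g₁.compile n b ++ g₂.compile n (b + (g₁.compile n b).length)
  | bind e g, n, b => e.compile n b ++ g.compile (n + 1) (b + (e.compile n b).length)
  | loop count body, n, b =>
    let b₁ := b + (count.compile n b).length
    count.compile n b ++
      countedLoop (n + 1) (n + 2) (n + 3) b₁ (body.compile (n + 2) (b₁ + 3))

/-- The cells from `width` on are not used, except for the output. -/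
def width : Gen → ℕ → ℕ
  | emit e, n => e.width n
  | seq g₁ g₂, n => max (g₁.width n) (g₂.width n)
  | bind e g, n => max (e.width n) (g.width (n + 1))
  | loop count body, n => max (count.width n) (body.width (n + 2))

theorem add_two_le_width (g : Gen) (n : ℕ) : n + 2 ≤ g.width n := by
  induction g generalizing n with
  | emit e => exact e.add_two_le_width n
  | seq _ _ ih => exact (ih n).trans (le_max_left _ _)
  | bind e => exact (e.add_two_le_width n).trans (le_max_left _ _)
  | loop count => exact (count.add_two_le_width n).trans (le_max_left _ _)

end Gen

theorem two_mul_length_flatMap_range_le {α : Type*} {f : ℕ → List α} {c : ℕ → ℕ}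
    (h : ∀ j, 2 * (f j).length ≤ c j) (n : ℕ) :
    2 * ((List.range n).flatMap f).length ≤ ∑ j ∈ Finset.range n, c j := by
  induction n with
  | zero => simp
  | succ n ih =>
    rw [List.range_succ, List.flatMap_append, List.flatMap_singleton, List.length_append,
      Finset.sum_range_succ, mul_add]
    exact Nat.add_le_add ih (h n)

theorem Gen.two_mul_length_out_le (inp : List ℕ) (g : Gen) (ρ : List ℕ) :
    2 * (g.out inp ρ).length ≤ g.cost inp ρ := by
  induction g generalizing ρ with
  | emit e => simp [out, cost]
  | seq _ _ ih₁ ih₂ =>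
    rw [out, List.length_append, mul_add]
    exact Nat.add_le_add (ih₁ ρ) (ih₂ ρ)
  | bind _ _ ih => exact (ih _).trans (Nat.le_add_left _ _)
  | loop _ _ ih =>
    exact (two_mul_length_flatMap_range_le (fun _ => (ih _).trans (Nat.le_add_right _ 5)) _).trans
      (Nat.le_add_left _ _)

/-- The memory after a list has been written to every second cell from `p` on. -/
def writeOut (mem : ℕ → ℕ) (p : ℕ) : List ℕ → ℕ → ℕ
  | [] => mem
  | x :: l => writeOut (Function.update mem p x) (p + 2) l

theorem writeOut_append (mem : ℕ → ℕ) (p : ℕ) (l l' : List ℕ) :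
    writeOut mem p (l ++ l') = writeOut (writeOut mem p l) (p + 2 * l.length) l' := by
  induction l generalizing mem p with
  | nil => simp [writeOut]
  | cons x l ih => simp [writeOut, ih, mul_add, add_assoc, add_comm 2]

theorem writeOut_congr {mem mem' : ℕ → ℕ} (p : ℕ) (l : List ℕ) {a : ℕ} (h : mem a = mem' a) :
    writeOut mem p l a = writeOut mem' p l a := by
  induction l generalizing mem mem' p with
  | nil => exact h
  | cons _ _ ih => exact ih _ (by simp only [Function.update_apply, h])

theorem writeOut_of_ne (mem : ℕ → ℕ) (p : ℕ) (l : List ℕ) {a : ℕ}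
    (h : ∀ i < l.length, a ≠ p + 2 * i) : writeOut mem p l a = mem a := by
  induction l generalizing mem p with
  | nil => rfl
  | cons x l ih =>
    rw [writeOut, ih, Function.update_of_ne (by simpa using h 0 (by simp))]
    intro i hi
    have := h (i + 1) (by simpa using hi)
    omega

theorem writeOut_apply (mem : ℕ → ℕ) (p : ℕ) (l : List ℕ) (i : ℕ) (hi : i < l.length) :
    writeOut mem p l (p + 2 * i) = l[i] := by
  induction l generalizing mem p i with
  | nil => simp at hi
  | cons x l ih =>
    cases i with
    | zero => simp [writeOut, writeOut_of_ne _ (p + 2) l (a := p) (by omega)]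
    | succ i =>
      rw [writeOut, show p + 2 * (i + 1) = p + 2 + 2 * i by ring]
      exact ih _ _ i (by simpa using hi)

namespace Gen

/-- The compiled generator writes its list within its cost, wherever it stands in the program `P`,
provided that the output area lies in the cells from `W` on. -/
def CompilesCorrectly (P : Program) (inp : List ℕ) (V W : ℕ) (g : Gen) : Prop :=
  ∀ (ρ : List ℕ) (b : ℕ) (mem : ℕ → ℕ), CodeAt P b (g.compile ρ.length b) → Holds ρ mem →
    (∀ a, mem a ≤ V) → g.width ρ.length ≤ W → W ≤ mem 0 → mem 0 + g.cost inp ρ ≤ V →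
    ∃ mem', Runs P inp V (g.cost inp ρ) ⟨b, mem⟩ ⟨b + (g.compile ρ.length b).length, mem'⟩ ∧
      mem' 0 = mem 0 + 2 * (g.out inp ρ).length ∧
      (∀ a, 0 < a → a ≤ ρ.length → mem' a = mem a) ∧
      ∀ a, W ≤ a → mem' a = writeOut mem (mem 0) (g.out inp ρ) a

namespace CompilesCorrectly

variable {P : Program} {inp : List ℕ} {V W : ℕ} {e count : NatExpr} {g g₁ g₂ body : Gen}

theorem emit (h : e.CompilesCorrectly P inp V) : CompilesCorrectly P inp V W (emit e) :=
  fun ρ b mem hP hρ hm hW hW' hV => by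
  simp only [compile, codeAt_append, List.length_append, CodeAt] at hP ⊢
  simp only [cost, width] at hV hW ⊢
  have hw := e.add_two_le_width ρ.length
  obtain ⟨m, r, v, f⟩ := h ρ b mem hP.1 hρ hm (by omega)
  have s₁ := Runs.write (inp := inp) (mem 0) (e.eval inp ρ) hP.2.1
    (by simp only [Instr.exec, Config.set, v, f 0 (by omega)]) r.mem_le (by
      rw [← v]
      exact r.mem_le _)
  have s₂ := Runs.write (inp := inp) (ρ.length + 1) 2 hP.2.2.1 rfl s₁.mem_le (by omega)
  have s₃ := Runs.write (inp := inp) 0 (mem 0 + 2) hP.2.2.2.1 (by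
    simp only [Instr.exec, Config.set]
    rw [Function.update_of_ne (by omega), Function.update_of_ne (by omega), f 0 (by omega),
      Function.update_self]) s₂.mem_le (by omega)
  refine ⟨_, (((r.trans s₁).trans s₂).trans s₃).of_pc_eq (by simp [add_assoc]), by simp [out],
    fun a h0 ha => ?_, fun a ha => ?_⟩
  · rw [Function.update_of_ne (by omega), Function.update_of_ne (by omega),
      Function.update_of_ne (by omega), f a (by omega)]
  · rw [Function.update_of_ne (by omega), Function.update_of_ne (by omega)]
    exact writeOut_congr (mem 0) [e.eval inp ρ] (f a (by omega))

theorem seq (h₁ : CompilesCorrectly P inp V W g₁) (h₂ : CompilesCorrectly P inp V W g₂) :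
    CompilesCorrectly P inp V W (seq g₁ g₂) := fun ρ b mem hP hρ hm hW hW' hV => by
  simp only [compile, codeAt_append, List.length_append] at hP ⊢
  simp only [cost, width] at hV hW ⊢
  have hl := two_mul_length_out_le inp g₁ ρ
  obtain ⟨m₁, r₁, p₁, e₁, f₁⟩ := h₁ ρ b mem hP.1 hρ hm (by omega) hW' (by omega)
  obtain ⟨m₂, r₂, p₂, e₂, f₂⟩ :=
    h₂ ρ _ m₁ hP.2 (hρ.congr e₁) r₁.mem_le (by omega) (by omega) (by omega)
  refine ⟨m₂, by simpa only [add_assoc] using r₁.trans r₂, ?_, fun a h0 ha => ?_, fun a ha => ?_⟩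
  · rw [p₂, p₁, out, List.length_append, mul_add, add_assoc]
  · rw [e₂ a h0 ha, e₁ a h0 ha]
  · rw [f₂ a ha, out, writeOut_append, ← p₁]
    exact writeOut_congr _ _ (f₁ a ha)

theorem bind (h₁ : e.CompilesCorrectly P inp V) (h₂ : CompilesCorrectly P inp V W g) :
    CompilesCorrectly P inp V W (bind e g) := fun ρ b mem hP hρ hm hW hW' hV => by
  simp only [compile, codeAt_append, List.length_append] at hP ⊢
  simp only [cost, width] at hV hW ⊢
  have hw := e.add_two_le_width ρ.length
  obtain ⟨m₁, r₁, v₁, f₁⟩ := h₁ ρ b mem hP.1 hρ hm (by omega)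
  have run₂ := h₂ (ρ ++ [e.eval inp ρ]) (b + (e.compile ρ.length b).length) m₁
  simp only [List.length_append, List.length_singleton] at run₂
  have h0 := f₁ 0 (by omega)
  obtain ⟨m₂, r₂, p₂, e₂, f₂⟩ := run₂ hP.2 ((hρ.congr fun a _ ha => f₁ a (.inl ha)).append v₁)
    r₁.mem_le (by omega) (by omega) (by omega)
  refine ⟨m₂, by simpa only [add_assoc] using r₁.trans r₂, by rw [p₂, h0, out],
    fun a h0 ha => ?_, fun a ha => ?_⟩
  · rw [e₂ a h0 (by omega), f₁ a (by omega)]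
  · rw [f₂ a ha, out, h0]
    exact writeOut_congr _ _ (f₁ a (by omega))

theorem isLoopInvariant (h : CompilesCorrectly P inp V W body) {ρ : List ℕ} {b n : ℕ}
    {m₀ : ℕ → ℕ} (hP : CodeAt P (b + 3) (body.compile (ρ.length + 2) (b + 3)))
    (hρ : Holds ρ m₀) (hW : body.width (ρ.length + 2) ≤ W) (hW' : W ≤ m₀ 0)
    (hV : m₀ 0 + ∑ j ∈ Finset.range n, body.cost inp (ρ ++ [n, j]) ≤ V) :
    IsLoopInvariant P inp V (ρ.length + 1) (ρ.length + 2) (ρ.length + 3) b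
      (body.compile (ρ.length + 2) (b + 3)) n (fun j => body.cost inp (ρ ++ [n, j]))
      fun j m => m (ρ.length + 1) = n ∧
        m 0 = m₀ 0 + 2 * ((List.range j).flatMap fun i => body.out inp (ρ ++ [n, i])).length ∧
        (∀ a, 0 < a → a ≤ ρ.length → m a = m₀ a) ∧
        ∀ a, W ≤ a → m a =
          writeOut m₀ (m₀ 0) ((List.range j).flatMap fun i => body.out inp (ρ ++ [n, i])) a where
  count_eq h := h.1
  congr := by
    rintro j m m' ⟨hn, hp, he, hf⟩ hm'
    have hw := add_two_le_width body (ρ.length + 2)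
    exact ⟨by rw [hm' _ (by omega) (by omega), hn], by rw [hm' _ (by omega) (by omega), hp],
      fun a h0 ha => by rw [hm' a (by omega) (by omega), he a h0 ha],
      fun a ha => by rw [hm' a (by omega) (by omega), hf a ha]⟩
  round := by
    rintro j m hj ⟨hn, hp, he, hf⟩ hi hmV
    have henv : Holds (ρ ++ [n] ++ [j]) m :=
      ((hρ.congr he).append hn).append (by simpa only [List.length_append, List.length_singleton])
    have run := h (ρ ++ [n] ++ [j]) (b + 3) m
    simp only [List.length_append, List.length_singleton, add_assoc, Nat.reduceAdd] at run
    simp only [← add_assoc, List.append_assoc, List.singleton_append] at run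
    have hspace : m 0 + body.cost inp (ρ ++ [n, j]) ≤ V := by
      have hout := two_mul_length_flatMap_range_le
        (fun i => two_mul_length_out_le inp body (ρ ++ [n, i])) j
      have hsum := Finset.sum_le_sum_of_subset (f := fun i => body.cost inp (ρ ++ [n, i]))
        (Finset.range_mono (Nat.succ_le_of_lt hj))
      rw [Finset.sum_range_succ] at hsum
      omega
    obtain ⟨m₁, r, p, e, f⟩ := run hP (by simpa using henv) hmV hW (by omega) hspace
    simp only [List.range_succ, List.flatMap_append, List.flatMap_singleton, List.length_append]
    refine ⟨m₁, r, by rw [e _ (by omega) (by omega), hi], by rw [e _ (by omega) (by omega), hn],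
      by omega, fun a h0 ha => by rw [e a h0 (by omega), he a h0 ha], fun a ha => ?_⟩
    rw [f a ha, writeOut_append, hp]
    exact writeOut_congr _ _ (hf a ha)

theorem loop (h₁ : count.CompilesCorrectly P inp V) (h₂ : CompilesCorrectly P inp V W body) :
    CompilesCorrectly P inp V W (loop count body) := fun ρ b mem hP hρ hm hW hW' hV => by
  simp only [compile, codeAt_append, List.length_append] at hP ⊢
  simp only [cost, width] at hV hW ⊢
  have hw := count.add_two_le_width ρ.length
  obtain ⟨m₁, r₁, v₁, f₁⟩ := h₁ ρ b mem hP.1 hρ hm (by omega)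
  have h0 := f₁ 0 (by omega)
  set n := count.eval inp ρ
  have hsum := Finset.sum_le_sum (s := Finset.range n)
    fun j _ => Nat.le_add_right (body.cost inp (ρ ++ [n, j])) 5
  have invariant := h₂.isLoopInvariant (codeAt_append.1 (codeAt_append.1 hP.2).2).1
    (hρ.congr fun a _ ha => f₁ a (.inl ha)) (n := n) (by omega) (by omega) (by omega)
  obtain ⟨m₂, r₂, -, p₂, e₂, f₂⟩ := invariant.runs_countedLoop hP.2 (by omega)
    ⟨v₁, by simp, fun _ _ _ => rfl, fun _ _ => by simp [writeOut]⟩ r₁.mem_le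
  refine ⟨m₂, ((r₁.trans r₂).of_pc_eq (by rw [add_assoc])).mono (by omega), by rw [p₂, h0, out],
    fun a h0 ha => ?_, fun a ha => ?_⟩
  · rw [e₂ a h0 ha, f₁ a (by omega)]
  · rw [f₂ a ha, out, h0]
    exact writeOut_congr _ _ (f₁ a (by omega))

end CompilesCorrectly

theorem compilesCorrectly (P : Program) {inp : List ℕ} {V : ℕ} (W : ℕ)
    (hinp : ∀ x ∈ inp, x ≤ V) (g : Gen) : g.CompilesCorrectly P inp V W := by
  induction g with
  | emit e => exact .emit (e.compilesCorrectly P hinp)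
  | seq _ _ h₁ h₂ => exact .seq h₁ h₂
  | bind e _ h => exact .bind (e.compilesCorrectly P hinp) h
  | loop count _ h => exact .loop (count.compilesCorrectly P hinp) h

end Gen

/-! ### Running a program on a computed input -/

/-- The instruction `j`, followed by a jump, in four cells of the program. -/
def simDirect (next : ℕ) (j : Instr) : List Instr :=
  [j, .jump next, .halt false, .halt false]

/-- Three instructions that write `2 * mem[x] + r` to the cell `0`, and then the instruction `j`. -/
def simIndirect (x r : ℕ) (j : Instr) : List Instr :=
  [.add 0 x x, .const 1 r, .add 0 0 1, j]

/-- Four instructions that have the effect of the given one, where the memory of the simulated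
program is in the cells `R + 1, R + 3, …` and its input in the cells `R, R + 2, …`. -/
def simInstr (R base pc : ℕ) : Instr → List Instr
  | .const d v => simDirect (base + 4 * (pc + 1)) (.const (R + 2 * d + 1) v)
  | .copy d a => simDirect (base + 4 * (pc + 1)) (.copy (R + 2 * d + 1) (R + 2 * a + 1))
  | .add d a b =>
    simDirect (base + 4 * (pc + 1)) (.add (R + 2 * d + 1) (R + 2 * a + 1) (R + 2 * b + 1))
  | .sub d a b =>
    simDirect (base + 4 * (pc + 1)) (.sub (R + 2 * d + 1) (R + 2 * a + 1) (R + 2 * b + 1))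
  | .mul d a b =>
    simDirect (base + 4 * (pc + 1)) (.mul (R + 2 * d + 1) (R + 2 * a + 1) (R + 2 * b + 1))
  | .div d a b =>
    simDirect (base + 4 * (pc + 1)) (.div (R + 2 * d + 1) (R + 2 * a + 1) (R + 2 * b + 1))
  | .mod d a b =>
    simDirect (base + 4 * (pc + 1)) (.mod (R + 2 * d + 1) (R + 2 * a + 1) (R + 2 * b + 1))
  | .load d a => simIndirect (R + 2 * a + 1) (R + 1) (.load (R + 2 * d + 1) 0)
  | .store d a => simIndirect (R + 2 * d + 1) (R + 1) (.store 0 (R + 2 * a + 1))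
  | .read d a => simIndirect (R + 2 * a + 1) R (.load (R + 2 * d + 1) 0)
  | .jump l => [.jump (base + 4 * l), .halt false, .halt false, .halt false]
  | .jumpZero a l => simDirect (base + 4 * (pc + 1)) (.jumpZero (R + 2 * a + 1) (base + 4 * l))
  | .halt b => [.halt b, .halt false, .halt false, .halt false]

theorem length_simInstr (R base pc : ℕ) (i : Instr) : (simInstr R base pc i).length = 4 := by
  cases i <;> rfl

/-- The simulation of a whole program, whose first instruction has the number `pc`. -/
def simulate (R base : ℕ) : ℕ → Program → Program
  | _, [] => []
  | pc, i :: P => simInstr R base pc i ++ simulate R base (pc + 1) P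

theorem codeAt_simInstr {Q P : Program} {R base k j : ℕ} {i : Instr}
    (h : CodeAt Q (base + 4 * k) (simulate R base k P)) (hi : P[j]? = some i) :
    CodeAt Q (base + 4 * (k + j)) (simInstr R base (k + j) i) := by
  induction P generalizing k j with
  | nil => simp at hi
  | cons i' P ih =>
    rw [simulate, codeAt_append, length_simInstr] at h
    cases j with
    | zero =>
      obtain rfl : i' = i := by simpa using hi
      exact h.1
    | succ j =>
      have := ih (k := k + 1) (j := j) h.2 (by simpa using hi)
      rwa [add_right_comm, add_assoc k j 1] at this

/-- The memory `mem` contains the memory `m` and the input `inp` of the simulated program. -/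
structure Simulates (R : ℕ) (inp : List ℕ) (m mem : ℕ → ℕ) : Prop where
  memory : ∀ a, mem (R + 2 * a + 1) = m a
  input : ∀ j, mem (R + 2 * j) = inp.getD j 0

namespace Simulates

variable {P Q : Program} {R base V U d v : ℕ} {inp inp₀ : List ℕ} {m mem : ℕ → ℕ} {c : Config}
  {j : Instr}

theorem update (h : Simulates R inp m mem) (d v : ℕ) :
    Simulates R inp (Function.update m d v) (Function.update mem (R + 2 * d + 1) v) where
  memory a := by
    simp only [Function.update_apply, h.memory, show R + 2 * a + 1 = R + 2 * d + 1 ↔ a = d by omega]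
  input j := by rw [Function.update_of_ne (by omega), h.input]

theorem scratch (h : Simulates R inp m mem) {d : ℕ} (hd : d < R) (v : ℕ) :
    Simulates R inp m (Function.update mem d v) where
  memory a := by rw [Function.update_of_ne (by omega), h.memory]
  input j := by rw [Function.update_of_ne (by omega), h.input]

theorem of_writeOut {l : List ℕ} (h : ∀ a, R ≤ a → mem a = writeOut (fun _ => 0) R l a) :
    Simulates R l init.mem mem where
  memory a := by
    rw [h _ (by omega), writeOut_of_ne _ _ _ (by omega)]
    rfl
  input j := by
    rw [h _ (by omega)]
    by_cases hj : j < l.length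
    · rw [writeOut_apply _ _ _ _ hj, List.getD_eq_getElem _ _ hj]
    · rw [writeOut_of_ne _ _ _ (by omega), List.getD_eq_default _ _ (not_lt.1 hj)]

theorem runs_direct (hs : Simulates R inp c.mem mem) (hmem : ∀ a, mem a ≤ V)
    (hQ : CodeAt Q (base + 4 * c.pc) (simDirect (base + 4 * (c.pc + 1)) j)) (hv : v ≤ V)
    (hj : j.exec inp₀ ⟨base + 4 * c.pc, mem⟩ =
      ⟨base + 4 * c.pc + 1, Function.update mem (R + 2 * d + 1) v⟩) :
    ∃ mem', Runs Q inp₀ V 4 ⟨base + 4 * c.pc, mem⟩ ⟨base + 4 * (c.set d v).pc, mem'⟩ ∧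
      Simulates R inp (c.set d v).mem mem' := by
  have s₁ := Runs.write _ v hQ.1 hj hmem hv
  have s₂ := Runs.goto (inp := inp₀) (base + 4 * (c.pc + 1)) hQ.2.1 rfl s₁.mem_le
  exact ⟨_, (s₁.trans s₂).mono (by omega), hs.update d v⟩

theorem runs_indirect (hs : Simulates R inp c.mem mem) (hmem : ∀ a, mem a ≤ V) (hR : 2 ≤ R)
    {x r : ℕ} (hQ : CodeAt Q (base + 4 * c.pc) (simIndirect (R + 2 * x + 1) r j))
    (hx : 2 * c.mem x + r ≤ V) (hv : v ≤ V)
    (hj : ∀ mem', Simulates R inp c.mem mem' → mem' 0 = 2 * c.mem x + r →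
      j.exec inp₀ ⟨base + 4 * c.pc + 3, mem'⟩ =
        ⟨base + 4 * c.pc + 4, Function.update mem' (R + 2 * d + 1) v⟩) :
    ∃ mem', Runs Q inp₀ V 4 ⟨base + 4 * c.pc, mem⟩ ⟨base + 4 * (c.set d v).pc, mem'⟩ ∧
      Simulates R inp (c.set d v).mem mem' := by
  have s₁ := Runs.write (inp := inp₀) (V := V) 0 (2 * c.mem x) hQ.1
    (by simp [Instr.exec, Config.set, hs.memory, two_mul (c.mem x)]) hmem (by omega)
  have s₂ := Runs.write (inp := inp₀) 1 r hQ.2.1 rfl s₁.mem_le (by omega)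
  have s₃ := Runs.write (inp := inp₀) 0 (2 * c.mem x + r) hQ.2.2.1
    (by simp [Instr.exec, Config.set]) s₂.mem_le (by omega)
  have hs' := ((hs.scratch (d := 0) (by omega) (2 * c.mem x)).scratch (d := 1) (by omega) r).scratch
    (d := 0) (by omega) (2 * c.mem x + r)
  have s₄ := Runs.write _ v hQ.2.2.2.1 (hj _ hs' (Function.update_self ..)) s₃.mem_le hv
  exact ⟨_, ((s₁.trans s₂).trans s₃).trans s₄, hs'.update d v⟩

theorem exec (hs : Simulates R inp c.mem mem) (hmem : ∀ a, mem a ≤ V) (hR : 2 ≤ R)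
    (hV : 2 * U + R + 1 ≤ V) {i : Instr}
    (hQ : CodeAt Q (base + 4 * c.pc) (simInstr R base c.pc i)) (hc : ∀ a, c.mem a ≤ U)
    (hc' : ∀ a, (i.exec inp c).mem a ≤ U) :
    ∃ mem', Runs Q inp₀ V 4 ⟨base + 4 * c.pc, mem⟩ ⟨base + 4 * (i.exec inp c).pc, mem'⟩ ∧
      Simulates R inp (i.exec inp c).mem mem' := by
  have set_le : ∀ {d v}, (∀ a, (c.set d v).mem a ≤ U) → v ≤ V := fun {d v} h => by
    have : v ≤ U := by simpa [Config.set] using h d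
    omega
  have address_le : ∀ {x r}, r ≤ R + 1 → 2 * c.mem x + r ≤ V := fun {x _} _ => by
    have := hc x
    omega
  cases i with
  | const d v => exact hs.runs_direct hmem hQ (set_le hc') rfl
  | copy | add | sub | mul | div | mod =>
    exact hs.runs_direct hmem hQ (set_le hc') (by simp [Instr.exec, Config.set, hs.memory])
  | load d a =>
    refine hs.runs_indirect hmem hR hQ (address_le le_rfl) (set_le hc') fun mem' hs' h0 => ?_
    simp only [Instr.exec, Config.set, h0]
    rw [show 2 * c.mem a + (R + 1) = R + 2 * c.mem a + 1 by ring, hs'.memory]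
  | store d a =>
    refine hs.runs_indirect hmem hR hQ (address_le le_rfl) (set_le hc') fun mem' hs' h0 => ?_
    simp only [Instr.exec, Config.set, h0, hs'.memory]
    rw [show 2 * c.mem d + (R + 1) = R + 2 * c.mem d + 1 by ring]
  | read d a =>
    refine hs.runs_indirect hmem hR hQ (address_le (by omega)) (set_le hc') fun mem' hs' h0 => ?_
    simp only [Instr.exec, Config.set, h0]
    rw [show 2 * c.mem a + R = R + 2 * c.mem a by ring, hs'.input]
  | jump l => exact ⟨mem, (Runs.goto _ hQ.1 rfl hmem).mono (by omega), hs⟩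
  | jumpZero a l =>
    by_cases ha : c.mem a = 0
    · refine ⟨mem, (Runs.goto _ hQ.1 ?_ hmem).mono (by omega), ?_⟩
      · simp [Instr.exec, ha, hs.memory]
      · simpa [Instr.exec, ha] using hs
    · have s₁ := Runs.goto (inp := inp₀) (base + 4 * c.pc + 1) hQ.1
        (by simp [Instr.exec, ha, hs.memory]) hmem
      have s₂ := Runs.goto (inp := inp₀) (base + 4 * (c.pc + 1)) hQ.2.1 rfl hmem
      refine ⟨mem, ?_, ?_⟩
      · simpa [Instr.exec, ha] using (s₁.trans s₂).mono (show 1 + 1 ≤ 4 by omega)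
      · simpa [Instr.exec, ha] using hs
  | halt b => exact ⟨mem, (Runs.refl hmem).mono (by omega), hs⟩

theorem step (hs : Simulates R inp c.mem mem) (hmem : ∀ a, mem a ≤ V) (hR : 2 ≤ R)
    (hV : 2 * U + R + 1 ≤ V) (hQ : CodeAt Q base (simulate R base 0 P)) (hc : ∀ a, c.mem a ≤ U)
    (hc' : ∀ a, (step P inp c).mem a ≤ U) :
    ∃ mem', Runs Q inp₀ V 4 ⟨base + 4 * c.pc, mem⟩ ⟨base + 4 * (RAM.step P inp c).pc, mem'⟩ ∧
      Simulates R inp (RAM.step P inp c).mem mem' := by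
  cases hi : P[c.pc]? with
  | none =>
    rw [show RAM.step P inp c = c by simp [RAM.step, hi]]
    exact ⟨mem, (Runs.refl hmem).mono (by omega), hs⟩
  | some i =>
    rw [step_eq_exec hi] at hc' ⊢
    have code := codeAt_simInstr (k := 0) hQ hi
    rw [zero_add] at code
    exact hs.exec hmem hR hV code hc hc'

theorem runs (hs : Simulates R inp init.mem mem) (hmem : ∀ a, mem a ≤ V) (hR : 2 ≤ R)
    (hV : 2 * U + R + 1 ≤ V) (hQ : CodeAt Q base (simulate R base 0 P)) {T : ℕ}
    (hU : ∀ i ≤ T, ∀ a, (configAt P inp i).mem a ≤ U) :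
    ∃ mem', Runs Q inp₀ V (4 * T) ⟨base, mem⟩ ⟨base + 4 * (configAt P inp T).pc, mem'⟩ ∧
      Simulates R inp (configAt P inp T).mem mem' := by
  induction T with
  | zero => exact ⟨mem, Runs.refl hmem, hs⟩
  | succ T ih =>
    obtain ⟨m₁, r₁, hs₁⟩ := ih fun i hi => hU i (by omega)
    have hstep : configAt P inp (T + 1) = RAM.step P inp (configAt P inp T) :=
      Function.iterate_succ_apply' _ _ _
    obtain ⟨m₂, r₂, hs₂⟩ := hs₁.step (inp₀ := inp₀) r₁.mem_le hR hV hQ (hU T (by omega))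
      (hstep ▸ hU (T + 1) le_rfl)
    rw [← hstep] at r₂ hs₂
    exact ⟨m₂, (r₁.trans r₂).mono (by omega), hs₂⟩

end Simulates

theorem le_foldr_max {l : List ℕ} {x : ℕ} (h : x ∈ l) : x ≤ l.foldr max 0 :=
  List.le_max_of_le h le_rfl

namespace Gen

/-- Runs the generator `g` and then the program `P` on the list that `g` has written. -/
def pipe (g : Gen) (P : Program) : Program :=
  [.const 0 (g.width 0)] ++ g.compile 0 1 ++ simulate (g.width 0) (1 + (g.compile 0 1).length) 0 P

variable (g : Gen) (P : Program) {inp : List ℕ} {V : ℕ}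

theorem codeAt_pipe_simulate : CodeAt (g.pipe P) (1 + (g.compile 0 1).length)
    (simulate (g.width 0) (1 + (g.compile 0 1).length) 0 P) := by
  have := codeAt_length_append ([.const 0 (g.width 0)] ++ g.compile 0 1)
    (simulate (g.width 0) (1 + (g.compile 0 1).length) 0 P) []
  rwa [List.append_nil, List.length_append] at this

theorem runs_pipe_out (hinp : ∀ x ∈ inp, x ≤ V) (hV : g.width 0 + g.cost inp [] ≤ V) :
    ∃ mem, Runs (g.pipe P) inp V (1 + g.cost inp []) init ⟨1 + (g.compile 0 1).length, mem⟩ ∧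
      ∀ a, g.width 0 ≤ a → mem a = writeOut (fun _ => 0) (g.width 0) (g.out inp []) a := by
  have s := Runs.write (P := g.pipe P) (inp := inp) (V := V) (b := 0) (mem := fun _ => 0) 0
    (g.width 0) rfl rfl (fun _ => Nat.zero_le _) (by omega)
  have hR := g.add_two_le_width 0
  obtain ⟨mem, r, -, -, hm⟩ := g.compilesCorrectly (g.pipe P) (g.width 0) hinp [] 1 _
    (codeAt_length_append [.const 0 (g.width 0)] _ _) .nil s.mem_le le_rfl (by simp) (by simpa)
  refine ⟨mem, s.trans r, fun a ha => ?_⟩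
  rw [hm a ha, Function.update_self]
  exact writeOut_congr _ _ (Function.update_of_ne (by omega) _ _)

theorem mem_out_le {y : ℕ} (hy : y ∈ g.out inp []) :
    y ≤ inp.foldr max 0 + g.width 0 + g.cost inp [] := by
  obtain ⟨mem, r, hm⟩ := g.runs_pipe_out (inp := inp)
    (V := inp.foldr max 0 + g.width 0 + g.cost inp []) []
    (fun x hx => (le_foldr_max hx).trans (by omega)) (by omega)
  obtain ⟨i, hi, rfl⟩ := List.getElem_of_mem hy
  rw [← writeOut_apply (fun _ => 0) (g.width 0) _ i hi, ← hm _ (by omega)]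
  exact r.mem_le _

theorem exists_configAt_pipe {T U : ℕ}
    (hU : ∀ i ≤ T, ∀ a, (configAt P (g.out inp []) i).mem a ≤ U) :
    ∃ T' ≤ 1 + g.cost inp [] + 4 * T,
      (configAt (g.pipe P) inp T').pc =
        1 + (g.compile 0 1).length + 4 * (configAt P (g.out inp []) T).pc ∧
      ∀ i ≤ T', ∀ a, (configAt (g.pipe P) inp i).mem a ≤
        inp.foldr max 0 + 2 * g.width 0 + 1 + g.cost inp [] + 2 * U := by
  obtain ⟨mem₁, r₁, hm⟩ := g.runs_pipe_out (inp := inp)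
    (V := inp.foldr max 0 + 2 * g.width 0 + 1 + g.cost inp [] + 2 * U) P
    (fun x hx => (le_foldr_max hx).trans (by omega))
    (by omega)
  obtain ⟨mem₂, r₂, -⟩ := (Simulates.of_writeOut hm).runs (U := U) r₁.mem_le (g.add_two_le_width 0)
    (by omega) (g.codeAt_pipe_simulate P) hU
  obtain ⟨T', hT', e, hmem⟩ := r₁.trans r₂
  exact ⟨T', hT', by rw [configAt, e], hmem⟩

theorem answer_pipe {c c' : Config} {b : Bool} (h : answer P c = some b)
    (hpc : c'.pc = 1 + (g.compile 0 1).length + 4 * c.pc) : answer (g.pipe P) c' = some b := by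
  rw [answer] at h
  split at h
  next b' hi =>
    have code := codeAt_simInstr (base := 1 + (g.compile 0 1).length) (k := 0)
      (g.codeAt_pipe_simulate P) hi
    rw [zero_add] at code
    rw [answer, hpc, code.1]
    exact h
  next => cases h

end Gen

/-- The number whose logarithm determines the word length. -/
noncomputable def wordBase (inp : List ℕ) (t : ℝ) : ℕ :=
  inp.length + inp.foldr max 0 + ⌈t⌉₊ + 2

theorem two_pow_wordLength_le (c : ℕ) (inp : List ℕ) (t : ℝ) :
    2 ^ wordLength c inp t ≤ wordBase inp t ^ c := by
  rw [wordLength, mul_comm c, pow_mul]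
  exact Nat.pow_le_pow_left (Nat.pow_log_le_self 2 (by omega)) c

theorem mul_wordBase_pow_lt (A e : ℕ) (inp : List ℕ) (t : ℝ) :
    A * wordBase inp t ^ e < 2 ^ wordLength (2 * (A + e)) inp t := by
  have hY : 2 ≤ wordBase inp t := by unfold wordBase; omega
  change _ < 2 ^ (2 * (A + e) * Nat.log 2 (wordBase inp t))
  set Y := wordBase inp t
  have hA : A < Y ^ A := A.lt_two_pow_self.trans_le (Nat.pow_le_pow_left hY A)
  have hlog : 1 ≤ Nat.log 2 Y := Nat.log_pos (by norm_num) hY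
  have hYlog : Y ≤ 2 ^ (2 * Nat.log 2 Y) :=
    (Nat.lt_pow_succ_log_self (by norm_num) Y).le.trans
      (Nat.pow_le_pow_right (by norm_num) (by omega))
  calc A * Y ^ e < Y ^ A * Y ^ e := Nat.mul_lt_mul_of_pos_right hA (by positivity)
    _ = Y ^ (A + e) := (pow_add _ _ _).symm
    _ ≤ (2 ^ (2 * Nat.log 2 Y)) ^ (A + e) := Nat.pow_le_pow_left hYlog _
    _ = 2 ^ (2 * (A + e) * Nat.log 2 Y) := by rw [← pow_mul]; congr 1; ring

theorem lt_two_pow_wordLength {inp inp' : List ℕ} {t t' : ℝ} {A D V : ℕ} (c : ℕ)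
    (hbase : wordBase inp' t' ≤ D * wordBase inp t)
    (hV : V ≤ A * wordBase inp t + 2 * 2 ^ wordLength c inp' t') :
    V < 2 ^ wordLength (2 * (A + 2 * D ^ c + (c + 1))) inp t := by
  refine lt_of_le_of_lt ?_ (mul_wordBase_pow_lt (A + 2 * D ^ c) (c + 1) inp t)
  have hY : 1 ≤ wordBase inp t := by unfold wordBase; omega
  set Y := wordBase inp t
  calc V ≤ A * Y + 2 * 2 ^ wordLength c inp' t' := hV
    _ ≤ A * Y + 2 * (D * Y) ^ c := Nat.add_le_add_left (Nat.mul_le_mul_left 2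
        ((two_pow_wordLength_le _ _ _).trans (Nat.pow_le_pow_left hbase c))) _
    _ = A * Y + 2 * D ^ c * Y ^ c := by rw [mul_pow, mul_assoc]
    _ ≤ A * Y ^ (c + 1) + 2 * D ^ c * Y ^ (c + 1) := by
        gcongr
        exacts [Nat.le_self_pow (by omega) Y, by omega]
    _ = (A + 2 * D ^ c) * Y ^ (c + 1) := (add_mul _ _ _).symm

theorem wordBase_out_le {g : Gen} {inp : List ℕ} {K : ℕ} {t t' : ℝ}
    (hcost : g.cost inp [] ≤ K * wordBase inp t) (ht : ⌈t'⌉₊ ≤ K * wordBase inp t) :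
    wordBase (g.out inp []) t' ≤ (3 * K + g.width 0 + 3) * wordBase inp t := by
  have hlen := g.two_mul_length_out_le inp []
  have hmax : (g.out inp []).foldr max 0 ≤ inp.foldr max 0 + g.width 0 + g.cost inp [] :=
    List.max_le_of_forall_le _ _ fun _ hy => g.mem_out_le hy
  have hY : inp.foldr max 0 + 2 ≤ wordBase inp t := by unfold wordBase; omega
  have hR : g.width 0 ≤ g.width 0 * wordBase inp t := Nat.le_mul_of_pos_right _ (by omega)
  rw [show (3 * K + g.width 0 + 3) * wordBase inp t = K * wordBase inp t + K * wordBase inp t +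
    K * wordBase inp t + g.width 0 * wordBase inp t + 3 * wordBase inp t by ring]
  rw [show wordBase (g.out inp []) t' =
    (g.out inp []).length + (g.out inp []).foldr max 0 + ⌈t'⌉₊ + 2 from rfl]
  omega

theorem SolvableInTime.of_reduction {α β : Type} {encα : α → List ℕ} {instα yesα : α → Prop}
    {tα : α → ℝ} {encβ : β → List ℕ} {instβ yesβ : β → Prop} {tβ : β → ℝ}
    (h : SolvableInTime encβ instβ yesβ tβ) (g : Gen) (f : α → β) (K : ℕ)
    (hone : ∀ x, instα x → 1 ≤ tα x) (hinst : ∀ x, instα x → instβ (f x))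
    (hyes : ∀ x, instα x → (yesβ (f x) ↔ yesα x))
    (hout : ∀ x, instα x → g.out (encα x) [] = encβ (f x))
    (hcost : ∀ x, instα x → (g.cost (encα x) [] : ℝ) ≤ K * tα x)
    (htime : ∀ x, instα x → tβ (f x) ≤ K * tα x) :
    SolvableInTime encα instα yesα tα := by
  obtain ⟨P, K', c, hP⟩ := h
  refine ⟨g.pipe P, 1 + K + 4 * (K' * K),
    2 * (2 + 2 * g.width 0 + K + 2 * (3 * K + g.width 0 + 3) ^ c + (c + 1)), fun x hx => ?_⟩
  obtain ⟨T, hT, ⟨b, hb, hbyes⟩, hw⟩ := hP (f x) (hinst x hx)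
  rw [← hout x hx] at hb hw
  obtain ⟨T', hT', hpc, hmem⟩ := g.exists_configAt_pipe P fun i hi a => (hw i hi a).le
  refine ⟨T', ?_, ⟨b, g.answer_pipe P hb hpc, hbyes.trans (hyes x hx)⟩, fun i hi a =>
    (hmem i hi a).trans_lt ?_⟩
  · have hT_le : (T : ℝ) ≤ K' * (K * tα x) :=
      hT.trans (mul_le_mul_of_nonneg_left (htime x hx) (Nat.cast_nonneg _))
    have hT'_le : (T' : ℝ) ≤ 1 + g.cost (encα x) [] + 4 * T := mod_cast hT'
    push_cast
    linarith [hone x hx, hcost x hx]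
  · have ht : (tα x : ℝ) ≤ wordBase (encα x) (tα x) :=
      (Nat.le_ceil _).trans (Nat.cast_le.2 (by unfold wordBase; omega))
    have hKt : K * tα x ≤ (K * wordBase (encα x) (tα x) : ℕ) := by
      rw [Nat.cast_mul]
      exact mul_le_mul_of_nonneg_left ht (Nat.cast_nonneg _)
    have hcostY : g.cost (encα x) [] ≤ K * wordBase (encα x) (tα x) :=
      Nat.cast_le.1 ((hcost x hx).trans hKt)
    refine lt_two_pow_wordLength c
      (wordBase_out_le hcostY (Nat.ceil_le.2 ((htime x hx).trans hKt))) ?_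
    have hY : (encα x).foldr max 0 + 2 ≤ wordBase (encα x) (tα x) := by unfold wordBase; omega
    have hR : g.width 0 ≤ g.width 0 * wordBase (encα x) (tα x) :=
      Nat.le_mul_of_pos_right _ (by omega)
    simp only [add_mul, mul_assoc]
    omega

end RAM

/-! ### Orthogonality of three families of vectors as a matching problem -/

namespace TripleMatch

/-- The number of positions in one half of the pattern: `N` blocks, one per vector of the third
family, of `m + 1` positions each. The first position of a block marks its beginning, the others
stand for the coordinates. -/
def patHalf (N m : ℕ) : ℕ := N * (m + 1)

/-- The number of cells in one half of the text, again grouped into blocks of length `m + 1`. -/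
def textHalf (N m : ℕ) : ℕ := (3 * N - 2) * (m + 1)

/-- The half in which a position lies, for two halves of length `X`. -/
def side (X c : ℕ) : ℕ := if c < X then 0 else 1

/-- The distance of a position from its end, for two halves of length `X`. -/
def fold (X c : ℕ) : ℕ := if c < X then c else 2 * X - 1 - c

/-- The stage of the block `b` of a half of the text: the `N` blocks of stage `1`, which stand for
the vectors of a family, lie between `N - 1` blocks of stage `0` and `N - 1` blocks of stage `2`. -/
def stage (N b : ℕ) : ℕ := if b < N - 1 then 0 else if b < 2 * N - 1 then 1 else 2

/-- The bit represented by the cell `q` of the half `s` of the text, where `F s` is the family of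
vectors for this half. -/
def bit (N m : ℕ) (F : ℕ → ℕ → ℕ → ℕ) (s q : ℕ) : ℕ :=
  if stage N (q / (m + 1)) = 1 ∧ q % (m + 1) ≠ 0 then
    F s (q / (m + 1) - (N - 1)) (q % (m + 1) - 1) else 0

/-- The position, inside its cell, of the only nonzero letter of the cell `q` of the half `s` of the
text. It encodes the stage and the bit of the cell. The bit enters with different signs in the two
halves, so that the distance of two mirrored letters reveals the sum of their bits. -/
def offset (N m : ℕ) (F : ℕ → ℕ → ℕ → ℕ) (s q : ℕ) : ℕ :=
  4 * stage N (q / (m + 1)) + if s = 0 then bit N m F s q else 1 - bit N m F s q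

/-- The letter for the half `s`; the first cell of a block has its own letter. -/
def symbol (m s q : ℕ) : ℕ := 1 + 2 * s + if q % (m + 1) = 0 then 0 else 1

/-- The letters of the text, which consists of cells of width `20`. -/
def textLetter (N m : ℕ) (F : ℕ → ℕ → ℕ → ℕ) (p : ℕ) : ℕ :=
  let s := side (textHalf N m) (p / 20)
  let q := fold (textHalf N m) (p / 20)
  if p % 20 = offset N m F s q then symbol m s q else 0

/-- The letters of the pattern. -/
def patLetter (N m i : ℕ) : ℕ := symbol m (side (patHalf N m) i) (fold (patHalf N m) i)

/-- The gap lengths that are allowed by the constraints of kind `τ`. In terms of `x + 1`, which is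
the distance of the two letters, kind `0` says that the cells are adjacent and have the same stage,
kind `1` that the stage grows by at most one, and kinds `2` and `3` that the stages agree, where
kind `3` moreover forbids that both bits are `1`. -/
def Allowed (τ x : ℕ) : Prop :=
  if τ = 0 then 18 ≤ x ∧ x ≤ 20
  else if τ = 1 then (x + 1) % 20 = 19 ∨ (x + 1) % 20 ≤ 5
  else if τ = 2 then (x + 1) % 20 = 19 ∨ (x + 1) % 20 ≤ 1
  else if τ = 3 then (x + 1) % 20 ≤ 1
  else True

/-- The kind of the constraint between a position of the pattern and its mirror image. -/
def pairKind (m : ℕ) (F : ℕ → ℕ → ℕ → ℕ) (i : ℕ) : ℕ :=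
  2 + if i % (m + 1) = 0 then 0 else F 2 (i / (m + 1)) (i % (m + 1) - 1)

/-- The kind of the constraint between two neighbours in the left half of the pattern. -/
def leftKind (m i : ℕ) : ℕ := if i % (m + 1) = m then 1 else 0

/-- The kind of the constraint between the mirror images of `i` and `i + 1` in the right half of the
pattern. -/
def rightKind (m i : ℕ) : ℕ := if i % (m + 1) = m then 4 else 0

/-- The constraints: left position, right position, kind. -/
def data (N m : ℕ) (F : ℕ → ℕ → ℕ → ℕ) : List (ℕ × ℕ × ℕ) :=
  (List.range (patHalf N m)).map (fun i => (i, 2 * patHalf N m - 1 - i, pairKind m F i)) ++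
  (List.range (patHalf N m - 1)).map (fun i => (i, i + 1, leftKind m i)) ++
  (List.range (patHalf N m - 1)).map (fun i =>
    (2 * patHalf N m - 2 - i, 2 * patHalf N m - 1 - i, rightKind m i))

/-- The map `e` of positions matches the pattern in the text and satisfies the constraints. -/
structure IsEmbedding (N m : ℕ) (F : ℕ → ℕ → ℕ → ℕ) (e : ℕ → ℕ) : Prop where
  strictMono : ∀ i j, i < j → j < 2 * patHalf N m → e i < e j
  lt : ∀ i < 2 * patHalf N m, e i < 40 * textHalf N m
  letter : ∀ i < 2 * patHalf N m, textLetter N m F (e i) = patLetter N m i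
  allowed : ∀ d ∈ data N m F, Allowed d.2.2 (e d.2.1 - e d.1 - 1)

/-- The position in the text of the only nonzero letter of the cell `q` of the half `s`. -/
def textPos (N m : ℕ) (F : ℕ → ℕ → ℕ → ℕ) (s q : ℕ) : ℕ :=
  20 * (if s = 0 then q else 2 * textHalf N m - 1 - q) + offset N m F s q

/-- An embedding described by the cells `L i` and `R i` in which the position `i` of the left half
of the pattern and its mirror image are placed. -/
structure IsPlacement (N m : ℕ) (F : ℕ → ℕ → ℕ → ℕ) (L R : ℕ → ℕ) : Prop where
  left_lt : ∀ i < patHalf N m, L i < textHalf N m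
  right_lt : ∀ i < patHalf N m, R i < textHalf N m
  left_strictMono : ∀ i j, i < j → j < patHalf N m → L i < L j
  right_strictMono : ∀ i j, i < j → j < patHalf N m → R i < R j
  left_mod : ∀ i < patHalf N m, L i % (m + 1) = 0 ↔ i % (m + 1) = 0
  right_mod : ∀ i < patHalf N m, R i % (m + 1) = 0 ↔ i % (m + 1) = 0
  pair : ∀ i < patHalf N m,
    Allowed (pairKind m F i) (textPos N m F 1 (R i) - textPos N m F 0 (L i) - 1)
  left : ∀ i, i + 1 < patHalf N m →
    Allowed (leftKind m i) (textPos N m F 0 (L (i + 1)) - textPos N m F 0 (L i) - 1)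
  right : ∀ i, i + 1 < patHalf N m →
    Allowed (rightKind m i) (textPos N m F 1 (R i) - textPos N m F 1 (R (i + 1)) - 1)

/-- An embedding described by the blocks `A j` and `B j` in which the block `j` of the left half of
the pattern and its mirror image are placed. -/
structure IsBlockPlacement (N m : ℕ) (F : ℕ → ℕ → ℕ → ℕ) (A B : ℕ → ℕ) : Prop where
  left_lt : ∀ j < N, A j < 3 * N - 2
  right_lt : ∀ j < N, B j < 3 * N - 2
  left_strictMono : ∀ i j, i < j → j < N → A i < A j
  right_strictMono : ∀ i j, i < j → j < N → B i < B j
  stage_succ_le : ∀ j, j + 1 < N → stage N (A (j + 1)) ≤ stage N (A j) + 1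
  stage_right : ∀ j < N, stage N (B j) = stage N (A j)
  not_and : ∀ j < N, stage N (A j) = 1 → ∀ k < m,
    ¬ (F 0 (A j - (N - 1)) k = 1 ∧ F 1 (B j - (N - 1)) k = 1 ∧ F 2 j k = 1)

/-- The cell of the position `i` if the block `j` is placed in the block `A j`. -/
def cellOf (m : ℕ) (A : ℕ → ℕ) (i : ℕ) : ℕ := A (i / (m + 1)) * (m + 1) + i % (m + 1)

/-- The block of the text in which the block `j` of the pattern is placed, if the block `c` of the
pattern goes to the block with number `x` of stage `1`. -/
def blockOf (N c x j : ℕ) : ℕ :=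
  if j < c then j else if j = c then N - 1 + x else 2 * N - 2 + (j - c)

variable {N m : ℕ} {F : ℕ → ℕ → ℕ → ℕ}

theorem mul_succ_add_div {k : ℕ} (b : ℕ) (hk : k ≤ m) : (b * (m + 1) + k) / (m + 1) = b := by
  rw [mul_comm, Nat.mul_add_div m.succ_pos, Nat.div_eq_of_lt (Nat.lt_succ_of_le hk), add_zero]

theorem mul_succ_add_mod {k : ℕ} (b : ℕ) (hk : k ≤ m) : (b * (m + 1) + k) % (m + 1) = k := by
  rw [mul_comm, Nat.mul_add_mod, Nat.mod_eq_of_lt (Nat.lt_succ_of_le hk)]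

theorem mul_succ_add_lt {n j k : ℕ} (hj : j < n) (hk : k ≤ m) :
    j * (m + 1) + k < n * (m + 1) :=
  calc j * (m + 1) + k < (j + 1) * (m + 1) := by rw [add_mul]; omega
    _ ≤ n * (m + 1) := Nat.mul_le_mul_right _ hj

theorem stage_le (N b : ℕ) : stage N b ≤ 2 := by
  unfold stage
  split_ifs <;> omega

theorem sub_lt_of_stage_eq_one {b : ℕ} (h : stage N b = 1) : b - (N - 1) < N := by
  unfold stage at h
  split_ifs at h <;> omega

theorem bit_le (hF : ∀ g i k, F g i k ≤ 1) (s q : ℕ) : bit N m F s q ≤ 1 := by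
  unfold bit
  split_ifs
  · exact hF _ _ _
  · omega

theorem bit_mul_succ_add_succ {b k : ℕ} (hk : k < m) (s : ℕ) (hb : stage N b = 1) :
    bit N m F s (b * (m + 1) + (k + 1)) = F s (b - (N - 1)) k := by
  rw [bit, mul_succ_add_div b hk, mul_succ_add_mod b hk, if_pos ⟨hb, k.succ_ne_zero⟩]
  rfl

theorem offset_lt (hF : ∀ g i k, F g i k ≤ 1) (s q : ℕ) : offset N m F s q < 20 := by
  have := stage_le N (q / (m + 1))
  have := bit_le (N := N) (m := m) hF s q
  unfold offset
  split_ifs <;> omega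

theorem mem_data {d : ℕ × ℕ × ℕ} : d ∈ data N m F ↔
    (∃ i < patHalf N m, d = (i, 2 * patHalf N m - 1 - i, pairKind m F i)) ∨
    (∃ i < patHalf N m - 1, d = (i, i + 1, leftKind m i)) ∨
    (∃ i < patHalf N m - 1,
      d = (2 * patHalf N m - 2 - i, 2 * patHalf N m - 1 - i, rightKind m i)) := by
  simp only [data, List.mem_append, List.mem_map, List.mem_range, or_assoc, eq_comm]

theorem eq_and_mod_eq_zero_iff_of_symbol_eq {s s' q q' : ℕ} (h : symbol m s q = symbol m s' q') :
    s = s' ∧ (q % (m + 1) = 0 ↔ q' % (m + 1) = 0) := by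
  unfold symbol at h
  split_ifs at h <;> constructor <;> omega

theorem symbol_congr {q q' : ℕ} (s : ℕ) (h : q % (m + 1) = 0 ↔ q' % (m + 1) = 0) :
    symbol m s q = symbol m s q' := by
  simp only [symbol, h]

theorem patLetter_left {i : ℕ} (hi : i < patHalf N m) : patLetter N m i = symbol m 0 i := by
  simp only [patLetter, side, fold, if_pos hi]

theorem patLetter_right {i : ℕ} (hi : i < patHalf N m) :
    patLetter N m (2 * patHalf N m - 1 - i) = symbol m 1 i := by
  have hlt : ¬ 2 * patHalf N m - 1 - i < patHalf N m := by omega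
  simp only [patLetter, side, fold, if_neg hlt]
  congr 1
  omega

theorem textPos_zero (q : ℕ) :
    textPos N m F 0 q = 20 * q + (4 * stage N (q / (m + 1)) + bit N m F 0 q) := rfl

theorem textPos_one (q : ℕ) :
    textPos N m F 1 q = 20 * (2 * textHalf N m - 1 - q) +
      (4 * stage N (q / (m + 1)) + (1 - bit N m F 1 q)) := rfl

theorem textLetter_textPos_zero (hF : ∀ g i k, F g i k ≤ 1) {q : ℕ} (hq : q < textHalf N m) :
    textLetter N m F (textPos N m F 0 q) = symbol m 0 q := by
  have hoff := offset_lt (N := N) (m := m) hF 0 q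
  have hdiv : textPos N m F 0 q / 20 = q := by simp only [textPos, if_pos]; omega
  have hmod : textPos N m F 0 q % 20 = offset N m F 0 q := by simp only [textPos]; omega
  simp only [textLetter, hdiv, hmod, side, fold, if_pos hq, if_true]

theorem textLetter_textPos_one (hF : ∀ g i k, F g i k ≤ 1) {q : ℕ} (hq : q < textHalf N m) :
    textLetter N m F (textPos N m F 1 q) = symbol m 1 q := by
  have hoff := offset_lt (N := N) (m := m) hF 1 q
  have hdiv : textPos N m F 1 q / 20 = 2 * textHalf N m - 1 - q := by
    simp only [textPos, one_ne_zero, if_false]; omega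
  have hmod : textPos N m F 1 q % 20 = offset N m F 1 q := by simp only [textPos]; omega
  have hlt : ¬ 2 * textHalf N m - 1 - q < textHalf N m := by omega
  have hfold : 2 * textHalf N m - 1 - (2 * textHalf N m - 1 - q) = q := by omega
  simp only [textLetter, hdiv, hmod, side, fold, if_neg hlt, hfold, if_true]

theorem exists_eq_textPos_of_textLetter_eq {p s i : ℕ} (hp : p < 40 * textHalf N m)
    (h : textLetter N m F p = symbol m s i) :
    ∃ q < textHalf N m, p = textPos N m F s q ∧ (q % (m + 1) = 0 ↔ i % (m + 1) = 0) := by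
  simp only [textLetter] at h
  split_ifs at h with hoff
  · obtain ⟨rfl, hmod⟩ := eq_and_mod_eq_zero_iff_of_symbol_eq h
    refine ⟨fold (textHalf N m) (p / 20), ?_, ?_, hmod⟩
    · unfold fold
      split_ifs <;> omega
    · rw [textPos, ← hoff]
      by_cases hlt : p / 20 < textHalf N m
      · simp only [side, fold, if_pos hlt, if_true]
        omega
      · simp only [side, fold, if_neg hlt, one_ne_zero, if_false]
        omega
  · unfold symbol at h
    omega

theorem textPos_zero_lt_textPos_zero (hF : ∀ g i k, F g i k ≤ 1) {q q' : ℕ} :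
    textPos N m F 0 q < textPos N m F 0 q' ↔ q < q' := by
  have h := offset_lt (N := N) (m := m) hF 0 q
  have h' := offset_lt (N := N) (m := m) hF 0 q'
  rcases lt_trichotomy q q' with hq | rfl | hq <;> simp only [textPos, if_true] <;> omega

theorem textPos_one_lt_textPos_one (hF : ∀ g i k, F g i k ≤ 1) {q q' : ℕ}
    (hq : q < textHalf N m) (hq' : q' < textHalf N m) :
    textPos N m F 1 q' < textPos N m F 1 q ↔ q < q' := by
  have h := offset_lt (N := N) (m := m) hF 1 q
  have h' := offset_lt (N := N) (m := m) hF 1 q'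
  rcases lt_trichotomy q q' with hlt | rfl | hlt <;>
    simp only [textPos, one_ne_zero, if_false] <;> omega

theorem textPos_zero_lt_textPos_one (hF : ∀ g i k, F g i k ≤ 1) {q q' : ℕ}
    (hq : q < textHalf N m) (hq' : q' < textHalf N m) :
    textPos N m F 0 q < textPos N m F 1 q' := by
  have h := offset_lt (N := N) (m := m) hF 0 q
  simp only [textPos, one_ne_zero, if_true, if_false]
  omega

theorem textPos_one_lt (hF : ∀ g i k, F g i k ≤ 1) {q : ℕ} (hq : q < textHalf N m) :
    textPos N m F 1 q < 40 * textHalf N m := by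
  have h := offset_lt (N := N) (m := m) hF 1 q
  simp only [textPos, one_ne_zero, if_false]
  omega

theorem pairKind_eq_two_or_three (hF : ∀ g i k, F g i k ≤ 1) (i : ℕ) :
    pairKind m F i = 2 ∨ pairKind m F i = 3 := by
  have := hF 2 (i / (m + 1)) (i % (m + 1) - 1)
  unfold pairKind
  split_ifs <;> omega

theorem pairKind_mul_succ_add_succ {j k : ℕ} (hk : k < m) :
    pairKind m F (j * (m + 1) + (k + 1)) = 2 + F 2 j k := by
  rw [pairKind, mul_succ_add_mod j hk, mul_succ_add_div j hk, if_neg k.succ_ne_zero]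
  rfl

theorem allowed_pairKind_iff (hF : ∀ g i k, F g i k ≤ 1) {i q q' : ℕ} (hq : q < textHalf N m)
    (hq' : q' < textHalf N m) :
    Allowed (pairKind m F i) (textPos N m F 1 q' - textPos N m F 0 q - 1) ↔
      stage N (q' / (m + 1)) = stage N (q / (m + 1)) ∧
        ¬ (bit N m F 0 q = 1 ∧ bit N m F 1 q' = 1 ∧ pairKind m F i = 3) := by
  have hb := bit_le (N := N) (m := m) hF 0 q
  have hb' := bit_le (N := N) (m := m) hF 1 q'
  have hs := stage_le N (q / (m + 1))
  have hs' := stage_le N (q' / (m + 1))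
  have hmod : ∀ s < 3, ∀ s' < 3, ∀ b < 2, ∀ b' < 2,
      ((20 + 4 * s' + (1 - b') - 4 * s - b) % 20 = 19 ∨
        (20 + 4 * s' + (1 - b') - 4 * s - b) % 20 ≤ 1 ↔ s' = s) := by
    decide
  have hdist : textPos N m F 1 q' - textPos N m F 0 q - 1 + 1 =
      20 * (2 * textHalf N m - 2 - q' - q) + (20 + 4 * stage N (q' / (m + 1)) +
        (1 - bit N m F 1 q') - 4 * stage N (q / (m + 1)) - bit N m F 0 q) := by
    rw [textPos_zero, textPos_one]
    omega
  replace hmod := hmod _ (Nat.lt_succ_of_le hs) _ (Nat.lt_succ_of_le hs') _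
    (Nat.lt_succ_of_le hb) _ (Nat.lt_succ_of_le hb')
  rcases pairKind_eq_two_or_three (m := m) hF i with hkind | hkind
  · simp only [Allowed, hkind, OfNat.ofNat_ne_zero, ↓reduceIte, OfNat.ofNat_ne_one, hdist,
      Nat.mul_add_mod_self_left, Nat.reduceEqDiff, and_false, not_false_eq_true, and_true]
    exact hmod
  · simp only [Allowed, hkind, OfNat.ofNat_ne_zero, ↓reduceIte, OfNat.ofNat_ne_one,
      Nat.succ_ne_self, hdist, Nat.mul_add_mod_self_left, and_true, not_and]
    by_cases hst : stage N (q' / (m + 1)) = stage N (q / (m + 1))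
    · rw [hst]
      omega
    · omega

theorem allowed_zero_left_iff (hF : ∀ g i k, F g i k ≤ 1) {q q' : ℕ} (h : q < q') :
    Allowed 0 (textPos N m F 0 q' - textPos N m F 0 q - 1) ↔
      q' = q + 1 ∧ stage N (q' / (m + 1)) = stage N (q / (m + 1)) := by
  have := bit_le (N := N) (m := m) hF 0 q
  have := bit_le (N := N) (m := m) hF 0 q'
  have := stage_le N (q / (m + 1))
  have := stage_le N (q' / (m + 1))
  rw [textPos_zero, textPos_zero]
  simp only [Allowed, if_true]
  omega

theorem allowed_zero_right_iff (hF : ∀ g i k, F g i k ≤ 1) {q q' : ℕ} (h : q < q')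
    (hq' : q' < textHalf N m) :
    Allowed 0 (textPos N m F 1 q - textPos N m F 1 q' - 1) ↔
      q' = q + 1 ∧ stage N (q' / (m + 1)) = stage N (q / (m + 1)) := by
  have := bit_le (N := N) (m := m) hF 1 q
  have := bit_le (N := N) (m := m) hF 1 q'
  have := stage_le N (q / (m + 1))
  have := stage_le N (q' / (m + 1))
  rw [textPos_one, textPos_one]
  simp only [Allowed, if_true]
  omega

theorem allowed_one_left_iff (hF : ∀ g i k, F g i k ≤ 1) {q q' : ℕ} (h : q < q') :
    Allowed 1 (textPos N m F 0 q' - textPos N m F 0 q - 1) ↔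
      stage N (q / (m + 1)) ≤ stage N (q' / (m + 1)) ∧
        stage N (q' / (m + 1)) ≤ stage N (q / (m + 1)) + 1 := by
  have := bit_le (N := N) (m := m) hF 0 q
  have := bit_le (N := N) (m := m) hF 0 q'
  have := stage_le N (q / (m + 1))
  have := stage_le N (q' / (m + 1))
  rw [textPos_zero, textPos_zero]
  simp only [Allowed, one_ne_zero, if_false, if_true]
  omega

theorem IsEmbedding.exists_isPlacement (hF : ∀ g i k, F g i k ≤ 1) {e : ℕ → ℕ}
    (he : IsEmbedding N m F e) : ∃ L R, IsPlacement N m F L R := by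
  have hleft : ∀ i < patHalf N m, ∃ q < textHalf N m, e i = textPos N m F 0 q ∧
      (q % (m + 1) = 0 ↔ i % (m + 1) = 0) := fun i hi =>
    exists_eq_textPos_of_textLetter_eq (he.lt i (by omega))
      ((he.letter i (by omega)).trans (patLetter_left hi))
  have hright : ∀ i < patHalf N m, ∃ q < textHalf N m,
      e (2 * patHalf N m - 1 - i) = textPos N m F 1 q ∧
        (q % (m + 1) = 0 ↔ i % (m + 1) = 0) := fun i hi =>
    exists_eq_textPos_of_textLetter_eq (he.lt _ (by omega))
      ((he.letter _ (by omega)).trans (patLetter_right hi))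
  choose! L hL heL hLmod using hleft
  choose! R hR heR hRmod using hright
  refine ⟨L, R, hL, hR, fun i j hij hj => ?_, fun i j hij hj => ?_, hLmod, hRmod,
    fun i hi => ?_, fun i hi => ?_, fun i hi => ?_⟩
  · rw [← textPos_zero_lt_textPos_zero hF, ← heL i (by omega), ← heL j hj]
    exact he.strictMono i j hij (by omega)
  · rw [← textPos_one_lt_textPos_one hF (hR i (by omega)) (hR j hj), ← heR i (by omega), ← heR j hj]
    exact he.strictMono _ _ (by omega) (by omega)
  · rw [← heL i hi, ← heR i hi]
    exact he.allowed _ (mem_data.2 (.inl ⟨i, hi, rfl⟩))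
  · rw [← heL i (by omega), ← heL (i + 1) hi]
    exact he.allowed _ (mem_data.2 (.inr (.inl ⟨i, by omega, rfl⟩)))
  · rw [← heR i (by omega), ← heR (i + 1) hi,
      show 2 * patHalf N m - 1 - (i + 1) = 2 * patHalf N m - 2 - i by omega]
    exact he.allowed _ (mem_data.2 (.inr (.inr ⟨i, by omega, rfl⟩)))

theorem exists_mirror_eq {D i : ℕ} (hi : i < 2 * D) (h : ¬ i < D) : ∃ j < D, i = 2 * D - 1 - j :=
  ⟨2 * D - 1 - i, by omega, by omega⟩

theorem IsPlacement.exists_isEmbedding (hF : ∀ g i k, F g i k ≤ 1) {L R : ℕ → ℕ}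
    (h : IsPlacement N m F L R) : ∃ e, IsEmbedding N m F e := by
  obtain ⟨e, hleft, hright⟩ : ∃ e : ℕ → ℕ, (∀ i < patHalf N m, e i = textPos N m F 0 (L i)) ∧
      ∀ i < patHalf N m, e (2 * patHalf N m - 1 - i) = textPos N m F 1 (R i) := by
    refine ⟨fun i => if i < patHalf N m then textPos N m F 0 (L i) else
      textPos N m F 1 (R (2 * patHalf N m - 1 - i)), fun i hi => if_pos hi, fun i hi => ?_⟩
    have hmirror : 2 * patHalf N m - 1 - (2 * patHalf N m - 1 - i) = i := by omega
    simp only [if_neg (show ¬ 2 * patHalf N m - 1 - i < patHalf N m by omega), hmirror]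
  have hmono : ∀ i j, i < j → j < 2 * patHalf N m → e i < e j := by
    intro i j hij hj
    by_cases hi' : i < patHalf N m <;> by_cases hj' : j < patHalf N m
    · rw [hleft i hi', hleft j hj', textPos_zero_lt_textPos_zero hF]
      exact h.left_strictMono i j hij hj'
    · obtain ⟨j, hjD, rfl⟩ := exists_mirror_eq hj hj'
      rw [hleft i hi', hright j hjD]
      exact textPos_zero_lt_textPos_one hF (h.left_lt i hi') (h.right_lt j hjD)
    · omega
    · obtain ⟨j, hjD, rfl⟩ := exists_mirror_eq hj hj'
      obtain ⟨i, hiD, rfl⟩ := exists_mirror_eq (by omega) hi'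
      rw [hright i hiD, hright j hjD,
        textPos_one_lt_textPos_one hF (h.right_lt j hjD) (h.right_lt i hiD)]
      exact h.right_strictMono j i (by omega) hiD
  refine ⟨e, hmono, fun i hi => ?_, fun i hi => ?_, fun d hd => ?_⟩
  · have hlast := (hright 0 (by omega)).trans_lt (textPos_one_lt hF (h.right_lt 0 (by omega)))
    rcases Nat.lt_or_ge i (2 * patHalf N m - 1) with hi' | hi'
    · exact (hmono i _ hi' (by omega)).trans hlast
    · rwa [show i = 2 * patHalf N m - 1 - 0 by omega]
  · by_cases hi' : i < patHalf N m
    · rw [hleft i hi', textLetter_textPos_zero hF (h.left_lt i hi'), patLetter_left hi',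
        symbol_congr 0 (h.left_mod i hi')]
    · obtain ⟨i, hiD, rfl⟩ := exists_mirror_eq hi hi'
      rw [hright i hiD, textLetter_textPos_one hF (h.right_lt i hiD), patLetter_right hiD,
        symbol_congr 1 (h.right_mod i hiD)]
  · rcases mem_data.1 hd with ⟨i, hi, rfl⟩ | ⟨i, hi, rfl⟩ | ⟨i, hi, rfl⟩
    · simpa only [hleft i hi, hright i hi] using h.pair i hi
    · simpa only [hleft i (by omega), hleft (i + 1) (by omega)] using h.left i (by omega)
    · have hsucc := hright (i + 1) (by omega)
      rw [show 2 * patHalf N m - 1 - (i + 1) = 2 * patHalf N m - 2 - i by omega] at hsucc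
      simpa only [hsucc, hright i (by omega)] using h.right i (by omega)

theorem cellOf_div (A : ℕ → ℕ) (i : ℕ) : cellOf m A i / (m + 1) = A (i / (m + 1)) :=
  mul_succ_add_div _ (Nat.le_of_lt_succ (Nat.mod_lt i m.succ_pos))

theorem cellOf_mod (A : ℕ → ℕ) (i : ℕ) : cellOf m A i % (m + 1) = i % (m + 1) :=
  mul_succ_add_mod _ (Nat.le_of_lt_succ (Nat.mod_lt i m.succ_pos))

theorem div_lt_of_lt_patHalf {i : ℕ} (hi : i < patHalf N m) : i / (m + 1) < N :=
  Nat.div_lt_of_lt_mul (by rwa [patHalf, mul_comm] at hi)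

theorem cellOf_lt {A : ℕ → ℕ} (hA : ∀ j < N, A j < 3 * N - 2) {i : ℕ} (hi : i < patHalf N m) :
    cellOf m A i < textHalf N m :=
  mul_succ_add_lt (hA _ (div_lt_of_lt_patHalf hi)) (Nat.le_of_lt_succ (Nat.mod_lt i m.succ_pos))

theorem cellOf_lt_cellOf {A : ℕ → ℕ} (hA : ∀ i j, i < j → j < N → A i < A j) {i j : ℕ}
    (hij : i < j) (hj : j < patHalf N m) : cellOf m A i < cellOf m A j := by
  rcases (Nat.div_le_div_right (c := m + 1) hij.le).eq_or_lt with hdiv | hdiv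
  · have hi := Nat.div_add_mod i (m + 1)
    have hj := Nat.div_add_mod j (m + 1)
    rw [hdiv] at hi
    rw [cellOf, cellOf, hdiv]
    omega
  · exact (mul_succ_add_lt (hA _ _ hdiv (div_lt_of_lt_patHalf hj))
      (Nat.le_of_lt_succ (Nat.mod_lt i m.succ_pos))).trans_le (Nat.le_add_right _ _)

theorem succ_div_eq_of_mod_ne {i : ℕ} (h : i % (m + 1) ≠ m) : (i + 1) / (m + 1) = i / (m + 1) := by
  have hlt := Nat.mod_lt i (Nat.add_one_pos m)
  have hi : i + 1 = i / (m + 1) * (m + 1) + (i % (m + 1) + 1) := by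
    rw [← add_assoc, Nat.div_add_mod']
  rw [hi, mul_succ_add_div _ (by omega)]

theorem cellOf_succ {A : ℕ → ℕ} {i : ℕ} (h : i % (m + 1) ≠ m) :
    cellOf m A (i + 1) = cellOf m A i + 1 := by
  have hdiv := succ_div_eq_of_mod_ne h
  have hi := Nat.div_add_mod i (m + 1)
  have hsucc := Nat.div_add_mod (i + 1) (m + 1)
  rw [hdiv] at hsucc
  rw [cellOf, cellOf, hdiv]
  omega

theorem eq_div_mul_succ_add {n : ℕ} {X : ℕ → ℕ}
    (hsucc : ∀ i, i + 1 < n * (m + 1) → i % (m + 1) ≠ m → X (i + 1) = X i + 1)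
    (hmod : ∀ j < n, X (j * (m + 1)) % (m + 1) = 0) {j k : ℕ} (hj : j < n) (hk : k ≤ m) :
    X (j * (m + 1) + k) = X (j * (m + 1)) / (m + 1) * (m + 1) + k := by
  induction k with
  | zero => rw [add_zero, add_zero, Nat.div_mul_cancel (Nat.dvd_of_mod_eq_zero (hmod j hj))]
  | succ k ih =>
    have hne : (j * (m + 1) + k) % (m + 1) ≠ m := by
      rw [mul_succ_add_mod j (by omega)]
      omega
    rw [← add_assoc, hsucc (j * (m + 1) + k) (mul_succ_add_lt hj hk) hne, ih (by omega), add_assoc]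

theorem IsPlacement.left_succ (hF : ∀ g i k, F g i k ≤ 1) {L R : ℕ → ℕ}
    (h : IsPlacement N m F L R) {i : ℕ} (hi : i + 1 < patHalf N m) (hmod : i % (m + 1) ≠ m) :
    L (i + 1) = L i + 1 := by
  have hleft := h.left i hi
  rw [leftKind, if_neg hmod,
    allowed_zero_left_iff hF (h.left_strictMono i _ (lt_add_one i) hi)] at hleft
  exact hleft.1

theorem IsPlacement.right_succ (hF : ∀ g i k, F g i k ≤ 1) {L R : ℕ → ℕ}
    (h : IsPlacement N m F L R) {i : ℕ} (hi : i + 1 < patHalf N m) (hmod : i % (m + 1) ≠ m) :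
    R (i + 1) = R i + 1 := by
  have hright := h.right i hi
  rw [rightKind, if_neg hmod, allowed_zero_right_iff hF (h.right_strictMono i _ (lt_add_one i) hi)
    (h.right_lt _ hi)] at hright
  exact hright.1

theorem IsPlacement.exists_blocks (hF : ∀ g i k, F g i k ≤ 1) {L R : ℕ → ℕ}
    (h : IsPlacement N m F L R) : ∃ A B : ℕ → ℕ,
      (∀ j < N, ∀ k ≤ m, L (j * (m + 1) + k) = A j * (m + 1) + k) ∧
      ∀ j < N, ∀ k ≤ m, R (j * (m + 1) + k) = B j * (m + 1) + k := by
  have hlt : ∀ j < N, j * (m + 1) < patHalf N m := fun j hj =>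
    Nat.mul_lt_mul_of_pos_right hj m.succ_pos
  exact ⟨fun j => L (j * (m + 1)) / (m + 1), fun j => R (j * (m + 1)) / (m + 1),
    fun j hj k hk => eq_div_mul_succ_add (n := N) (fun i hi => h.left_succ hF hi)
      (fun j hj => (h.left_mod _ (hlt j hj)).2 (Nat.mul_mod_left j (m + 1))) hj hk,
    fun j hj k hk => eq_div_mul_succ_add (n := N) (fun i hi => h.right_succ hF hi)
      (fun j hj => (h.right_mod _ (hlt j hj)).2 (Nat.mul_mod_left j (m + 1))) hj hk⟩

theorem IsPlacement.exists_isBlockPlacement (hF : ∀ g i k, F g i k ≤ 1) {L R : ℕ → ℕ}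
    (h : IsPlacement N m F L R) : ∃ A B, IsBlockPlacement N m F A B := by
  obtain ⟨A, B, hA, hB⟩ := h.exists_blocks hF
  have hA0 : ∀ j < N, L (j * (m + 1)) = A j * (m + 1) := fun j hj => hA j hj 0 m.zero_le
  have hB0 : ∀ j < N, R (j * (m + 1)) = B j * (m + 1) := fun j hj => hB j hj 0 m.zero_le
  have hlt : ∀ j < N, j * (m + 1) < patHalf N m := fun j hj => mul_succ_add_lt hj m.zero_le
  have hpair : ∀ i < patHalf N m, _ := fun i hi =>
    (allowed_pairKind_iff hF (h.left_lt i hi) (h.right_lt i hi)).1 (h.pair i hi)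
  have hstage : ∀ j < N, stage N (B j) = stage N (A j) := fun j hj => by
    simpa only [hA0 j hj, hB0 j hj, Nat.mul_div_left _ m.succ_pos] using (hpair _ (hlt j hj)).1
  refine ⟨A, B, fun j hj => ?_, fun j hj => ?_, fun i j hij hj => ?_, fun i j hij hj => ?_,
    fun j hj => ?_, hstage, fun j hj hst k hk => ?_⟩
  · exact lt_of_mul_lt_mul_right ((hA0 j hj).symm.trans_lt (h.left_lt _ (hlt j hj))) (Nat.zero_le _)
  · exact lt_of_mul_lt_mul_right ((hB0 j hj).symm.trans_lt (h.right_lt _ (hlt j hj)))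
      (Nat.zero_le _)
  · have hL := h.left_strictMono _ _ (Nat.mul_lt_mul_of_pos_right hij m.succ_pos) (hlt j hj)
    rw [hA0 i (hij.trans hj), hA0 j hj] at hL
    exact lt_of_mul_lt_mul_right hL (Nat.zero_le _)
  · have hR := h.right_strictMono _ _ (Nat.mul_lt_mul_of_pos_right hij m.succ_pos) (hlt j hj)
    rw [hB0 i (hij.trans hj), hB0 j hj] at hR
    exact lt_of_mul_lt_mul_right hR (Nat.zero_le _)
  · have hsucc : j * (m + 1) + m + 1 = (j + 1) * (m + 1) := by ring
    have hi : j * (m + 1) + m + 1 < patHalf N m := hsucc ▸ hlt (j + 1) hj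
    have hleft := h.left _ hi
    rw [leftKind, mul_succ_add_mod j le_rfl, if_pos rfl,
      allowed_one_left_iff hF (h.left_strictMono _ _ (lt_add_one _) hi), hsucc,
      hA0 (j + 1) hj, hA j (by omega) m le_rfl, Nat.mul_div_left _ m.succ_pos,
      mul_succ_add_div _ le_rfl] at hleft
    exact hleft.2
  · have hbits := (hpair _ (mul_succ_add_lt hj hk)).2
    rw [hA j hj _ hk, hB j hj _ hk, bit_mul_succ_add_succ hk 0 hst,
      bit_mul_succ_add_succ hk 1 ((hstage j hj).trans hst), pairKind_mul_succ_add_succ hk] at hbits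
    exact fun hand => hbits ⟨hand.1, hand.2.1, by rw [hand.2.2]⟩

theorem bit_cellOf (s : ℕ) (A : ℕ → ℕ) (i : ℕ) : bit N m F s (cellOf m A i) =
    if stage N (A (i / (m + 1))) = 1 ∧ i % (m + 1) ≠ 0 then
      F s (A (i / (m + 1)) - (N - 1)) (i % (m + 1) - 1) else 0 := by
  rw [bit, cellOf_div, cellOf_mod]

theorem IsBlockPlacement.stage_le_stage_succ {A B : ℕ → ℕ} (h : IsBlockPlacement N m F A B) {j : ℕ}
    (hj : j + 1 < N) : stage N (A j) ≤ stage N (A (j + 1)) := by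
  have := h.left_strictMono j (j + 1) (lt_add_one j) hj
  unfold stage
  split_ifs <;> omega

theorem succ_div_eq_succ_of_mod_eq {i : ℕ} (h : i % (m + 1) = m) :
    (i + 1) / (m + 1) = i / (m + 1) + 1 := by
  have hi : i + 1 = (i / (m + 1) + 1) * (m + 1) := by
    have := Nat.div_add_mod' i (m + 1)
    rw [add_mul]
    omega
  rw [hi, Nat.mul_div_left _ m.succ_pos]

theorem IsBlockPlacement.isPlacement (hF : ∀ g i k, F g i k ≤ 1) {A B : ℕ → ℕ}
    (h : IsBlockPlacement N m F A B) : IsPlacement N m F (cellOf m A) (cellOf m B) := by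
  have hlt : ∀ i < patHalf N m, cellOf m A i < textHalf N m := fun i => cellOf_lt h.left_lt
  have hlt' : ∀ i < patHalf N m, cellOf m B i < textHalf N m := fun i => cellOf_lt h.right_lt
  have hmono : ∀ i, i + 1 < patHalf N m → cellOf m A i < cellOf m A (i + 1) := fun i hi =>
    cellOf_lt_cellOf h.left_strictMono (lt_add_one i) hi
  have hmono' : ∀ i, i + 1 < patHalf N m → cellOf m B i < cellOf m B (i + 1) := fun i hi =>
    cellOf_lt_cellOf h.right_strictMono (lt_add_one i) hi
  refine ⟨hlt, hlt', fun i j => cellOf_lt_cellOf h.left_strictMono,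
    fun i j => cellOf_lt_cellOf h.right_strictMono, fun i _ => by rw [cellOf_mod],
    fun i _ => by rw [cellOf_mod], fun i hi => ?_, fun i hi => ?_, fun i hi => ?_⟩
  · have hj := div_lt_of_lt_patHalf hi
    rw [allowed_pairKind_iff hF (hlt i hi) (hlt' i hi), cellOf_div, cellOf_div, bit_cellOf,
      bit_cellOf, h.stage_right _ hj]
    refine ⟨rfl, ?_⟩
    split_ifs with hbit
    · have hmod := Nat.mod_lt i (Nat.add_one_pos m)
      rw [pairKind, if_neg hbit.2]
      rintro ⟨h₀, h₁, h₂⟩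
      exact h.not_and _ hj hbit.1 (i % (m + 1) - 1) (by omega) ⟨h₀, h₁, by omega⟩
    · simp
  · unfold leftKind
    split_ifs with hmod
    · rw [allowed_one_left_iff hF (hmono i hi), cellOf_div, cellOf_div,
        succ_div_eq_succ_of_mod_eq hmod]
      have hj := div_lt_of_lt_patHalf hi
      rw [succ_div_eq_succ_of_mod_eq hmod] at hj
      exact ⟨h.stage_le_stage_succ hj, h.stage_succ_le _ hj⟩
    · rw [allowed_zero_left_iff hF (hmono i hi), cellOf_div, cellOf_div,
        succ_div_eq_of_mod_ne hmod]
      exact ⟨cellOf_succ hmod, rfl⟩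
  · unfold rightKind
    split_ifs with hmod
    · simp [Allowed]
    · rw [allowed_zero_right_iff hF (hmono' i hi) (hlt' _ hi), cellOf_div, cellOf_div,
        succ_div_eq_of_mod_ne hmod]
      exact ⟨cellOf_succ hmod, rfl⟩

/-- The blocks of stage `0` and `2` are so few that a strictly increasing sequence cannot avoid
stage `1` unless it skips it. -/
theorem IsBlockPlacement.exists_stage_eq_one (hN : 0 < N) {A B : ℕ → ℕ}
    (h : IsBlockPlacement N m F A B) : ∃ j < N, stage N (A j) = 1 := by
  have hgrowth : ∀ j < N, A 0 + j ≤ A j := by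
    intro j
    induction j with
    | zero => exact fun _ => le_rfl
    | succ j ih => exact fun hj =>
        (ih (by omega)).trans_lt (h.left_strictMono j (j + 1) (lt_add_one j) hj)
  have hlast_ge := hgrowth (N - 1) (by omega)
  have hlast_lt := h.left_lt (N - 1) (by omega)
  have hfirst : stage N (A 0) ≤ 1 := by
    unfold stage
    split_ifs <;> omega
  have hlast : 1 ≤ stage N (A (N - 1)) := by
    unfold stage
    split_ifs <;> omega
  have hex : ∃ j, 1 ≤ stage N (A j) := ⟨_, hlast⟩
  have hle : Nat.find hex ≤ N - 1 := Nat.find_min' hex hlast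
  refine ⟨Nat.find hex, by omega, le_antisymm ?_ (Nat.find_spec hex)⟩
  rcases hj : Nat.find hex with _ | j
  · exact hfirst
  · have hmin := Nat.find_min hex (show j < Nat.find hex by omega)
    have := h.stage_succ_le j (by omega)
    omega

theorem stage_blockOf {c x : ℕ} (hc : c < N) (hx : x < N) (j : ℕ) :
    stage N (blockOf N c x j) = if j < c then 0 else if j = c then 1 else 2 := by
  unfold stage blockOf
  split_ifs <;> omega

theorem blockOf_lt {c x j : ℕ} (hx : x < N) (hj : j < N) : blockOf N c x j < 3 * N - 2 := by
  unfold blockOf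
  split_ifs <;> omega

theorem blockOf_lt_blockOf {c x i j : ℕ} (hc : c < N) (hx : x < N) (h : i < j) :
    blockOf N c x i < blockOf N c x j := by
  unfold blockOf
  split_ifs <;> omega

theorem isBlockPlacement_blockOf {a b c : ℕ} (ha : a < N) (hb : b < N) (hc : c < N)
    (h : ∀ k < m, ¬ (F 0 a k = 1 ∧ F 1 b k = 1 ∧ F 2 c k = 1)) :
    IsBlockPlacement N m F (blockOf N c a) (blockOf N c b) := by
  refine ⟨fun j => blockOf_lt ha, fun j => blockOf_lt hb, fun i j hij _ =>
    blockOf_lt_blockOf hc ha hij, fun i j hij _ => blockOf_lt_blockOf hc hb hij, fun j _ => ?_,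
    fun j _ => ?_, fun j _ hst => ?_⟩
  · rw [stage_blockOf hc ha, stage_blockOf hc ha]
    split_ifs <;> omega
  · rw [stage_blockOf hc ha, stage_blockOf hc hb]
  · obtain rfl : j = c := by
      rw [stage_blockOf hc ha] at hst
      split_ifs at hst with _ hj
      · exact hj
      · contradiction
    simpa only [blockOf, lt_irrefl, if_false, if_true, Nat.add_sub_cancel_left] using h

theorem exists_isEmbedding_iff (hN : 0 < N) (hF : ∀ g i k, F g i k ≤ 1) :
    (∃ e, IsEmbedding N m F e) ↔
      ∃ a < N, ∃ b < N, ∃ c < N, ∀ k < m, ¬ (F 0 a k = 1 ∧ F 1 b k = 1 ∧ F 2 c k = 1) := by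
  constructor
  · rintro ⟨e, he⟩
    obtain ⟨L, R, hLR⟩ := he.exists_isPlacement hF
    obtain ⟨A, B, hAB⟩ := hLR.exists_isBlockPlacement hF
    obtain ⟨j, hj, hst⟩ := hAB.exists_stage_eq_one hN
    exact ⟨A j - (N - 1), sub_lt_of_stage_eq_one hst, B j - (N - 1),
      sub_lt_of_stage_eq_one ((hAB.stage_right j hj).trans hst), j, hj, hAB.not_and j hj hst⟩
  · rintro ⟨a, ha, b, hb, c, hc, h⟩
    exact ((isBlockPlacement_blockOf ha hb hc h).isPlacement hF).exists_isEmbedding hF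

end TripleMatch

/-! ### Representations of sets of lengths -/

namespace PartialDFA

/-- An automaton that counts the letters modulo `n + 1` and accepts the counts in `p`. -/
def cyclic (σ n : ℕ) (p : ℕ → Bool) : PartialDFA σ where
  numStates := n + 1
  start := 0
  step q _ := some (q + 1)
  accept q := p q

/-- An automaton that reads at most `n` letters, counts them, and accepts the counts in `p`. -/
def bounded (σ n : ℕ) (p : ℕ → Bool) : PartialDFA σ where
  numStates := n + 1
  start := 0
  step q _ := if h : (q : ℕ) + 1 < n + 1 then some ⟨q + 1, h⟩ else none
  accept q := p q

theorem size_le {σ : ℕ} (A : PartialDFA σ) : A.size ≤ A.numStates * (σ + 1) := by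
  rw [size, transitions, List.length_flatMap, mul_add_one, add_comm]
  refine Nat.add_le_add_right ((List.sum_le_card_nsmul _ σ fun x hx => ?_).trans (by simp)) _
  obtain ⟨q, -, rfl⟩ := List.mem_map.1 hx
  exact (List.length_filterMap_le _ _).trans (by simp)

theorem mem_language_iff {σ : ℕ} (A : PartialDFA σ) (v : List (Fin σ)) :
    v ∈ A.language ↔ ∃ s, A.toDFA.eval v = some s ∧ A.accept s = true := Iff.rfl

theorem eval_cyclic (σ n : ℕ) (p : ℕ → Bool) (v : List (Fin σ)) :
    (cyclic σ n p).toDFA.eval v = some (Fin.ofNat (n + 1) v.length) := by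
  induction v using List.reverseRecOn with
  | nil => rfl
  | append_singleton v a ih =>
    rw [DFA.eval_append_singleton, ih]
    simp only [toDFA, cyclic, Option.bind_some, List.length_append, List.length_singleton]
    congr 1
    ext
    simp [Fin.val_add]

theorem language_cyclic (σ n : ℕ) (p : ℕ → Bool) :
    (cyclic σ n p).language = {v | p (v.length % (n + 1)) = true} := by
  ext v
  rw [mem_language_iff, eval_cyclic]
  simp [cyclic]

theorem eval_bounded (σ n : ℕ) (p : ℕ → Bool) (v : List (Fin σ)) :
    (bounded σ n p).toDFA.eval v =
      if h : v.length < n + 1 then some (⟨v.length, h⟩ : Fin (n + 1)) else none := by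
  induction v using List.reverseRecOn with
  | nil => rfl
  | append_singleton v a ih =>
    rw [DFA.eval_append_singleton, ih]
    simp only [toDFA, bounded, List.length_append, List.length_singleton]
    by_cases h : v.length < n + 1
    · rw [dif_pos h]
      rfl
    · rw [dif_neg h, dif_neg (by omega)]
      rfl

theorem language_bounded (σ n : ℕ) (p : ℕ → Bool) :
    (bounded σ n p).language = {v | v.length ≤ n ∧ p v.length = true} := by
  ext v
  rw [mem_language_iff, eval_bounded]
  by_cases h : v.length < n + 1
  · simp [h, bounded, Nat.lt_succ_iff.1 h]
  · simp [h, show ¬ v.length ≤ n by omega]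

end PartialDFA

namespace SemilinearRep

/-- The numbers with residue modulo `n + 1` in `p`. -/
def cyclic (n : ℕ) (p : ℕ → Bool) : SemilinearRep :=
  ((List.range (n + 1)).filter p).map fun r => ⟨r, [n + 1], by simp⟩

/-- The numbers up to `n` in `p`. -/
def bounded (n : ℕ) (p : ℕ → Bool) : SemilinearRep :=
  ((List.range (n + 1)).filter p).map fun r => ⟨r, [], by simp⟩

theorem toSet_cyclic (n : ℕ) (p : ℕ → Bool) :
    (cyclic n p).toSet = {x | p (x % (n + 1)) = true} := by
  ext x
  simp only [toSet, cyclic, LinearRep.toSet, List.mem_map, List.mem_filter, List.mem_range,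
    Set.mem_ofPred_eq]
  constructor
  · rintro ⟨_, ⟨r, ⟨hr, hp⟩, rfl⟩, k, rfl⟩
    have hmod : (r + ∑ i, k i * [n + 1].get i) % (n + 1) = r := by simp [Nat.mod_eq_of_lt hr]
    rwa [hmod]
  · intro hp
    refine ⟨_, ⟨x % (n + 1), ⟨Nat.mod_lt _ n.succ_pos, hp⟩, rfl⟩, fun _ => x / (n + 1), ?_⟩
    simpa using (Nat.mod_add_div' x (n + 1)).symm

theorem toSet_bounded (n : ℕ) (p : ℕ → Bool) :
    (bounded n p).toSet = {x | x ≤ n ∧ p x = true} := by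
  ext x
  simp [toSet, bounded, LinearRep.toSet]

theorem size_map_le {s n : ℕ} {f : ℕ → LinearRep} (p : ℕ → Bool) (hf : ∀ r, (f r).size ≤ s) :
    SemilinearRep.size (((List.range n).filter p).map f) ≤ n * s := by
  rw [size, List.map_map]
  refine (List.sum_le_card_nsmul _ s fun x hx => ?_).trans (Nat.mul_le_mul_right _ ?_)
  · obtain ⟨r, -, rfl⟩ := List.mem_map.1 hx
    exact hf r
  · simpa using List.length_filter_le p (List.range n)

theorem size_cyclic_le (n : ℕ) (p : ℕ → Bool) : (cyclic n p).size ≤ (n + 1) * 2 :=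
  size_map_le p fun _ => le_rfl

theorem size_bounded_le (n : ℕ) (p : ℕ → Bool) : (bounded n p).size ≤ (n + 1) * 1 :=
  size_map_le p fun _ => le_rfl

end SemilinearRep

namespace ConstraintKind

theorem exists_rep_cyclic (𝓛 : ConstraintKind) {σ : ℕ} (hσ : 0 < σ) (n : ℕ) (p : ℕ → Bool) :
    ∃ r : 𝓛.Rep σ, 𝓛.language r = {v | p (v.length % (n + 1)) = true} ∧
      𝓛.size r ≤ (n + 1) * (σ + 1) := by
  cases 𝓛 with
  | reg => exact ⟨PartialDFA.cyclic σ n p, PartialDFA.language_cyclic σ n p, PartialDFA.size_le _⟩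
  | semi =>
    refine ⟨SemilinearRep.cyclic n p, ?_,
      (SemilinearRep.size_cyclic_le n p).trans (Nat.mul_le_mul_left _ (Nat.succ_le_succ hσ))⟩
    simp only [language, SemilinearRep.toSet_cyclic, Set.mem_ofPred_eq]

theorem exists_rep_bounded (𝓛 : ConstraintKind) (σ n : ℕ) (p : ℕ → Bool) :
    ∃ r : 𝓛.Rep σ, 𝓛.language r = {v | v.length ≤ n ∧ p v.length = true} ∧
      𝓛.size r ≤ (n + 1) * (σ + 1) := by
  cases 𝓛 with
  | reg => exact ⟨PartialDFA.bounded σ n p, PartialDFA.language_bounded σ n p, PartialDFA.size_le _⟩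
  | semi =>
    refine ⟨SemilinearRep.bounded n p, ?_, (SemilinearRep.size_bounded_le n p).trans
      (Nat.mul_le_mul_left _ (Nat.succ_le_succ σ.zero_le))⟩
    simp only [language, SemilinearRep.toSet_bounded, Set.mem_ofPred_eq]

end ConstraintKind

theorem length_gap {α : Type} (v : List α) {M : ℕ} (e : Fin M → Fin v.length) (i j : Fin M) :
    (gap v e i j).length = (e j : ℕ) - e i - 1 := by
  have := (e j).2
  simp only [gap, List.length_take, List.length_drop]
  omega

/-! ### The instance of the matching problem -/

namespace TripleMatch

theorem exists_rep (𝓛 : ConstraintKind) (τ : ℕ) :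
    ∃ r : 𝓛.Rep 5, 𝓛.language r = {v | Allowed τ v.length} ∧ 𝓛.size r ≤ 126 := by
  by_cases h0 : τ = 0
  · obtain ⟨r, hr, hs⟩ := 𝓛.exists_rep_bounded 5 20 fun x => decide (18 ≤ x)
    refine ⟨r, ?_, hs⟩
    rw [hr]
    ext v
    simp [Allowed, h0, and_comm]
  · obtain ⟨r, hr, hs⟩ := 𝓛.exists_rep_cyclic (σ := 5) (by norm_num) 19 fun x =>
      if τ = 1 then decide ((x + 1) % 20 = 19 ∨ (x + 1) % 20 ≤ 5)
      else if τ = 2 then decide ((x + 1) % 20 = 19 ∨ (x + 1) % 20 ≤ 1)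
      else if τ = 3 then decide ((x + 1) % 20 ≤ 1)
      else true
    refine ⟨r, ?_, hs.trans (by norm_num)⟩
    rw [hr]
    ext v
    simp only [Allowed, h0, if_false, Set.mem_ofPred_eq, Nat.reduceAdd]
    split_ifs <;> simp

/-- A representation, of size independent of all parameters, of the gap lengths that are allowed by
the constraints of kind `τ`. -/
noncomputable def rep (𝓛 : ConstraintKind) (τ : ℕ) : 𝓛.Rep 5 := (exists_rep 𝓛 τ).choose

theorem language_rep (𝓛 : ConstraintKind) (τ : ℕ) :
    𝓛.language (rep 𝓛 τ) = {v | Allowed τ v.length} := (exists_rep 𝓛 τ).choose_spec.1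

theorem size_rep_le (𝓛 : ConstraintKind) (τ : ℕ) : 𝓛.size (rep 𝓛 τ) ≤ 126 :=
  (exists_rep 𝓛 τ).choose_spec.2

/-- The constraint of kind `d.2.2` between the positions `d.1` and `d.2.1`. -/
noncomputable def constraint (𝓛 : ConstraintKind) (M : ℕ) (d : ℕ × ℕ × ℕ)
    (h : d.1 < d.2.1 ∧ d.2.1 < M) : GapConstraint 𝓛 5 M where
  left := ⟨d.1, h.1.trans h.2⟩
  right := ⟨d.2.1, h.2⟩
  lt := h.1
  rep := rep 𝓛 d.2.2

section

variable {𝓛 : ConstraintKind} {M : ℕ} {d d' : ℕ × ℕ × ℕ} (h : d.1 < d.2.1 ∧ d.2.1 < M)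
  (h' : d'.1 < d'.2.1 ∧ d'.2.1 < M)

theorem mem_language_constraint (v : List (Fin 5)) :
    v ∈ (constraint 𝓛 M d h).language ↔ Allowed d.2.2 v.length := by
  change v ∈ 𝓛.language (rep 𝓛 d.2.2) ↔ _
  rw [language_rep, Set.mem_ofPred_eq]

theorem mem_interval_constraint (x : Fin M) :
    x ∈ (constraint 𝓛 M d h).interval ↔ d.1 ≤ x ∧ x < d.2.1 := by
  simp [GapConstraint.interval, constraint, Fin.le_def, Fin.lt_def]

theorem interval_constraint_inter
    (hnest : (d'.1 ≤ d.1 ∧ d.2.1 ≤ d'.2.1) ∨ (d.1 ≤ d'.1 ∧ d'.2.1 ≤ d.2.1) ∨ d.2.1 ≤ d'.1 ∨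
      d'.2.1 ≤ d.1) :
    (constraint 𝓛 M d h).interval ∩ (constraint 𝓛 M d' h').interval =
        (constraint 𝓛 M d h).interval ∨
      (constraint 𝓛 M d h).interval ∩ (constraint 𝓛 M d' h').interval =
        (constraint 𝓛 M d' h').interval ∨
      (constraint 𝓛 M d h).interval ∩ (constraint 𝓛 M d' h').interval = ∅ := by
  simp only [Finset.ext_iff, Finset.mem_inter, mem_interval_constraint, Finset.notMem_empty,
    iff_false]
  rcases hnest with hnest | hnest | hnest
  · exact .inl fun x => by omega
  · exact .inr (.inl fun x => by omega)
  · exact .inr (.inr fun x => by omega)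

end

/-- The text, which encodes the first two families of vectors. -/
def text (N m : ℕ) (F : ℕ → ℕ → ℕ → ℕ) : List (Fin 5) :=
  (List.range (40 * textHalf N m)).map fun p => Fin.ofNat 5 (textLetter N m F p)

/-- The pattern, which only depends on the dimensions of the families. -/
def pattern (N m : ℕ) : List (Fin 5) :=
  (List.range (2 * patHalf N m)).map fun i => Fin.ofNat 5 (patLetter N m i)

section

variable (N m : ℕ) (F : ℕ → ℕ → ℕ → ℕ)

theorem length_text : (text N m F).length = 40 * textHalf N m := by simp [text]

theorem length_pattern : (pattern N m).length = 2 * patHalf N m := by simp [pattern]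

theorem data_lt : ∀ d ∈ data N m F, d.1 < d.2.1 ∧ d.2.1 < (pattern N m).length := by
  intro d hd
  rw [length_pattern]
  rcases mem_data.1 hd with ⟨i, hi, rfl⟩ | ⟨i, hi, rfl⟩ | ⟨i, hi, rfl⟩ <;> simp only <;> omega

/-- The constraints, which encode the third family of vectors. -/
noncomputable def constraints (𝓛 : ConstraintKind) :
    List (GapConstraint 𝓛 5 (pattern N m).length) :=
  (data N m F).pmap (constraint 𝓛 _) (data_lt N m F)

end

variable {N m : ℕ} {F : ℕ → ℕ → ℕ → ℕ}

theorem mem_constraints {𝓛 : ConstraintKind} {C : GapConstraint 𝓛 5 (pattern N m).length} :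
    C ∈ constraints N m F 𝓛 ↔
      ∃ d, ∃ h : d ∈ data N m F, C = constraint 𝓛 _ d (data_lt N m F d h) := by
  simp only [constraints, List.mem_pmap, eq_comm]

theorem two_le_patHalf (hN : 2 ≤ N) : 2 ≤ patHalf N m :=
  hN.trans (Nat.le_mul_of_pos_right _ m.succ_pos)

theorem four_le_textHalf (hN : 2 ≤ N) : 4 ≤ textHalf N m :=
  (show 4 ≤ 3 * N - 2 by omega).trans (Nat.le_mul_of_pos_right _ m.succ_pos)

theorem patHalf_le_textHalf (hN : 0 < N) : patHalf N m ≤ textHalf N m :=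
  Nat.mul_le_mul_right _ (by omega)

theorem length_constraints (𝓛 : ConstraintKind) :
    (constraints N m F 𝓛).length = patHalf N m + 2 * (patHalf N m - 1) := by
  simp only [constraints, List.length_pmap, data, List.length_append, List.length_map,
    List.length_range]
  omega

theorem nodup_data : ((data N m F).map fun d => (d.1, d.2.1)).Nodup := by
  simp only [data, List.map_append, List.map_map, List.nodup_append, List.mem_append,
    List.mem_map, List.mem_range, Function.comp_apply]
  refine ⟨⟨?_, ?_, ?_⟩, ?_, ?_⟩
  · refine List.Nodup.map_on (fun x _ y _ h => ?_) List.nodup_range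
    exact (Prod.mk.inj h).1
  · refine List.Nodup.map_on (fun x _ y _ h => ?_) List.nodup_range
    exact (Prod.mk.inj h).1
  · rintro _ ⟨i, -, rfl⟩ _ ⟨j, hj, rfl⟩ h
    simp only [Prod.mk.injEq] at h
    omega
  · refine List.Nodup.map_on (fun x hx y hy h => ?_) List.nodup_range
    simp only [Prod.mk.injEq, List.mem_range, Function.comp_apply] at h hx hy
    omega
  · rintro _ (⟨i, hi, rfl⟩ | ⟨i, hi, rfl⟩) _ ⟨j, hj, rfl⟩ h <;>
      simp only [Prod.mk.injEq] at h <;> omega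

theorem map_ends_constraints (𝓛 : ConstraintKind) :
    (constraints N m F 𝓛).map (fun C => ((C.left : ℕ), (C.right : ℕ))) =
      (data N m F).map fun d => (d.1, d.2.1) := by
  rw [constraints, List.map_pmap]
  simp only [constraint]
  rw [List.pmap_eq_map]

theorem nodup_constraints (𝓛 : ConstraintKind) :
    ((constraints N m F 𝓛).map fun C => (C.left, C.right)).Nodup := by
  refine List.Nodup.of_map (fun p : Fin _ × Fin _ => ((p.1 : ℕ), (p.2 : ℕ))) ?_
  rw [List.map_map]
  exact (map_ends_constraints 𝓛).symm ▸ nodup_data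

theorem le_sizeBound (𝓛 : ConstraintKind) {n : ℕ} : n ≤ 𝓛.sizeBound n := by
  cases 𝓛 with
  | reg => exact Nat.le_self_pow two_ne_zero n
  | semi => exact le_rfl

/-- The instance of the matching problem that has a solution if and only if the families of vectors
given by `F` contain an orthogonal triple. -/
noncomputable def inst (𝓛 : ConstraintKind) (N m : ℕ) (F : ℕ → ℕ → ℕ → ℕ) (hN : 2 ≤ N) :
    MatchInstance 𝓛 where
  σ := 5
  text := text N m F
  pattern := pattern N m
  constraints := constraints N m F 𝓛
  alphabet_le := by
    have := four_le_textHalf (m := m) hN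
    rw [length_text]
    omega
  pattern_le := by
    have := patHalf_le_textHalf (m := m) (zero_lt_two.trans_le hN)
    rw [length_text, length_pattern]
    omega
  nonempty := by
    have := two_le_patHalf (m := m) hN
    rw [← List.length_pos_iff, length_constraints]
    omega
  nodup := nodup_constraints 𝓛
  size_le C hC := by
    obtain ⟨d, h, rfl⟩ := mem_constraints.1 hC
    have := four_le_textHalf (m := m) hN
    refine (size_rep_le 𝓛 d.2.2).trans (le_trans ?_ (le_sizeBound 𝓛))
    rw [length_text]
    omega

theorem size_le_of_mem_inst (𝓛 : ConstraintKind) (hN : 2 ≤ N) :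
    ∀ C ∈ (inst 𝓛 N m F hN).constraints, C.size ≤ 126 := by
  intro C hC
  obtain ⟨d, h, rfl⟩ := mem_constraints.1 hC
  exact size_rep_le 𝓛 d.2.2

theorem nonIntersecting_inst (𝓛 : ConstraintKind) (hN : 2 ≤ N) :
    (inst 𝓛 N m F hN).NonIntersecting := by
  intro C hC C' hC'
  obtain ⟨d, h, rfl⟩ := mem_constraints.1 hC
  obtain ⟨d', h', rfl⟩ := mem_constraints.1 hC'
  refine interval_constraint_inter _ _ ?_
  rcases mem_data.1 h with ⟨i, hi, rfl⟩ | ⟨i, hi, rfl⟩ | ⟨i, hi, rfl⟩ <;>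
  rcases mem_data.1 h' with ⟨j, hj, rfl⟩ | ⟨j, hj, rfl⟩ | ⟨j, hj, rfl⟩ <;>
  simp only <;> omega

theorem symbol_side_lt (m X c q : ℕ) : symbol m (side X c) q < 5 := by
  unfold symbol side
  split_ifs <;> norm_num

theorem textLetter_lt (p : ℕ) : textLetter N m F p < 5 := by
  simp only [textLetter]
  split_ifs
  · exact symbol_side_lt ..
  · norm_num

theorem patLetter_lt (i : ℕ) : patLetter N m i < 5 := symbol_side_lt ..

theorem text_get (p : Fin (text N m F).length) :
    (((text N m F).get p : Fin 5) : ℕ) = textLetter N m F p := by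
  change (((text N m F)[(p : ℕ)] : Fin 5) : ℕ) = _
  simp only [text, List.getElem_map, List.getElem_range]
  exact Nat.mod_eq_of_lt (textLetter_lt _)

theorem pattern_get (i : Fin (pattern N m).length) :
    (((pattern N m).get i : Fin 5) : ℕ) = patLetter N m i := by
  change (((pattern N m)[(i : ℕ)] : Fin 5) : ℕ) = _
  simp only [pattern, List.getElem_map, List.getElem_range]
  exact Nat.mod_eq_of_lt (patLetter_lt _)

theorem exists_isEmbedding_of_isMatch {𝓛 : ConstraintKind} {hN : 2 ≤ N}
    (h : (inst 𝓛 N m F hN).IsMatch) : ∃ e, IsEmbedding N m F e := by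
  obtain ⟨e, hmono, hletter, hC⟩ := h
  change Fin (pattern N m).length → Fin (text N m F).length at e
  have hlen : ∀ i < 2 * patHalf N m, i < (pattern N m).length := fun i hi => by
    rwa [length_pattern]
  refine ⟨fun i => if h : i < (pattern N m).length then (e ⟨i, h⟩ : ℕ) else 0, ?_, ?_, ?_, ?_⟩
  · intro i j hij hj
    simp only [dif_pos (hlen j hj), dif_pos (hlen i (hij.trans hj))]
    exact hmono hij
  · intro i hi
    simp only [dif_pos (hlen i hi)]
    exact (e _).2.trans_eq (length_text N m F)
  · intro i hi
    simp only [dif_pos (hlen i hi)]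
    rw [← text_get, ← pattern_get ⟨i, hlen i hi⟩]
    exact congrArg Fin.val (hletter ⟨i, hlen i hi⟩)
  · intro d hd
    have hlt := data_lt N m F d hd
    have hallowed := (mem_language_constraint _ _).1 (hC _ (mem_constraints.2 ⟨d, hd, rfl⟩))
    simp only [dif_pos hlt.2, dif_pos (hlt.1.trans hlt.2)]
    exact (congrArg (Allowed d.2.2) (length_gap (text N m F) e _ _)).mp hallowed

theorem IsEmbedding.isMatch_inst (𝓛 : ConstraintKind) (hN : 2 ≤ N) {e : ℕ → ℕ}
    (h : IsEmbedding N m F e) : (inst 𝓛 N m F hN).IsMatch := by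
  have hlen : ∀ i : Fin (pattern N m).length, (i : ℕ) < 2 * patHalf N m := fun i =>
    i.2.trans_eq (length_pattern N m)
  refine ⟨fun i => ⟨e i, (h.lt _ (hlen i)).trans_eq (length_text N m F).symm⟩,
    fun i j hij => h.strictMono i j hij (hlen j), fun i => ?_, fun C hC => ?_⟩
  · ext
    exact (text_get _).trans ((h.letter i (hlen i)).trans (pattern_get i).symm)
  · obtain ⟨d, hd, rfl⟩ := mem_constraints.1 hC
    refine (mem_language_constraint _ _).2 ?_
    exact (congrArg (Allowed d.2.2) (length_gap (text N m F) _ _ _)).mpr (h.allowed d hd)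

theorem isMatch_inst_iff (𝓛 : ConstraintKind) (hN : 2 ≤ N) (hF : ∀ g i k, F g i k ≤ 1) :
    (inst 𝓛 N m F hN).IsMatch ↔
      ∃ a < N, ∃ b < N, ∃ c < N, ∀ k < m, ¬ (F 0 a k = 1 ∧ F 1 b k = 1 ∧ F 2 c k = 1) :=
  ⟨fun h => (exists_isEmbedding_iff (by omega) hF).1 (exists_isEmbedding_of_isMatch h),
    fun h => ((exists_isEmbedding_iff (by omega) hF).2 h).elim fun _ he => he.isMatch_inst 𝓛 hN⟩

end TripleMatch

namespace RAM

/-! ### Upper bounds for values and costs -/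

/-- `β` bounds the environment `ρ` entrywise. -/
def Below (ρ β : List ℕ) : Prop := ρ.length = β.length ∧ ∀ x, ρ.getD x 0 ≤ β.getD x 0

namespace Below

theorem nil : Below [] [] := ⟨rfl, fun _ => le_rfl⟩

theorem append {ρ β : List ℕ} (h : Below ρ β) {v w : ℕ} (hv : v ≤ w) :
    Below (ρ ++ [v]) (β ++ [w]) := by
  refine ⟨by simp [h.1], fun x => ?_⟩
  rcases lt_trichotomy x ρ.length with hx | rfl | hx
  · rw [List.getD_append _ _ _ _ hx, List.getD_append _ _ _ _ (h.1 ▸ hx)]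
    exact h.2 x
  · simpa [h.1] using hv
  · rw [List.getD_eq_default _ _ (by simpa using hx)]
    exact Nat.zero_le _

end Below

namespace NatExpr

/-- A bound for the values of an expression, where `B` bounds the entries of the input. -/
def bound (B : ℕ) : NatExpr → List ℕ → ℕ
  | const v, _ => v
  | var x, β => β.getD x 0
  | op .add e₁ e₂, β => e₁.bound B β + e₂.bound B (β ++ [e₁.bound B β])
  | op .mul e₁ e₂, β => e₁.bound B β * e₂.bound B (β ++ [e₁.bound B β])
  | op _ e₁ _, β => e₁.bound B β
  | read _, _ => B
  | bind e₁ e₂, β => e₂.bound B (β ++ [e₁.bound B β])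
  | iter count start body, β =>
    iterate (fun acc _ => max acc
        (body.bound B (β ++ [count.bound B β, acc, count.bound B β])))
      (start.bound B (β ++ [count.bound B β])) (count.bound B β)

/-- A bound for the cost of an expression. -/
def costBound (B : ℕ) : NatExpr → List ℕ → ℕ
  | const v, _ => v + 1
  | var _, _ => 1
  | op o e₁ e₂, β => e₁.costBound B β + e₂.costBound B (β ++ [e₁.bound B β]) +
      o.charge (e₁.bound B β) (e₂.bound B (β ++ [e₁.bound B β])) + 1
  | read e, β => e.costBound B β + 1
  | bind e₁ e₂, β => e₁.costBound B β + e₂.costBound B (β ++ [e₁.bound B β]) + 1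
  | iter count start body, β =>
    count.costBound B β + start.costBound B (β ++ [count.bound B β]) + 4 + count.bound B β *
      (body.costBound B (β ++ [count.bound B β, (iter count start body).bound B β,
        count.bound B β]) + 6)

theorem iterate_le_iterate {f g : ℕ → ℕ → ℕ} {z w n N : ℕ} (hn : n ≤ N) (hz : z ≤ w)
    (h : ∀ acc acc' i, i < N → acc ≤ acc' → f acc i ≤ g acc' i) (hg : ∀ acc i, acc ≤ g acc i) :
    iterate f z n ≤ iterate g w N := by
  induction N generalizing n with
  | zero =>
    obtain rfl := Nat.le_zero.1 hn
    exact hz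
  | succ N ih =>
    replace ih := fun {n} hn => @ih n hn fun acc acc' i hi => h acc acc' i (hi.trans N.lt_succ_self)
    rcases hn.eq_or_lt with rfl | hlt
    · exact h _ _ _ N.lt_succ_self (ih le_rfl)
    · exact (ih (Nat.le_of_lt_succ hlt)).trans (hg _ _)

variable {inp : List ℕ} {B : ℕ}

theorem iterate_eval_le_bound {count start body : NatExpr} {ρ β : List ℕ} {n : ℕ}
    (h : Below ρ β) (hn : n ≤ count.eval inp ρ) (hcount : count.eval inp ρ ≤ count.bound B β)
    (hstart : ∀ {ρ β}, Below ρ β → start.eval inp ρ ≤ start.bound B β)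
    (hbody : ∀ {ρ β}, Below ρ β → body.eval inp ρ ≤ body.bound B β) :
    iterate (fun acc i => body.eval inp (ρ ++ [count.eval inp ρ, acc, i]))
      (start.eval inp (ρ ++ [count.eval inp ρ])) n ≤ (iter count start body).bound B β := by
  refine iterate_le_iterate (hn.trans hcount) (hstart (h.append hcount)) ?_
    fun _ _ => le_max_left _ _
  intro acc acc' i hi hacc
  refine (hbody ?_).trans (le_max_right _ _)
  simpa using ((h.append hcount).append hacc).append hi.le

theorem eval_le_bound (hB : ∀ x ∈ inp, x ≤ B) (e : NatExpr) {ρ β : List ℕ} (h : Below ρ β) :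
    e.eval inp ρ ≤ e.bound B β := by
  induction e generalizing ρ β with
  | const => exact le_rfl
  | var x => exact h.2 x
  | op o _ _ ih₁ ih₂ =>
    have h₁ := ih₁ h
    cases o with
    | add => exact Nat.add_le_add h₁ (ih₂ (h.append h₁))
    | sub => exact (Nat.sub_le _ _).trans h₁
    | mul => exact Nat.mul_le_mul h₁ (ih₂ (h.append h₁))
    | div => exact (Nat.div_le_self _ _).trans h₁
    | mod => exact (Nat.mod_le _ _).trans h₁
  | read => exact getD_le hB _
  | bind _ _ ih₁ ih₂ => exact ih₂ (h.append (ih₁ h))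
  | iter _ _ _ ih₁ ih₂ ih₃ => exact iterate_eval_le_bound h le_rfl (ih₁ h) ih₂ ih₃

theorem cost_le_costBound (hB : ∀ x ∈ inp, x ≤ B) (e : NatExpr) {ρ β : List ℕ} (h : Below ρ β) :
    e.cost inp ρ ≤ e.costBound B β := by
  induction e generalizing ρ β with
  | const => exact le_rfl
  | var => exact le_rfl
  | op o e₁ e₂ ih₁ ih₂ =>
    have v₁ := eval_le_bound hB e₁ h
    have v₂ := eval_le_bound hB e₂ (h.append v₁)
    refine Nat.add_le_add_right (Nat.add_le_add (Nat.add_le_add (ih₁ h) (ih₂ (h.append v₁))) ?_) 1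
    cases o with
    | add => exact Nat.add_le_add v₁ v₂
    | mul => exact Nat.mul_le_mul v₁ v₂
    | _ => exact le_rfl
  | read _ ih => exact Nat.add_le_add_right (ih h) 1
  | bind e₁ _ ih₁ ih₂ =>
    exact Nat.add_le_add_right (Nat.add_le_add (ih₁ h) (ih₂ (h.append (eval_le_bound hB e₁ h)))) 1
  | iter count start body ih₁ ih₂ ih₃ =>
    have v := eval_le_bound hB count h
    refine Nat.add_le_add (Nat.add_le_add_right (Nat.add_le_add (ih₁ h) (ih₂ (h.append v))) 4)
      ((Finset.sum_le_card_nsmul _ _ (body.costBound B (β ++ [count.bound B β,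
        (iter count start body).bound B β, count.bound B β]) + 6) fun i hi => ?_).trans ?_)
    · have hi : i ≤ count.eval inp ρ := (Finset.mem_range.1 hi).le
      have hacc := iterate_eval_le_bound h hi v (eval_le_bound hB start) (eval_le_bound hB body)
      refine Nat.add_le_add_right (ih₃ ?_) 6
      simpa using ((h.append v).append hacc).append (hi.trans v)
    · rw [Finset.card_range, smul_eq_mul]
      exact Nat.mul_le_mul_right _ v

end NatExpr

namespace Gen

/-- A bound for the cost of a generator. -/
def costBound (B : ℕ) : Gen → List ℕ → ℕ
  | emit e, β => e.costBound B β + 3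
  | seq g₁ g₂, β => g₁.costBound B β + g₂.costBound B β
  | bind e g, β => e.costBound B β + g.costBound B (β ++ [e.bound B β])
  | loop count body, β => count.costBound B β + 3 + count.bound B β *
      (body.costBound B (β ++ [count.bound B β, count.bound B β]) + 5)

variable {inp : List ℕ} {B : ℕ}

theorem cost_le_costBound (hB : ∀ x ∈ inp, x ≤ B) (g : Gen) {ρ β : List ℕ} (h : Below ρ β) :
    g.cost inp ρ ≤ g.costBound B β := by
  induction g generalizing ρ β with
  | emit e => exact Nat.add_le_add_right (e.cost_le_costBound hB h) 3
  | seq _ _ ih₁ ih₂ => exact Nat.add_le_add (ih₁ h) (ih₂ h)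
  | bind e _ ih =>
    exact Nat.add_le_add (e.cost_le_costBound hB h) (ih (h.append (e.eval_le_bound hB h)))
  | loop count body ih =>
    have v := count.eval_le_bound hB h
    refine Nat.add_le_add (Nat.add_le_add_right (count.cost_le_costBound hB h) 3)
      ((Finset.sum_le_card_nsmul _ _ (body.costBound B (β ++ [count.bound B β,
        count.bound B β]) + 5) fun i hi => ?_).trans ?_)
    · refine Nat.add_le_add_right (ih ?_) 5
      simpa using (h.append v).append ((Finset.mem_range.1 hi).le.trans v)
    · rw [Finset.card_range, smul_eq_mul]
      exact Nat.mul_le_mul_right _ v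

/-- Writes the given numbers. -/
def emitList : List ℕ → Gen
  | [] => loop (.const 0) (emit (.const 0))
  | v :: l => seq (emit (.const v)) (emitList l)

theorem out_emitList (inp l ρ : List ℕ) : (emitList l).out inp ρ = l := by
  induction l with
  | nil => rfl
  | cons v l ih => simp [emitList, out, ih, NatExpr.eval]

theorem costBound_emitList (B : ℕ) (l β : List ℕ) :
    (emitList l).costBound B β = (emitList l).costBound 0 [] := by
  induction l with
  | nil => rfl
  | cons v l ih => simp [emitList, costBound, NatExpr.costBound, ih]

end Gen

end RAM

/-! ### Satisfiability as orthogonality -/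

namespace SatReduction

open RAM.NatExpr (iterate)

/-- `1` if the numbers are equal, `0` otherwise, in truncated arithmetic. -/
def eqNat (a b : ℕ) : ℕ := 1 - ((a - b) + (b - a))

theorem eqNat_eq (a b : ℕ) : eqNat a b = if a = b then 1 else 0 := by
  unfold eqNat
  split_ifs <;> omega

/-- The position of the clause `k` in the encoding of a formula. -/
def clauseStart (inp : List ℕ) (k : ℕ) : ℕ := iterate (fun acc _ => acc + 1 + inp.getD acc 0) 2 k

/-- `0` if the literal with code `c` belongs to the group `g` of variables and is satisfied by the
assignment with number `i` of this group, `1` otherwise. Groups have `r` variables. -/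
def literalFails (r g i c : ℕ) : ℕ :=
  1 - eqNat (c / 2 / r) g * eqNat (iterate (fun a _ => a / 2) i (c / 2 % r) % 2) (c % 2)

/-- `1` if no literal of the clause `k` is satisfied by the assignment `i` of the group `g`. -/
def clauseFails (inp : List ℕ) (r g i k : ℕ) : ℕ :=
  iterate (fun acc t => acc * literalFails r g i (inp.getD (clauseStart inp k + 1 + t) 0)) 1
    (inp.getD (clauseStart inp k) 0)

theorem iterate_mul (f : ℕ → ℕ) (n : ℕ) :
    iterate (fun acc t => acc * f t) 1 n = ∏ t ∈ Finset.range n, f t := by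
  induction n with
  | zero => rfl
  | succ n ih => rw [iterate, ih, Finset.prod_range_succ]

theorem iterate_half (i n : ℕ) : iterate (fun a _ => a / 2) i n = i / 2 ^ n := by
  induction n with
  | zero => simp [iterate]
  | succ n ih => rw [iterate, ih, Nat.div_div_eq_div_mul, pow_succ]

theorem literalFails_le (r g i c : ℕ) : literalFails r g i c ≤ 1 := Nat.sub_le _ _

theorem clauseFails_le (inp : List ℕ) (r g i k : ℕ) : clauseFails inp r g i k ≤ 1 := by
  rw [clauseFails, iterate_mul]
  exact Finset.prod_le_one' fun _ _ => literalFails_le _ _ _ _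

theorem clauseFails_eq_one_iff (inp : List ℕ) (r g i k : ℕ) : clauseFails inp r g i k = 1 ↔
    ∀ t < inp.getD (clauseStart inp k) 0,
      literalFails r g i (inp.getD (clauseStart inp k + 1 + t) 0) = 1 := by
  rw [clauseFails, iterate_mul]
  simp only [Finset.prod_eq_one_iff, Finset.mem_range]

theorem literalFails_eq_one_iff (r g i v : ℕ) (b : Bool) :
    literalFails r g i (2 * v + b.toNat) = 1 ↔ ¬ (v / r = g ∧ i.testBit (v % r) = b) := by
  have hvar : (2 * v + b.toNat) / 2 = v := by
    have := b.toNat_le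
    omega
  have hsign : (2 * v + b.toNat) % 2 = b.toNat := by cases b <;> simp
  rw [literalFails, hvar, hsign, iterate_half, eqNat_eq, eqNat_eq, Nat.testBit_eq_decide_div_mod_eq]
  rcases Nat.mod_two_eq_zero_or_one (i / 2 ^ (v % r)) with h | h <;>
  cases b <;> by_cases hg : v / r = g <;> simp [h, hg]

/-- The part of the encoding of a formula that stands for the clause `c`. -/
def encodeClause {n : ℕ} (c : List (Fin n × Bool)) : List ℕ :=
  c.length :: c.map fun l => 2 * (l.1 : ℕ) + l.2.toNat

section

variable (φ : CNF)

theorem encode_eq :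
    φ.encode = [φ.numVars, φ.clauses.length] ++ φ.clauses.flatMap encodeClause := rfl

theorem exists_encode_eq_append {k : ℕ} (hk : k < φ.clauses.length) :
    ∃ rest, φ.encode = ([φ.numVars, φ.clauses.length] ++
      (φ.clauses.take k).flatMap encodeClause) ++ (encodeClause φ.clauses[k] ++ rest) := by
  refine ⟨(φ.clauses.drop (k + 1)).flatMap encodeClause, ?_⟩
  rw [encode_eq, List.append_assoc, ← List.flatMap_cons, ← List.flatMap_append,
    List.cons_getElem_drop_succ, List.take_append_drop]

theorem getD_encode {k : ℕ} (hk : k < φ.clauses.length) {t : ℕ} (ht : t ≤ φ.clauses[k].length) :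
    φ.encode.getD (([φ.numVars, φ.clauses.length] ++
      (φ.clauses.take k).flatMap encodeClause).length + t) 0 =
        (encodeClause φ.clauses[k]).getD t 0 := by
  obtain ⟨rest, hrest⟩ := exists_encode_eq_append φ hk
  conv_lhs => rw [hrest]
  rw [List.getD_append_right _ _ _ _ (Nat.le_add_right _ _), Nat.add_sub_cancel_left,
    List.getD_append _ _ _ _ (by simpa [encodeClause] using Nat.lt_succ_of_le ht)]

theorem clauseStart_encode {k : ℕ} (hk : k ≤ φ.clauses.length) :
    clauseStart φ.encode k = ([φ.numVars, φ.clauses.length] ++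
      (φ.clauses.take k).flatMap encodeClause).length := by
  induction k with
  | zero => rfl
  | succ k ih =>
    have hlen := getD_encode φ hk (Nat.zero_le _)
    replace ih := ih (Nat.le_of_succ_le hk)
    rw [clauseStart] at ih ⊢
    rw [add_zero] at hlen
    rw [iterate, ih, hlen, List.take_add_one, List.getElem?_eq_getElem hk]
    simp only [Option.toList_some, List.flatMap_append, List.flatMap_singleton, List.length_append,
      encodeClause, List.length_cons, List.length_map, List.getD_cons_zero]
    omega

theorem getD_clauseStart {k : ℕ} (hk : k < φ.clauses.length) :
    φ.encode.getD (clauseStart φ.encode k) 0 = φ.clauses[k].length := by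
  rw [clauseStart_encode φ hk.le]
  exact getD_encode φ hk (Nat.zero_le _)

theorem getD_clauseStart_add {k : ℕ} (hk : k < φ.clauses.length) {t : ℕ}
    (ht : t < φ.clauses[k].length) :
    φ.encode.getD (clauseStart φ.encode k + 1 + t) 0 =
      2 * (φ.clauses[k][t].1 : ℕ) + φ.clauses[k][t].2.toNat := by
  rw [clauseStart_encode φ hk.le, add_assoc, add_comm 1 t, getD_encode φ hk ht]
  simp [encodeClause, ht]

theorem clauseFails_encode_iff (r g i : ℕ) {k : ℕ} (hk : k < φ.clauses.length) :
    clauseFails φ.encode r g i k = 1 ↔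
      ∀ l ∈ φ.clauses[k], ¬ ((l.1 : ℕ) / r = g ∧ i.testBit (l.1 % r) = l.2) := by
  rw [clauseFails_eq_one_iff, getD_clauseStart φ hk, List.forall_mem_iff_getElem]
  refine forall₂_congr fun t ht => ?_
  rw [getD_clauseStart_add φ hk ht, literalFails_eq_one_iff]

end

/-- The number of variables in each of the three groups into which `n` variables are split. -/
def groupSize (n : ℕ) : ℕ := n / 3 + 1

theorem div_groupSize_cases {n v : ℕ} (hv : v < n) :
    v / groupSize n = 0 ∨ v / groupSize n = 1 ∨ v / groupSize n = 2 := by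
  have hlt : v / groupSize n < 3 := by
    refine Nat.div_lt_of_lt_mul ?_
    rw [groupSize]
    omega
  generalize v / groupSize n = g at hlt
  omega

theorem exists_testBit_mod_eq {r : ℕ} (hr : 0 < r) (A : ℕ → Bool) (g : ℕ) :
    ∃ i < 2 ^ r, ∀ v, v / r = g → i.testBit (v % r) = A v := by
  refine ⟨Nat.ofBits fun j : Fin r => A (g * r + j), Nat.ofBits_lt_two_pow _, ?_⟩
  rintro v rfl
  rw [Nat.testBit_ofBits_lt _ _ (Nat.mod_lt v hr), Nat.div_add_mod']

theorem satisfiable_iff (φ : CNF) :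
    φ.Satisfiable ↔ ∃ a < 2 ^ groupSize φ.numVars, ∃ b < 2 ^ groupSize φ.numVars,
      ∃ c < 2 ^ groupSize φ.numVars, ∀ k < φ.clauses.length,
        ¬ (clauseFails φ.encode (groupSize φ.numVars) 0 a k = 1 ∧
          clauseFails φ.encode (groupSize φ.numVars) 1 b k = 1 ∧
          clauseFails φ.encode (groupSize φ.numVars) 2 c k = 1) := by
  constructor
  · rintro ⟨A, hA⟩
    choose i hi hbit using exists_testBit_mod_eq (r := groupSize φ.numVars) (Nat.succ_pos _)
      fun v => if h : v < φ.numVars then A ⟨v, h⟩ else false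
    refine ⟨i 0, hi 0, i 1, hi 1, i 2, hi 2, fun k hk => ?_⟩
    simp only [clauseFails_encode_iff φ _ _ _ hk]
    rintro ⟨h0, h1, h2⟩
    obtain ⟨l, hl, hAl⟩ := hA _ (List.getElem_mem hk)
    have hlit : ∀ g, (l.1 : ℕ) / groupSize φ.numVars = g →
        (i g).testBit (l.1 % groupSize φ.numVars) = l.2 := fun g hg => by
      rw [hbit g _ hg, dif_pos l.1.2]
      exact hAl
    rcases div_groupSize_cases l.1.2 with hg | hg | hg
    exacts [h0 l hl ⟨hg, hlit 0 hg⟩, h1 l hl ⟨hg, hlit 1 hg⟩, h2 l hl ⟨hg, hlit 2 hg⟩]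
  · rintro ⟨a, -, b, -, c, -, h⟩
    refine ⟨fun v => (if (v : ℕ) / groupSize φ.numVars = 0 then a
      else if (v : ℕ) / groupSize φ.numVars = 1 then b else c).testBit
        (v % groupSize φ.numVars), fun cl hcl => ?_⟩
    obtain ⟨k, hk, rfl⟩ := List.getElem_of_mem hcl
    by_contra! hne
    refine h k hk ⟨?_, ?_, ?_⟩ <;> rw [clauseFails_encode_iff φ _ _ _ hk] <;>
    rintro l hl ⟨hg, hb⟩ <;> exact hne l hl (by simp [hg, hb])

end SatReduction

/-! ### The program for the reduction -/

/-! Environments begin with the number `n` of variables, the number `m` of clauses, the size `r` of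
a group, `N = 2 ^ r`, `patHalf N m` and `textHalf N m`. In a loop, they continue with the number of
rounds, at position `6`, and the current round, at position `7`. -/

namespace RAM.NatExpr

instance : Add NatExpr := ⟨op .add⟩
instance : Sub NatExpr := ⟨op .sub⟩
instance : Mul NatExpr := ⟨op .mul⟩
instance : Div NatExpr := ⟨op .div⟩
instance : Mod NatExpr := ⟨op .mod⟩
instance (n : ℕ) : OfNat NatExpr n := ⟨const n⟩

section

variable (a b : NatExpr)

theorem add_eq : a + b = op .add a b := rfl
theorem sub_eq : a - b = op .sub a b := rfl
theorem mul_eq : a * b = op .mul a b := rfl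
theorem div_eq : a / b = op .div a b := rfl
theorem mod_eq : a % b = op .mod a b := rfl
theorem ofNat_eq (n : ℕ) : (OfNat.ofNat n : NatExpr) = const n := rfl

end

end RAM.NatExpr

namespace SatReduction

open RAM RAM.NatExpr TripleMatch

/-- `1` if the values are equal, `0` otherwise. -/
def eqE (a b : NatExpr) : NatExpr := 1 - ((a - b) + (b - a))

/-- In an environment of length `11` that has the size of a group, the group, the assignment and
the clause at the positions `2`, `8`, `9`, `10`: does the clause fail? -/
def clauseFailsE : NatExpr :=
  bind (iter (var 10) 2 (var 12 + 1 + read (var 12)))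
    (iter (read (var 11)) 1
      (bind (read (var 11 + 1 + var 14))
        (bind (iter (var 15 / 2 % var 2) (var 9) (var 17 / 2))
          (var 13 * (1 - eqE (var 15 / 2 / var 2) (var 8) * eqE (var 16 % 2) (var 15 % 2))))))

theorem eval_clauseFailsE (inp : List ℕ) (n m r N D Q x y g i k : ℕ) :
    clauseFailsE.eval inp [n, m, r, N, D, Q, x, y, g, i, k] = clauseFails inp r g i k := rfl

/-- The distance from the end, for the position `c` in the half `s` of a string with halves of
length `X`. -/
def foldE (X s c : NatExpr) : NatExpr := (1 - s) * c + s * (2 * X - 1 - c)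

/-- The cell of the text at the position `7` of the environment, after the half `8`. -/
def textCellE : NatExpr := foldE (var 5) (var 8) (var 7 / 20)

/-- A letter of the text, whose position is at the position `7` of the environment. -/
def textLetterE : NatExpr :=
  bind (1 - (var 5 - var 7 / 20)) <|
  bind (textCellE / (var 1 + 1) - (var 3 - 1)) <|
  bind (var 1 - (var 1 - (textCellE % (var 1 + 1) - 1))) <|
  bind clauseFailsE <|
  bind ((1 - (var 3 - 1 - textCellE / (var 1 + 1))) +
    (1 - (2 * var 3 - 1 - textCellE / (var 1 + 1)))) <|
  bind (1 - (1 - textCellE % (var 1 + 1))) <|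
  bind (eqE (var 12) 1 * var 13 * var 11) <|
  eqE (var 7 % 20) (4 * var 12 + ((1 - var 8) * var 14 + var 8 * (1 - var 14))) *
    (1 + 2 * var 8 + var 13)

section

variable {N m : ℕ} {F : ℕ → ℕ → ℕ → ℕ}

theorem side_eq (X c : ℕ) : side X c = 1 - (X - c) := by
  unfold side
  split_ifs <;> omega

theorem fold_eq (X c : ℕ) : fold X c = (1 - side X c) * c + side X c * (2 * X - 1 - c) := by
  unfold fold side
  split_ifs <;> simp

theorem stage_eq (hN : 1 ≤ N) (b : ℕ) :
    stage N b = (1 - (N - 1 - b)) + (1 - (2 * N - 1 - b)) := by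
  unfold stage
  split_ifs <;> omega

theorem one_sub_one_sub (a : ℕ) : 1 - (1 - a) = if a = 0 then 0 else 1 := by
  split_ifs <;> omega

theorem pred_mod_eq (m q : ℕ) : q % (m + 1) - 1 = m - (m - (q % (m + 1) - 1)) := by
  have : q % (m + 1) < m + 1 := Nat.mod_lt q m.succ_pos
  omega

theorem bit_eq (s q : ℕ) :
    bit N m F s q = eqNat (stage N (q / (m + 1))) 1 * (1 - (1 - q % (m + 1))) *
      F s (q / (m + 1) - (N - 1)) (q % (m + 1) - 1) := by
  rw [bit, eqNat_eq, one_sub_one_sub]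
  by_cases hstage : stage N (q / (m + 1)) = 1 <;> by_cases hq : q % (m + 1) = 0 <;>
    simp [hstage, hq]

theorem offset_side_eq (X c q : ℕ) :
    offset N m F (side X c) q = 4 * stage N (q / (m + 1)) +
      ((1 - side X c) * bit N m F (side X c) q +
        side X c * (1 - bit N m F (side X c) q)) := by
  unfold offset side
  split_ifs <;> simp_all

theorem textLetter_eq (p : ℕ) :
    textLetter N m F p =
      eqNat (p % 20) (offset N m F (side (textHalf N m) (p / 20)) (fold (textHalf N m) (p / 20))) *
        symbol m (side (textHalf N m) (p / 20)) (fold (textHalf N m) (p / 20)) := by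
  rw [eqNat_eq, ite_mul, one_mul, zero_mul]
  rfl

end

theorem eval_textLetterE (inp : List ℕ) (n m r x p : ℕ) {N : ℕ} (hN : 1 ≤ N) :
    textLetterE.eval inp [n, m, r, N, patHalf N m, textHalf N m, x, p] =
      textLetter N m (clauseFails inp r) p := by
  rw [textLetter_eq, offset_side_eq, bit_eq, symbol, ← one_sub_one_sub, stage_eq hN, pred_mod_eq,
    fold_eq, side_eq]
  generalize patHalf N m = D
  generalize textHalf N m = Q
  simp only [textLetterE, textCellE, foldE, eqE, add_eq, sub_eq, mul_eq, div_eq, mod_eq, ofNat_eq,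
    List.cons_append, List.nil_append, eval_clauseFailsE, eval, Op.apply, List.getD_cons_succ,
    List.getD_cons_zero, eqNat]

/-- A letter of the pattern, whose position is at the position `7` of the environment. -/
def patLetterE : NatExpr :=
  bind (1 - (var 4 - var 7)) <|
    1 + 2 * var 8 + (1 - (1 - foldE (var 4) (var 8) (var 7) % (var 1 + 1)))

theorem eval_patLetterE (inp : List ℕ) (n m r N x Q i : ℕ) :
    patLetterE.eval inp [n, m, r, N, patHalf N m, Q, x, i] = patLetter N m i := by
  simp only [patLetterE, foldE, add_eq, sub_eq, mul_eq, mod_eq, ofNat_eq, List.cons_append,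
    List.nil_append, eval, Op.apply, List.getD_cons_succ, List.getD_cons_zero]
  rw [← side_eq, ← fold_eq, one_sub_one_sub, patLetter, symbol]

/-- The kind of the constraint between the position of the pattern that is at the position `7` of
the environment, and its mirror image. -/
def pairKindE : NatExpr :=
  bind 2 <| bind (var 7 / (var 1 + 1)) <| bind (var 1 - (var 1 - (var 7 % (var 1 + 1) - 1))) <|
  bind clauseFailsE <|
    2 + (1 - (1 - var 7 % (var 1 + 1))) * var 11

/-- The kind of the constraint between the position `i` of the pattern and its successor, in the
left half, where `i` is at the position `7` of the environment. -/
def leftKindE : NatExpr := eqE (var 7 % (var 1 + 1)) (var 1)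

/-- The kind of the constraint between the mirror images of the positions `i` and `i + 1` of the
pattern, in the right half, where `i` is at the position `7` of the environment. -/
def rightKindE : NatExpr := 4 * leftKindE

/-- Writes the encoding of the constraint language of kind `t` if the position `8` of the
environment contains `t`. -/
noncomputable def emitCase (𝓛 : ConstraintKind) (t : ℕ) : Gen :=
  .loop (eqE (var 8) (const t)) (.emitList (𝓛.encode (rep 𝓛 t)))

/-- Writes the encoding of the constraint language whose kind is at the position `8` of the
environment. -/
noncomputable def emitKind (𝓛 : ConstraintKind) : Gen :=
  .seq (emitCase 𝓛 0) <| .seq (emitCase 𝓛 1) <| .seq (emitCase 𝓛 2) <|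
    .seq (emitCase 𝓛 3) (emitCase 𝓛 4)

/-- Writes one constraint, with the given positions and kind. -/
noncomputable def emitConstraint (𝓛 : ConstraintKind) (a b t : NatExpr) : Gen :=
  .seq (.emit a) (.seq (.emit b) (.bind t (emitKind 𝓛)))

/-- Writes the constraints between the positions of the pattern and their mirror images. -/
noncomputable def emitPairs (𝓛 : ConstraintKind) : Gen :=
  .loop (var 4) (emitConstraint 𝓛 (var 7) (2 * var 4 - 1 - var 7) pairKindE)

/-- Writes the constraints in the left half of the pattern. -/
noncomputable def emitLeft (𝓛 : ConstraintKind) : Gen :=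
  .loop (var 4 - 1) (emitConstraint 𝓛 (var 7) (var 7 + 1) leftKindE)

/-- Writes the constraints in the right half of the pattern. -/
noncomputable def emitRight (𝓛 : ConstraintKind) : Gen :=
  .loop (var 4 - 1)
    (emitConstraint 𝓛 (2 * var 4 - 2 - var 7) (2 * var 4 - 1 - var 7) rightKindE)

/-- Writes the letters of the text. -/
def emitText : Gen := .loop (40 * var 5) (.emit textLetterE)

/-- Writes the letters of the pattern. -/
def emitPattern : Gen := .loop (2 * var 4) (.emit patLetterE)

/-- Writes the encoding of the instance of the matching problem. -/
noncomputable def emitInstance (𝓛 : ConstraintKind) : Gen :=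
  .seq (.emit 5) <| .seq (.emit (40 * var 5)) <| .seq emitText <|
  .seq (.emit (2 * var 4)) <| .seq emitPattern <|
  .seq (.emit (var 4 + 2 * (var 4 - 1))) <|
  .seq (emitPairs 𝓛) <| .seq (emitLeft 𝓛) (emitRight 𝓛)

/-- Computes the number of assignments of a group. -/
def powE : NatExpr := iter (var 2) 1 (var 4 * 2)

/-- Computes the instance of the matching problem for a formula. -/
noncomputable def program (𝓛 : ConstraintKind) : Gen :=
  .bind (read 0) <|
  .bind (read 1) <|
  .bind (var 0 / 3 + 1) <|
  .bind powE <|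
  .bind (var 3 * (var 1 + 1)) <|
  .bind ((3 * var 3 - 2) * (var 1 + 1)) <|
  emitInstance 𝓛

section

variable {inp : List ℕ} {n m r N D Q x i τ : ℕ}

theorem eval_pairKindE :
    pairKindE.eval inp [n, m, r, N, D, Q, x, i] = pairKind m (clauseFails inp r) i := by
  simp only [pairKindE, add_eq, sub_eq, mul_eq, div_eq, mod_eq, ofNat_eq, List.cons_append,
    List.nil_append, eval_clauseFailsE, eval, Op.apply, List.getD_cons_succ, List.getD_cons_zero]
  rw [← pred_mod_eq, one_sub_one_sub, ite_mul, zero_mul, one_mul, pairKind]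

theorem eval_leftKindE : leftKindE.eval inp [n, m, r, N, D, Q, x, i] = leftKind m i :=
  eqNat_eq _ _

theorem eval_rightKindE : rightKindE.eval inp [n, m, r, N, D, Q, x, i] = rightKind m i := by
  change 4 * leftKindE.eval inp [n, m, r, N, D, Q, x, i] = _
  rw [eval_leftKindE, leftKind, mul_ite, rightKind]

theorem pairKind_le : pairKind m (clauseFails inp r) i ≤ 4 := by
  have := clauseFails_le inp r 2 (i / (m + 1)) (i % (m + 1) - 1)
  unfold pairKind
  split_ifs <;> omega

theorem leftKind_le : leftKind m i ≤ 4 := by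
  unfold leftKind
  split_ifs <;> omega

theorem rightKind_le : rightKind m i ≤ 4 := by
  unfold rightKind
  split_ifs <;> omega

variable (𝓛 : ConstraintKind)

theorem out_emitCase (t : ℕ) : (emitCase 𝓛 t).out inp [n, m, r, N, D, Q, x, i, τ] =
    if τ = t then 𝓛.encode (rep 𝓛 t) else [] := by
  have h : (eqE (var 8) (const t)).eval inp [n, m, r, N, D, Q, x, i, τ] = eqNat τ t := rfl
  simp only [emitCase, Gen.out, h, eqNat_eq, Gen.out_emitList]
  split_ifs <;> simp

theorem out_emitKind (hτ : τ ≤ 4) :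
    (emitKind 𝓛).out inp [n, m, r, N, D, Q, x, i, τ] = 𝓛.encode (rep 𝓛 τ) := by
  simp only [emitKind, Gen.out, out_emitCase]
  interval_cases τ <;> simp

theorem out_emitConstraint {a b t : NatExpr} (ht : t.eval inp [n, m, r, N, D, Q, x, i] = τ)
    (hτ : τ ≤ 4) : (emitConstraint 𝓛 a b t).out inp [n, m, r, N, D, Q, x, i] =
      a.eval inp [n, m, r, N, D, Q, x, i] :: b.eval inp [n, m, r, N, D, Q, x, i] ::
        𝓛.encode (rep 𝓛 τ) := by
  rw [← out_emitKind 𝓛 hτ, ← ht]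
  rfl

theorem out_emitPairs : (emitPairs 𝓛).out inp [n, m, r, N, D, Q] = (List.range D).flatMap fun i =>
    i :: (2 * D - 1 - i) :: 𝓛.encode (rep 𝓛 (pairKind m (clauseFails inp r) i)) :=
  List.flatMap_congr fun _ _ => out_emitConstraint 𝓛 eval_pairKindE pairKind_le

theorem out_emitLeft : (emitLeft 𝓛).out inp [n, m, r, N, D, Q] =
    (List.range (D - 1)).flatMap fun i => i :: (i + 1) :: 𝓛.encode (rep 𝓛 (leftKind m i)) :=
  List.flatMap_congr fun _ _ => out_emitConstraint 𝓛 eval_leftKindE leftKind_le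

theorem out_emitRight : (emitRight 𝓛).out inp [n, m, r, N, D, Q] =
    (List.range (D - 1)).flatMap fun i =>
      (2 * D - 2 - i) :: (2 * D - 1 - i) :: 𝓛.encode (rep 𝓛 (rightKind m i)) :=
  List.flatMap_congr fun _ _ => out_emitConstraint 𝓛 eval_rightKindE rightKind_le

theorem out_emitText (hN : 1 ≤ N) :
    emitText.out inp [n, m, r, N, patHalf N m, textHalf N m] =
      (List.range (40 * textHalf N m)).map (textLetter N m (clauseFails inp r)) :=
  List.map_eq_flatMap.symm.trans <|
    List.map_congr_left fun p _ => eval_textLetterE inp n m r (40 * textHalf N m) p hN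

theorem out_emitPattern : emitPattern.out inp [n, m, r, N, patHalf N m, Q] =
    (List.range (2 * patHalf N m)).map (patLetter N m) :=
  List.map_eq_flatMap.symm.trans <|
    List.map_congr_left fun i _ => eval_patLetterE inp n m r N (2 * patHalf N m) Q i

end

section

variable {N m : ℕ} {F : ℕ → ℕ → ℕ → ℕ}

theorem map_val_text :
    (text N m F).map Fin.val = (List.range (40 * textHalf N m)).map (textLetter N m F) := by
  rw [text, List.map_map]
  exact List.map_congr_left fun p _ => Nat.mod_eq_of_lt (textLetter_lt p)

theorem map_val_pattern :
    (pattern N m).map Fin.val = (List.range (2 * patHalf N m)).map (patLetter N m) := by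
  rw [pattern, List.map_map]
  exact List.map_congr_left fun i _ => Nat.mod_eq_of_lt (patLetter_lt i)

variable (𝓛 : ConstraintKind)

theorem flatMap_encode_constraints : (constraints N m F 𝓛).flatMap GapConstraint.encode =
    (data N m F).flatMap fun d => d.1 :: d.2.1 :: 𝓛.encode (rep 𝓛 d.2.2) := by
  rw [List.flatMap_def, List.flatMap_def, constraints, List.map_pmap]
  simp only [GapConstraint.encode, constraint]
  rw [List.pmap_eq_map]
  rfl

theorem encode_inst (hN : 2 ≤ N) : (inst 𝓛 N m F hN).encode =
    [5, (text N m F).length] ++ (text N m F).map Fin.val ++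
      [(pattern N m).length] ++ (pattern N m).map Fin.val ++
      [(constraints N m F 𝓛).length] ++ (constraints N m F 𝓛).flatMap GapConstraint.encode := by
  simp [MatchInstance.encode, inst, List.map_eq_flatMap]

theorem out_emitInstance (hN : 2 ≤ N) {inp : List ℕ} {n r : ℕ} :
    (emitInstance 𝓛).out inp [n, m, r, N, patHalf N m, textHalf N m] =
      (inst 𝓛 N m (clauseFails inp r) hN).encode := by
  rw [encode_inst, map_val_text, map_val_pattern, flatMap_encode_constraints,
    length_constraints, length_text, length_pattern, data, List.flatMap_append, List.flatMap_append,
    List.flatMap_map, List.flatMap_map, List.flatMap_map]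
  simp only [emitInstance, Gen.out, out_emitText (Nat.one_le_of_lt hN), out_emitPattern,
    out_emitPairs, out_emitLeft, out_emitRight, List.append_assoc]
  rfl

end

theorem iterate_double (n : ℕ) : iterate (fun a _ => a * 2) 1 n = 2 ^ n := by
  induction n with
  | zero => rfl
  | succ n ih => rw [iterate, ih, pow_succ]

theorem two_le_two_pow_groupSize (n : ℕ) : 2 ≤ 2 ^ groupSize n :=
  Nat.le_self_pow (Nat.succ_ne_zero _) 2

/-- The instance of the matching problem for a formula. -/
noncomputable def instOfCNF (𝓛 : ConstraintKind) (φ : CNF) : MatchInstance 𝓛 :=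
  inst 𝓛 (2 ^ groupSize φ.numVars) φ.clauses.length (clauseFails φ.encode (groupSize φ.numVars))
    (two_le_two_pow_groupSize _)

theorem out_program (𝓛 : ConstraintKind) (φ : CNF) :
    (program 𝓛).out φ.encode [] = (instOfCNF 𝓛 φ).encode := by
  rw [instOfCNF, ← out_emitInstance (n := φ.numVars), ← iterate_double]
  rfl

end SatReduction

namespace RAM

namespace NatExpr

theorem iterate_eq_of_step {f : ℕ → ℕ → ℕ} {v : ℕ → ℕ} (h : ∀ i, f (v i) i = v (i + 1)) (n : ℕ) :
    iterate f (v 0) n = v n := by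
  induction n with
  | zero => rfl
  | succ n ih => rw [iterate, ih, h]

theorem iterate_max_self (z n : ℕ) : iterate (fun a _ => max a a) z n = z :=
  iterate_eq_of_step (v := fun _ => z) (fun _ => max_self z) n

theorem iterate_max_add (z c n : ℕ) :
    iterate (fun a _ => max a (a + 1 + c)) z n = z + n * (1 + c) := by
  have h : ∀ i, max (z + i * (1 + c)) (z + i * (1 + c) + 1 + c) = z + (i + 1) * (1 + c) := by
    intro i
    rw [max_eq_right (by omega)]
    ring
  simpa using iterate_eq_of_step (v := fun i => z + i * (1 + c)) h n

theorem iterate_max_double (n : ℕ) : iterate (fun a _ => max a (a * 2)) 1 n = 2 ^ n :=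
  iterate_eq_of_step (f := fun a _ => max a (a * 2)) (v := (2 ^ ·))
    (fun i => by rw [max_eq_right (by omega), pow_succ]) n

end NatExpr

theorem SolvableInTime.mono {α : Type} {enc : α → List ℕ} {inst inst' yes : α → Prop} {t : α → ℝ}
    (h : SolvableInTime enc inst yes t) (hinst : ∀ x, inst' x → inst x) :
    SolvableInTime enc inst' yes t :=
  let ⟨P, K, c, hP⟩ := h
  ⟨P, K, c, fun x hx => hP x (hinst x hx)⟩

end RAM

namespace SatReduction

open RAM RAM.NatExpr TripleMatch

/-! ### The running time of the reduction -/

section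

variable (B n m r N D Q x y g i k τ : ℕ)

theorem bound_clauseFailsE : clauseFailsE.bound B [n, m, r, N, D, Q, x, y, g, i, k] = 1 := by
  simp only [clauseFailsE, add_eq, sub_eq, mul_eq, div_eq, mod_eq, ofNat_eq, List.cons_append,
    List.nil_append, eqE, bound, List.getD_cons_succ, List.getD_cons_zero, mul_one,
    iterate_max_self]

theorem costBound_clauseFailsE : clauseFailsE.costBound B [n, m, r, N, D, Q, x, y, g, i, k] =
    17 + k * 19 + k * B * 3 + k * B ^ 2 * 2 + k ^ 2 * 2 + k ^ 2 * B * 2 + B * 89 + B * g +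
      B * i + B ^ 2 * 14 := by
  simp only [clauseFailsE, add_eq, sub_eq, mul_eq, div_eq, mod_eq, ofNat_eq, List.cons_append,
    List.nil_append, eqE, bound, costBound, Op.charge, List.getD_cons_succ, List.getD_cons_zero,
    mul_one, iterate_max_self, iterate_max_add]
  ring

theorem costBound_textLetterE :
    textLetterE.costBound B [B, B, B, Q, Q, Q, 40 * Q, 40 * Q] =
      631 + Q * 472 + Q * B * 42 + B * 114 + B ^ 2 * 19 + B ^ 3 * 4 := by
  simp only [textLetterE, textCellE, foldE, add_eq, sub_eq, mul_eq, div_eq, mod_eq, ofNat_eq,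
    List.cons_append, List.nil_append, eqE, bound, costBound, Op.charge, List.getD_cons_succ,
    List.getD_cons_zero, bound_clauseFailsE, costBound_clauseFailsE]
  ring

theorem costBound_patLetterE :
    patLetterE.costBound B [B, B, B, Q, Q, Q, 2 * Q, 2 * Q] = 56 + Q * 10 + B := by
  simp only [patLetterE, foldE, add_eq, sub_eq, mul_eq, mod_eq, ofNat_eq, List.cons_append,
    List.nil_append, bound, costBound, Op.charge, List.getD_cons_succ, List.getD_cons_zero]
  ring

theorem bound_pairKindE : pairKindE.bound B [B, B, B, Q, Q, Q, Q, Q] = 3 := by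
  simp only [pairKindE, add_eq, sub_eq, mul_eq, div_eq, mod_eq, ofNat_eq, List.cons_append,
    List.nil_append, bound, List.getD_cons_succ, List.getD_cons_zero, bound_clauseFailsE]

theorem costBound_pairKindE :
    pairKindE.costBound B [B, B, B, Q, Q, Q, Q, Q] =
      68 + B * 113 + B * Q + B ^ 2 * 19 + B ^ 3 * 4 := by
  simp only [pairKindE, add_eq, sub_eq, mul_eq, div_eq, mod_eq, ofNat_eq, List.cons_append,
    List.nil_append, bound, costBound, Op.charge, List.getD_cons_succ, List.getD_cons_zero,
    bound_clauseFailsE, costBound_clauseFailsE]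
  ring

theorem cost_powE_le (inp : List ℕ) :
    powE.cost inp [n, m, r] ≤ 7 + r * 11 + r * 2 ^ r * 2 := by
  refine (powE.cost_le_costBound (fun v hv => List.le_sum_of_mem hv) (β := [n, m, r])
    ⟨rfl, fun _ => le_rfl⟩).trans_eq ?_
  simp only [powE, mul_eq, ofNat_eq, List.cons_append, List.nil_append, bound, costBound,
    Op.charge, List.getD_cons_succ, List.getD_cons_zero, iterate_max_double]
  ring

end

section

variable (𝓛 : ConstraintKind)

theorem exists_costBound_emitCase (t : ℕ) : ∃ K : ℕ, ∀ B n m r N D Q x i τ : ℕ,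
    (emitCase 𝓛 t).costBound B [n, m, r, N, D, Q, x, i, τ] = K + τ := by
  refine ⟨18 + 3 * t + (Gen.emitList (𝓛.encode (rep 𝓛 t))).costBound 0 [],
    fun B n m r N D Q x i τ => ?_⟩
  simp only [emitCase, Gen.costBound, Gen.costBound_emitList B, add_eq, sub_eq, ofNat_eq,
    List.cons_append, List.nil_append, eqE, bound, costBound, Op.charge, List.getD_cons_succ,
    List.getD_cons_zero]
  ring

theorem exists_costBound_emitKind : ∃ K : ℕ, ∀ B n m r N D Q x i τ : ℕ,
    (emitKind 𝓛).costBound B [n, m, r, N, D, Q, x, i, τ] = K + τ * 5 := by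
  choose K hK using exists_costBound_emitCase 𝓛
  refine ⟨K 0 + K 1 + K 2 + K 3 + K 4, fun B n m r N D Q x i τ => ?_⟩
  simp only [emitKind, Gen.costBound, hK]
  ring

theorem exists_costBound_emitInstance : ∃ K : ℕ, ∀ B Q : ℕ, 1 ≤ B → 1 ≤ Q →
    (emitInstance 𝓛).costBound B [B, B, B, Q, Q, Q] ≤ K * (B ^ 3 * Q ^ 2) := by
  obtain ⟨K, hK⟩ := exists_costBound_emitKind 𝓛
  refine ⟨52372 + 3 * K, fun B Q hB hQ => ?_⟩
  simp only [emitInstance, emitText, emitPattern, emitPairs, emitLeft, emitRight, emitConstraint,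
    leftKindE, rightKindE, Gen.costBound, add_eq, sub_eq, mul_eq, mod_eq, ofNat_eq,
    List.cons_append, List.nil_append, eqE, bound, costBound, Op.charge, List.getD_cons_succ,
    List.getD_cons_zero, costBound_textLetterE, costBound_patLetterE, costBound_pairKindE,
    bound_pairKindE, hK]
  have monomial_le : ∀ b ≤ 3, ∀ q ≤ 2, B ^ b * Q ^ q ≤ B ^ 3 * Q ^ 2 := fun b hb q hq =>
    Nat.mul_le_mul (Nat.pow_le_pow_right hB hb) (Nat.pow_le_pow_right hQ hq)
  linarith [monomial_le 0 (by omega) 0 (by omega), monomial_le 0 (by omega) 1 (by omega),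
    monomial_le 1 (by omega) 1 (by omega), monomial_le 2 (by omega) 1 (by omega),
    monomial_le 3 (by omega) 1 (by omega), monomial_le 0 (by omega) 2 (by omega),
    monomial_le 1 (by omega) 2 (by omega),
    Nat.mul_le_mul_left K (monomial_le 0 (by omega) 1 (by omega))]

theorem cost_program (n m : ℕ) (l : List ℕ) :
    (program 𝓛).cost (n :: m :: l) [] =
      (emitInstance 𝓛).cost (n :: m :: l) [n, m, groupSize n, 2 ^ groupSize n,
        patHalf (2 ^ groupSize n) m, textHalf (2 ^ groupSize n) m] +
      powE.cost (n :: m :: l) [n, m, groupSize n] + n / 3 + 2 * m + 3 * 2 ^ groupSize n +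
      patHalf (2 ^ groupSize n) m + textHalf (2 ^ groupSize n) m + 38 := by
  have eval_powE : powE.eval (n :: m :: l) [n, m, groupSize n] = 2 ^ groupSize n :=
    iterate_double _
  simp only [program, Gen.cost, cost, eval, Op.charge, Op.apply, add_eq, sub_eq, mul_eq, div_eq,
    ofNat_eq, List.cons_append, List.nil_append, List.getD_cons_succ, List.getD_cons_zero,
    show n / 3 + 1 = groupSize n from rfl, eval_powE]
  simp only [patHalf, textHalf]
  rw [groupSize]
  ring

theorem exists_cost_program_le : ∃ K : ℕ, ∀ {n m B : ℕ} {l : List ℕ}, 1 ≤ B →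
    (∀ x ∈ n :: m :: l, x ≤ B) →
    (program 𝓛).cost (n :: m :: l) [] ≤ K * (B ^ 3 * textHalf (2 ^ groupSize n) m ^ 2) := by
  obtain ⟨K, hK⟩ := exists_costBound_emitInstance 𝓛
  refine ⟨K + 100, fun {n m B l} hB₁ hB => ?_⟩
  have hn : n ≤ B := hB n (by simp)
  have hm : m ≤ B := hB m (by simp)
  have hr : groupSize n ≤ B := by unfold groupSize; omega
  have hN := two_le_two_pow_groupSize n
  have hpow := cost_powE_le n m (groupSize n) (n :: m :: l)
  rw [cost_program]
  generalize groupSize n = r at *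
  generalize 2 ^ r = N at *
  have hND : N ≤ patHalf N m := Nat.le_mul_of_pos_right _ m.succ_pos
  have hDQ : patHalf N m ≤ textHalf N m := patHalf_le_textHalf (by omega)
  generalize patHalf N m = D at *
  generalize textHalf N m = Q at *
  have hbelow : Below [n, m, r, N, D, Q] [B, B, B, Q, Q, Q] :=
    (((((Below.nil.append hn).append hm).append hr).append (hND.trans hDQ)).append hDQ).append
      (le_refl Q)
  have hinst := ((emitInstance 𝓛).cost_le_costBound hB hbelow).trans (hK B Q hB₁ (by omega))
  have hrN : r * N ≤ B * Q := Nat.mul_le_mul hr (by omega)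
  have hBQ : B * Q ≤ B ^ 3 * Q ^ 2 :=
    Nat.mul_le_mul (Nat.le_self_pow (by omega) B) (Nat.le_self_pow (by omega) Q)
  have hB_le : B ≤ B * Q := Nat.le_mul_of_pos_right _ (by omega)
  have hQ_le : Q ≤ B * Q := Nat.le_mul_of_pos_left _ (by omega)
  have hn_div : n / 3 ≤ n := Nat.div_le_self _ _
  rw [add_mul]
  linarith

end

theorem le_of_mem_encode {φ : CNF} {k : ℕ} (hφ : φ.IsKCNF k) {x : ℕ} (hx : x ∈ φ.encode) :
    x ≤ 2 * φ.numVars + φ.clauses.length + k + 1 := by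
  simp only [CNF.encode, List.cons_append, List.nil_append, List.mem_cons, List.mem_flatMap,
    List.mem_map] at hx
  rcases hx with rfl | rfl | ⟨c, hc, rfl | ⟨l, -, rfl⟩⟩
  · omega
  · omega
  · have := hφ c hc
    omega
  · have hvar := l.1.2
    have hsign := l.2.toNat_le
    omega

theorem rpow_le_rpow_abs_mul_rpow {x y c : ℝ} (g : ℝ) (hx : 0 < x) (hxy : x ≤ y) (hc : 1 ≤ c)
    (hy : y ≤ c * x) : y ^ g ≤ c ^ |g| * x ^ g := by
  rcases le_total 0 g with hg | hg
  · rw [abs_of_nonneg hg, ← Real.mul_rpow (by linarith) hx.le]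
    exact Real.rpow_le_rpow (by linarith) hy hg
  · refine (Real.rpow_le_rpow_of_nonpos hx hxy hg).trans ?_
    exact le_mul_of_one_le_left (Real.rpow_nonneg hx.le g) (Real.one_le_rpow hc (abs_nonneg g))

theorem add_one_le_two_rpow (n : ℕ) : (n : ℝ) + 1 ≤ 72 * (2 : ℝ) ^ ((n : ℝ) / 36) := by
  have hexp := Real.add_one_le_exp (Real.log 2 * ((n : ℝ) / 36))
  rw [← Real.rpow_def_of_pos two_pos] at hexp
  have hlog := Real.log_two_gt_d9
  have hn : (0 : ℝ) ≤ n := n.cast_nonneg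
  nlinarith

theorem two_pow_groupSize_le (n : ℕ) : (2 : ℝ) ^ groupSize n ≤ 2 * (2 : ℝ) ^ ((n : ℝ) / 3) := by
  rw [groupSize, pow_succ, mul_comm, ← Real.rpow_natCast]
  gcongr
  · norm_num
  · exact Nat.cast_div_le

theorem add_one_pow_mul_two_pow_le (n : ℕ) {δ : ℝ} (hδ : 3 / 4 ≤ δ) :
    ((n : ℝ) + 1) ^ 3 * ((2 : ℝ) ^ groupSize n) ^ 2 ≤ 72 ^ 3 * 4 * (2 : ℝ) ^ ((n : ℝ) * δ) :=
  calc ((n : ℝ) + 1) ^ 3 * ((2 : ℝ) ^ groupSize n) ^ 2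
      ≤ (72 * (2 : ℝ) ^ ((n : ℝ) / 36)) ^ 3 * (2 * (2 : ℝ) ^ ((n : ℝ) / 3)) ^ 2 := by
        gcongr
        exacts [add_one_le_two_rpow n, two_pow_groupSize_le n]
    _ = 72 ^ 3 * 4 * (2 : ℝ) ^ ((n : ℝ) * (3 / 4)) := by
        rw [mul_pow, mul_pow, ← Real.rpow_mul_natCast zero_le_two,
          ← Real.rpow_mul_natCast zero_le_two, mul_mul_mul_comm, ← Real.rpow_add two_pos]
        norm_num
        ring_nf
    _ ≤ _ := by
        gcongr
        exact one_le_two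

/-- The time, up to a constant factor, in which the reduction would decide formulas with `n`
variables and `m` clauses. -/
noncomputable def satTime (δ : ℝ) (n m : ℕ) : ℝ := (2 : ℝ) ^ ((n : ℝ) * δ) * ((m : ℝ) + 1) ^ 5

theorem one_le_satTime {δ : ℝ} (hδ : 0 ≤ δ) (n m : ℕ) : 1 ≤ satTime δ n m :=
  one_le_mul_of_one_le_of_one_le (Real.one_le_rpow one_le_two (by positivity))
    (one_le_pow₀ (le_add_of_nonneg_left m.cast_nonneg))

theorem exists_cost_program_le_satTime (𝓛 : ConstraintKind) (k : ℕ) {δ : ℝ} (hδ : 3 / 4 ≤ δ) :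
    ∃ K : ℕ, ∀ φ : CNF, φ.IsKCNF k →
      ((program 𝓛).cost φ.encode [] : ℝ) ≤ K * satTime δ φ.numVars φ.clauses.length := by
  obtain ⟨K, hK⟩ := exists_cost_program_le 𝓛
  refine ⟨K * (k + 2) ^ 3 * 9 * (72 ^ 3 * 4), fun φ hφ => ?_⟩
  have hcost : (program 𝓛).cost φ.encode [] ≤ K * ((2 * φ.numVars + φ.clauses.length + k + 1) ^ 3 *
      textHalf (2 ^ groupSize φ.numVars) φ.clauses.length ^ 2) :=
    hK (by omega) fun x => le_of_mem_encode hφ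
  generalize (program 𝓛).cost φ.encode [] = T at *
  generalize φ.clauses.length = m at *
  generalize φ.numVars = n at *
  have hB : 2 * n + m + k + 1 ≤ (k + 2) * ((n + 1) * (m + 1)) := by
    have := Nat.zero_le (k * n * m + 2 * n * m + k * n + k * m + m + 1)
    linarith
  have hQ : textHalf (2 ^ groupSize n) m ≤ 3 * 2 ^ groupSize n * (m + 1) :=
    Nat.mul_le_mul_right _ (Nat.sub_le _ _)
  calc (T : ℝ)
      ≤ K * (((k + 2) * ((n + 1) * (m + 1))) ^ 3 * (3 * 2 ^ groupSize n * (m + 1)) ^ 2) :=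
        mod_cast hcost.trans (by gcongr)
    _ = K * (k + 2) ^ 3 * 9 * (((n : ℝ) + 1) ^ 3 * (2 ^ groupSize n) ^ 2) * (m + 1) ^ 5 := by ring
    _ ≤ K * (k + 2) ^ 3 * 9 * (72 ^ 3 * 4 * (2 : ℝ) ^ ((n : ℝ) * δ)) * (m + 1) ^ 5 := by
        gcongr ?_ * ?_ * ?_
        exact add_one_pow_mul_two_pow_le n hδ
    _ = _ := by
        rw [satTime]
        push_cast
        ring

theorem patHalf_rpow_le {δ s : ℝ} (hδ₀ : 0 ≤ δ) (hδ₁ : δ ≤ 1) (hs : s ≤ 3 * δ) (n m : ℕ) :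
    (patHalf (2 ^ groupSize n) m : ℝ) ^ s ≤ 8 * satTime δ n m := by
  have hm : 1 ≤ (m : ℝ) + 1 := le_add_of_nonneg_left m.cast_nonneg
  calc (patHalf (2 ^ groupSize n) m : ℝ) ^ s ≤ (patHalf (2 ^ groupSize n) m : ℝ) ^ (3 * δ) := by
        refine Real.rpow_le_rpow_of_exponent_le ?_ hs
        exact_mod_cast one_le_two.trans (two_le_patHalf (two_le_two_pow_groupSize n))
    _ = ((2 : ℝ) ^ groupSize n) ^ (3 * δ) * ((m : ℝ) + 1) ^ (3 * δ) := by
        rw [← Real.mul_rpow (by positivity) (by positivity), patHalf]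
        push_cast
        rfl
    _ ≤ (2 * (2 : ℝ) ^ ((n : ℝ) / 3)) ^ (3 * δ) * ((m : ℝ) + 1) ^ (5 : ℝ) := by
        gcongr
        · exact two_pow_groupSize_le n
        · linarith
    _ = (2 : ℝ) ^ (3 * δ) * satTime δ n m := by
        rw [Real.mul_rpow zero_le_two (by positivity), ← Real.rpow_mul zero_le_two,
          show (n : ℝ) / 3 * (3 * δ) = n * δ by ring, mul_assoc, satTime]
        norm_cast
    _ ≤ (2 : ℝ) ^ (3 : ℝ) * satTime δ n m := by
        have := zero_le_one.trans (one_le_satTime hδ₀ n m)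
        gcongr
        · exact one_le_two
        · linarith
    _ = 8 * satTime δ n m := by norm_num

theorem length_rpow_mul_length_rpow_le (𝓛 : ConstraintKind) (φ : CNF) (g h : ℝ) :
    ((instOfCNF 𝓛 φ).text.length : ℝ) ^ g * ((instOfCNF 𝓛 φ).constraints.length : ℝ) ^ h ≤
      120 ^ |g| * 3 ^ |h| *
        (patHalf (2 ^ groupSize φ.numVars) φ.clauses.length : ℝ) ^ (g + h) := by
  change ((text _ _ _).length : ℝ) ^ g * ((constraints _ _ _ _).length : ℝ) ^ h ≤ _
  rw [length_text, length_constraints]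
  have hN := two_le_two_pow_groupSize φ.numVars
  generalize φ.clauses.length = m
  generalize 2 ^ groupSize φ.numVars = N at *
  have hD := two_le_patHalf (m := m) hN
  have hDQ := patHalf_le_textHalf (m := m) (N := N) (by omega)
  have hQD : textHalf N m ≤ 3 * patHalf N m := by
    rw [patHalf, ← mul_assoc]
    exact Nat.mul_le_mul_right _ (Nat.sub_le _ _)
  generalize patHalf N m = D at *
  generalize textHalf N m = Q at *
  have hD₀ : (0 : ℝ) < D := by exact_mod_cast (by omega : 0 < D)
  rw [Real.rpow_add hD₀, mul_mul_mul_comm]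
  gcongr
  · exact rpow_le_rpow_abs_mul_rpow g hD₀ (by exact_mod_cast (by omega : D ≤ 40 * Q))
      (by norm_num) (by exact_mod_cast (by omega : 40 * Q ≤ 120 * D))
  · exact rpow_le_rpow_abs_mul_rpow h hD₀ (by exact_mod_cast (by omega : D ≤ D + 2 * (D - 1)))
      (by norm_num) (by exact_mod_cast (by omega : D + 2 * (D - 1) ≤ 3 * D))

theorem exists_time_instOfCNF_le_satTime (𝓛 : ConstraintKind) {g h δ : ℝ} (hδ₀ : 0 ≤ δ)
    (hδ₁ : δ ≤ 1) (hgh : g + h ≤ 3 * δ) : ∃ K : ℕ, ∀ φ : CNF,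
      ((instOfCNF 𝓛 φ).text.length : ℝ) ^ g * ((instOfCNF 𝓛 φ).constraints.length : ℝ) ^ h ≤
        K * satTime δ φ.numVars φ.clauses.length := by
  obtain ⟨K, hK⟩ := exists_nat_ge ((120 : ℝ) ^ |g| * 3 ^ |h| * 8)
  refine ⟨K, fun φ => ?_⟩
  have hone := one_le_satTime hδ₀ φ.numVars φ.clauses.length
  calc _ ≤ 120 ^ |g| * 3 ^ |h| * _ := length_rpow_mul_length_rpow_le 𝓛 φ g h
    _ ≤ 120 ^ |g| * 3 ^ |h| * (8 * satTime δ φ.numVars φ.clauses.length) := by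
        gcongr
        exact patHalf_rpow_le hδ₀ hδ₁ hgh _ _
    _ ≤ K * satTime δ φ.numVars φ.clauses.length := by
        rw [← mul_assoc]
        gcongr

theorem isMatch_instOfCNF_iff (𝓛 : ConstraintKind) (φ : CNF) :
    (instOfCNF 𝓛 φ).IsMatch ↔ φ.Satisfiable :=
  (isMatch_inst_iff 𝓛 _ (clauseFails_le φ.encode _)).trans (satisfiable_iff φ).symm

theorem not_solvableInTime (hSETH : SETH) (𝓛 : ConstraintKind) {g h : ℝ} (hgh : g + h < 3) :
    ¬ SolvableInTime (MatchInstance.encode (𝓛 := 𝓛))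
      (fun I => I.NonIntersecting ∧ ∀ C ∈ I.constraints, C.size ≤ 126) (fun I => I.IsMatch)
      (fun I => (I.text.length : ℝ) ^ g * (I.constraints.length : ℝ) ^ h) := by
  intro hsol
  obtain ⟨δ, hδ, hδ₁, hghδ⟩ : ∃ δ : ℝ, 3 / 4 ≤ δ ∧ δ < 1 ∧ g + h ≤ 3 * δ :=
    ⟨max (3 / 4) ((g + h) / 3), le_max_left _ _, max_lt (by norm_num) (by linarith), by
      linarith [le_max_right (3 / 4) ((g + h) / 3)]⟩
  have hδ₀ : 0 ≤ δ := le_trans (by norm_num) hδ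
  obtain ⟨k, hk⟩ := hSETH (1 - δ) (by linarith)
  obtain ⟨K₁, hcost⟩ := exists_cost_program_le_satTime 𝓛 k hδ
  obtain ⟨K₂, htime⟩ := exists_time_instOfCNF_le_satTime 𝓛 hδ₀ hδ₁.le hghδ
  have hone := fun φ : CNF => one_le_satTime hδ₀ φ.numVars φ.clauses.length
  have hmax : ∀ {K : ℕ} {φ : CNF}, K ≤ max K₁ K₂ → (K : ℝ) * satTime δ φ.numVars φ.clauses.length ≤
      (max K₁ K₂ : ℕ) * satTime δ φ.numVars φ.clauses.length := fun hK =>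
    mul_le_mul_of_nonneg_right (Nat.cast_le.2 hK) (zero_le_one.trans (hone _))
  refine hk 5 ?_
  rw [sub_sub_cancel]
  exact hsol.of_reduction (program 𝓛) (instOfCNF 𝓛) (max K₁ K₂) (fun φ _ => hone φ)
    (fun φ _ => ⟨nonIntersecting_inst 𝓛 _, size_le_of_mem_inst 𝓛 _⟩)
    (fun φ _ => isMatch_instOfCNF_iff 𝓛 φ) (fun φ _ => out_program 𝓛 φ)
    (fun φ hφ => (hcost φ hφ).trans (hmax (le_max_left _ _)))
    (fun φ _ => (htime φ).trans (hmax (le_max_right _ _)))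

end SatReduction

theorem mainTheorem5 (hSETH : SETH) :
    (∀ (𝓛 : ConstraintKind) (g h : ℝ), g + h < 3 →
      ¬ RAM.SolvableInTime (MatchInstance.encode (𝓛 := 𝓛))
        (fun I => I.NonIntersecting) (fun I => I.IsMatch)
        (fun I => (I.text.length : ℝ) ^ g * (I.constraints.length : ℝ) ^ h)) ∧
    -- the same, already for constraints of constant size
    ∃ s : ℕ, ∀ (𝓛 : ConstraintKind) (g h : ℝ), g + h < 3 →
      ¬ RAM.SolvableInTime (MatchInstance.encode (𝓛 := 𝓛))
        (fun I => I.NonIntersecting ∧ ∀ C ∈ I.constraints, C.size ≤ s) (fun I => I.IsMatch)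
        (fun I => (I.text.length : ℝ) ^ g * (I.constraints.length : ℝ) ^ h) :=
  have hardness := fun (𝓛 : ConstraintKind) (g h : ℝ) (hgh : g + h < 3) =>
    SatReduction.not_solvableInTime hSETH 𝓛 hgh
  ⟨fun 𝓛 g h hgh hsol => hardness 𝓛 g h hgh (hsol.mono fun _ hI => hI.1), 126, hardness⟩
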